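/- For $s\in[0,\pi/2)$ let $\mathcal R_s$ be the family of all nonempty bounded open rectangles $R\subset\mathbb R^2$ (with arbitrary side lengths) having one pair of sides parallel to $(\cos s,\sin s)$ and the other parallel to $(-\sin s,\cos s)$. For $f\in L^1(\mathbb R^2)$ (real-valued), say that $\mathcal R_s$ differentiates $\int f$ if for almost every $x\in\mathbb R^2$ $$\lim_{\operatorname{diam}(R)\to 0,\ x\in R\in\mathcal R_s}\frac1{|R|}\int_R f=f(x),$$ and let $$\overline D_sf(x)=\limsup_{\operatorname{diam}(R)\to 0,\ x\in R\in\mathcal R_s}\frac1{|R|}\int_R f\in[-\infty,\infty].$$ A set $S\subset[0,\pi/2)$ is called an $R$-set if there is a single function $f\in L^1(\mathbb R^2)$ such that $\mathcal R_s$ differentiates $\int f$ for every $s\in[0,\pi/2)\setminus S$, while $\overline D_sf(x)=\infty$ for almost every $x\in\mathbb R^2$, for every $s\in S$. **Theorem.** A set $S\subset[0,\pi/2)$ is an $R$-set if and only if it is a $G_\delta$ set in $[0,\pi/2)$, that is, $S=\big(\bigcap_{k=1}^\infty G_k\big)\cap[0,\pi/2)$ for some open sets $G_k\subset\mathbb R$.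 -/

import Mathlib

open MeasureTheory Filter Topology

/-- The Euclidean plane. -/
abbrev Plane : Type := EuclideanSpace ℝ (Fin 2)

/-- The coordinate of `x` along the unit vector `(cos s, sin s)`. -/
noncomputable def coordAlong (s : ℝ) (x : Plane) : ℝ :=
  x 0 * Real.cos s + x 1 * Real.sin s

/-- The coordinate of `x` along the orthogonal unit vector `(-sin s, cos s)`. -/
noncomputable def coordAcross (s : ℝ) (x : Plane) : ℝ :=
  -(x 0 * Real.sin s) + x 1 * Real.cos s

/-- The family of all nonempty bounded open rectangles in the plane with slope `s`, that is, with
one pair of sides in the direction `(cos s, sin s)` and the other in the direction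
`(-sin s, cos s)`; the two side lengths are arbitrary and independent of each other. -/
def rectBasis (s : ℝ) : Set (Set Plane) :=
  {R | ∃ a b c d : ℝ, a < b ∧ c < d ∧
    R = {x | coordAlong s x ∈ Set.Ioo a b ∧ coordAcross s x ∈ Set.Ioo c d}}

/-- The filter on sets of the plane describing `diam R → 0` with `x ∈ R ∈ rectBasis s`. -/
noncomputable def rectFilter (s : ℝ) (x : Plane) : Filter (Set Plane) :=
  comap (fun R : Set Plane => Metric.diam R) (𝓝 0) ⊓ 𝓟 {R | R ∈ rectBasis s ∧ x ∈ R}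

/-- The basis of rectangles of slope `s` differentiates the integral of `f`: at almost every `x`
the averages of `f` over the rectangles `R ∋ x` of slope `s` tend to `f x` as `diam R → 0`. -/
def DifferentiatesIntegral (s : ℝ) (f : Plane → ℝ) : Prop :=
  ∀ᵐ x ∂(volume : Measure Plane),
    Tendsto (fun R : Set Plane => ⨍ y in R, f y ∂volume) (rectFilter s x) (𝓝 (f x))

/-- The upper derivative of the integral of `f` at `x` with respect to the rectangles of slope `s`,
as an extended real number. -/
noncomputable def upperDerivative (s : ℝ) (f : Plane → ℝ) (x : Plane) : EReal :=
  limsup (fun R : Set Plane => ((⨍ y in R, f y ∂volume : ℝ) : EReal)) (rectFilter s x)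

/-- `S` is an `R`-set: a single integrable function `f` on the plane has its integral differentiated
by the rectangles of each slope `s ∈ [0, π/2) \ S`, and has infinite upper derivative almost
everywhere for each slope `s ∈ S`. -/
def IsRSet (S : Set ℝ) : Prop :=
  ∃ f : Plane → ℝ, Integrable f (volume : Measure Plane) ∧
    (∀ s ∈ Set.Ico 0 (Real.pi / 2) \ S, DifferentiatesIntegral s f) ∧
    (∀ s ∈ S, ∀ᵐ x ∂(volume : Measure Plane), upperDerivative s f x = ⊤)

/-! Necessity is soft. With the sides fixed, the integral of an integrable function over `Rc s a b c
d` is continuous in `s`, so lying in a small rectangle of slope `s` with average above `n` is an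
open condition on `s`. By continuity of measure from below, so is the condition that such points
fill more than half of a unit square. For `s ∈ S` this holds for every `n`. If slope `s`
differentiates the integral, the sets of such points decrease to a null set and the condition fails
for some `n`. Hence `S` is a countable intersection of open sets (`isGδ_of_integrable`).

Sufficiency rests on functions that are wild for slopes in a short interval and harmless for slopes
outside a larger one, modulo `π / 2` because a rectangle has two side directions. The germ is
`exists_block`: a bump on a strip of width `w` along a parabola, minus its translate by `w`. A half
plane whose boundary is tangent to the translated parabola misses the negative part but captures a
positive piece of length about `√(w / t)`, so its integral is of order `w ^ (3 / 2)`. The parabola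
has a tangent in each direction of a whole interval. A rectangle with transversal sides sees only
the places where its boundary crosses the strip, which contribute `O(w ^ 2)`. Taking `w` small makes
the ratio as small as desired.

Copies of size `δ` times the cell are placed at the centers of a lattice of cells. In a good
direction, a point in a hyperbolic region of its cell lies in a rectangle of area of order `δ`
(relative to the cell) which cuts the central copy along a good half plane, so the average is at
least of order `δ m`. The hyperbolic region has measure of order `δ log (1 / δ)`. With `n` lattice
generations, `n δ log (1 / δ)` about `Λ`, all but a proportion of roughly `exp (-Λ)` of the points
are served (`volume_uncovered_le`, `volume_not_good_le`). After normalizing the averages, the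
integral norm is of order `n δ`, about `Λ / log (1 / δ)`, hence small.

In transversal directions, large rectangles see only the blocks near their boundary, since blocks
have mean zero. Thin rectangles are controlled by a one-dimensional maximal inequality along the
long side, with weights decaying hyperbolically across it (`volume_bad_half_le`). The resulting
logarithm is multiplied by the small ratio obtained from the block. These estimates combine in
`exists_group`.

Finally `S` is the intersection of open sets `G k`, each split into Whitney intervals. A slope in
`S` belongs to one interval for every `k`; a slope outside `S` is transversal to all but finitely
many of them (`exists_intervals`). One group per interval, with rapidly decreasing parameters, is
summed. Borel–Cantelli turns the measure bounds into almost everywhere statements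
(`ae_differentiates`, `ae_large_averages`). -/

/-! ### Rotated coordinates and rectangles in `ℝ × ℝ`. -/

/-- The coordinate of `p` along the direction `(cos s, sin s)`. -/
noncomputable def al (s : ℝ) (p : ℝ × ℝ) : ℝ := p.1 * Real.cos s + p.2 * Real.sin s

/-- The coordinate of `p` along the direction `(-sin s, cos s)`. -/
noncomputable def ac (s : ℝ) (p : ℝ × ℝ) : ℝ := -(p.1 * Real.sin s) + p.2 * Real.cos s

/-- The open rectangle of slope `s` given by its sides in rotated coordinates. -/
def Rc (s a b c d : ℝ) : Set (ℝ × ℝ) := {p | al s p ∈ Set.Ioo a b ∧ ac s p ∈ Set.Ioo c d}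

lemma al_sub (s : ℝ) (p q : ℝ × ℝ) : al s (p - q) = al s p - al s q := by
  simp only [al, Prod.fst_sub, Prod.snd_sub]; ring

lemma ac_sub (s : ℝ) (p q : ℝ × ℝ) : ac s (p - q) = ac s p - ac s q := by
  simp only [ac, Prod.fst_sub, Prod.snd_sub]; ring

lemma al_add (s : ℝ) (p q : ℝ × ℝ) : al s (p + q) = al s p + al s q := by
  simp only [al, Prod.fst_add, Prod.snd_add]; ring

lemma ac_add (s : ℝ) (p q : ℝ × ℝ) : ac s (p + q) = ac s p + ac s q := by
  simp only [ac, Prod.fst_add, Prod.snd_add]; ring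

lemma al_smul (s r : ℝ) (p : ℝ × ℝ) : al s (r • p) = r * al s p := by
  simp only [al, Prod.smul_fst, Prod.smul_snd, smul_eq_mul]; ring

lemma ac_smul (s r : ℝ) (p : ℝ × ℝ) : ac s (r • p) = r * ac s p := by
  simp only [ac, Prod.smul_fst, Prod.smul_snd, smul_eq_mul]; ring

lemma al_add_pi_div_two (s : ℝ) (p : ℝ × ℝ) : al (s + Real.pi / 2) p = ac s p := by
  simp only [al, ac, Real.cos_add_pi_div_two, Real.sin_add_pi_div_two]; ring

lemma ac_add_pi_div_two (s : ℝ) (p : ℝ × ℝ) : ac (s + Real.pi / 2) p = -al s p := by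
  simp only [al, ac, Real.cos_add_pi_div_two, Real.sin_add_pi_div_two]; ring

lemma al_eq_rotate (s c : ℝ) (p : ℝ × ℝ) :
    al s p = Real.cos (s - c) * al c p + Real.sin (s - c) * ac c p := by
  have h1 := Real.cos_sq_add_sin_sq c
  simp only [al, ac, Real.cos_sub, Real.sin_sub]
  linear_combination (-(p.1 * Real.cos s) - p.2 * Real.sin s) * h1

lemma ac_eq_rotate (s c : ℝ) (p : ℝ × ℝ) :
    ac s p = -(Real.sin (s - c) * al c p) + Real.cos (s - c) * ac c p := by
  have h1 := Real.cos_sq_add_sin_sq c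
  simp only [al, ac, Real.cos_sub, Real.sin_sub]
  linear_combination (p.1 * Real.sin s - p.2 * Real.cos s) * h1

lemma fst_eq_al_ac (s : ℝ) (p : ℝ × ℝ) :
    p.1 = al s p * Real.cos s - ac s p * Real.sin s := by
  have h1 := Real.cos_sq_add_sin_sq s
  simp only [al, ac]
  linear_combination -p.1 * h1

lemma snd_eq_al_ac (s : ℝ) (p : ℝ × ℝ) :
    p.2 = al s p * Real.sin s + ac s p * Real.cos s := by
  have h1 := Real.cos_sq_add_sin_sq s
  simp only [al, ac]
  linear_combination -p.2 * h1

lemma abs_mul_add_mul_le {x y u v A B : ℝ} (hx : |x| ≤ 1) (hy : |y| ≤ 1) (hu : |u| ≤ A)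
    (hv : |v| ≤ B) : |u * x + v * y| ≤ A + B := by
  have h1 : |u * x| ≤ A := by
    rw [abs_mul]; nlinarith [abs_nonneg x, abs_nonneg u]
  have h2 : |v * y| ≤ B := by
    rw [abs_mul]; nlinarith [abs_nonneg y, abs_nonneg v]
  exact (abs_add_le _ _).trans (by linarith)

lemma abs_al_le (s : ℝ) {p : ℝ × ℝ} {A B : ℝ} (h1 : |p.1| ≤ A) (h2 : |p.2| ≤ B) :
    |al s p| ≤ A + B :=
  abs_mul_add_mul_le (Real.abs_cos_le_one s) (Real.abs_sin_le_one s) h1 h2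

lemma abs_ac_le (s : ℝ) {p : ℝ × ℝ} {A B : ℝ} (h1 : |p.1| ≤ A) (h2 : |p.2| ≤ B) :
    |ac s p| ≤ A + B := by
  have := abs_mul_add_mul_le (x := -Real.sin s) (by simpa using Real.abs_sin_le_one s)
    (Real.abs_cos_le_one s) h1 h2
  simpa [ac] using this

lemma abs_fst_le (s : ℝ) {p : ℝ × ℝ} {A B : ℝ} (h1 : |al s p| ≤ A) (h2 : |ac s p| ≤ B) :
    |p.1| ≤ A + B := by
  rw [fst_eq_al_ac s p]
  have := abs_mul_add_mul_le (y := -Real.sin s) (Real.abs_cos_le_one s)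
    (by simpa using Real.abs_sin_le_one s) h1 h2
  simpa [sub_eq_add_neg] using this

lemma abs_snd_le (s : ℝ) {p : ℝ × ℝ} {A B : ℝ} (h1 : |al s p| ≤ A) (h2 : |ac s p| ≤ B) :
    |p.2| ≤ A + B := by
  rw [snd_eq_al_ac s p]
  exact abs_mul_add_mul_le (Real.abs_sin_le_one s) (Real.abs_cos_le_one s) h1 h2

@[fun_prop]
lemma continuous_al (s : ℝ) : Continuous (al s) := by unfold al; fun_prop

@[fun_prop]
lemma continuous_ac (s : ℝ) : Continuous (ac s) := by unfold ac; fun_prop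

/-- The change to the orthonormal coordinates of slope `s`. -/
noncomputable def rot (s : ℝ) : (ℝ × ℝ) ≃ₜ (ℝ × ℝ) where
  toFun p := (al s p, ac s p)
  invFun q := (q.1 * Real.cos s - q.2 * Real.sin s, q.1 * Real.sin s + q.2 * Real.cos s)
  left_inv p := Prod.ext (fst_eq_al_ac s p).symm (snd_eq_al_ac s p).symm
  right_inv q := by
    have h1 := Real.cos_sq_add_sin_sq s
    ext
    · simp only [al]; linear_combination q.1 * h1
    · simp only [ac]; linear_combination q.2 * h1
  continuous_toFun := by fun_prop
  continuous_invFun := by fun_prop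

lemma rot_apply (s : ℝ) (p : ℝ × ℝ) : rot s p = (al s p, ac s p) := rfl

lemma measurePreserving_rot (s : ℝ) : MeasurePreserving (rot s) volume volume := by
  refine ⟨(rot s).continuous.measurable, ?_⟩
  set A : Matrix (Fin 2) (Fin 2) ℝ := !![Real.cos s, Real.sin s; -Real.sin s, Real.cos s] with hA
  set T := Matrix.toLin (Module.Basis.finTwoProd ℝ) (Module.Basis.finTwoProd ℝ) A with hT
  have hd : LinearMap.det T = 1 := by
    rw [hT, LinearMap.det_toLin, hA, Matrix.det_fin_two_of]
    nlinarith [Real.cos_sq_add_sin_sq s]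
  have hfun : (rot s : ℝ × ℝ → ℝ × ℝ) = T := by
    funext p
    rw [hT, hA, Matrix.toLin_finTwoProd_apply, rot_apply]
    simp only [al, ac]
    ext <;> simp <;> ring
  rw [hfun, Measure.map_linearMap_addHaar_eq_smul_addHaar _ (by rw [hd]; exact one_ne_zero), hd]
  simp

lemma Rc_eq_preimage (s a b c d : ℝ) :
    Rc s a b c d = rot s ⁻¹' (Set.Ioo a b ×ˢ Set.Ioo c d) := rfl

lemma isOpen_Rc (s a b c d : ℝ) : IsOpen (Rc s a b c d) := by
  rw [Rc_eq_preimage]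
  exact (isOpen_Ioo.prod isOpen_Ioo).preimage (rot s).continuous

lemma measurableSet_Rc (s a b c d : ℝ) : MeasurableSet (Rc s a b c d) :=
  (isOpen_Rc s a b c d).measurableSet

lemma volume_rot_preimage (s : ℝ) (A : Set (ℝ × ℝ)) : volume (rot s ⁻¹' A) = volume A :=
  (measurePreserving_rot s).measure_preimage_emb (rot s).measurableEmbedding A

lemma volume_prod_set (A B : Set ℝ) :
    (volume : Measure (ℝ × ℝ)) (A ×ˢ B) = volume A * volume B := by
  rw [Measure.volume_eq_prod, Measure.prod_prod]

lemma volume_Rc (s a b c d : ℝ) :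
    volume (Rc s a b c d) = ENNReal.ofReal (b - a) * ENNReal.ofReal (d - c) := by
  rw [Rc_eq_preimage, volume_rot_preimage, volume_prod_set, Real.volume_Ioo, Real.volume_Ioo]

lemma volume_real_Rc {s a b c d : ℝ} (hab : a ≤ b) (hcd : c ≤ d) :
    volume.real (Rc s a b c d) = (b - a) * (d - c) := by
  rw [Measure.real, volume_Rc, ENNReal.toReal_mul, ENNReal.toReal_ofReal (by linarith),
    ENNReal.toReal_ofReal (by linarith)]

lemma volume_Rc_lt_top (s a b c d : ℝ) : volume (Rc s a b c d) < ⊤ := by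
  rw [volume_Rc]; exact ENNReal.mul_lt_top ENNReal.ofReal_lt_top ENNReal.ofReal_lt_top

/-- A quarter turn exchanges the two sides. Estimates proved for rectangles whose longer side lies
in the first direction thus extend to all rectangles. -/
lemma Rc_add_pi_div_two (s a b c d : ℝ) :
    Rc (s + Real.pi / 2) c d (-b) (-a) = Rc s a b c d := by
  ext p
  simp only [Rc, Set.mem_ofPred_eq, al_add_pi_div_two, ac_add_pi_div_two, Set.mem_Ioo]
  constructor
  · rintro ⟨⟨h1, h2⟩, h3, h4⟩; exact ⟨⟨by linarith, by linarith⟩, h1, h2⟩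
  · rintro ⟨⟨h1, h2⟩, h3, h4⟩; exact ⟨⟨h3, h4⟩, by linarith, by linarith⟩

lemma integral_comp_rot (s : ℝ) (g : ℝ × ℝ → ℝ) : ∫ p, g (rot s p) = ∫ q, g q :=
  (measurePreserving_rot s).integral_comp (rot s).measurableEmbedding g

/-! ### The dipole along a parabola. -/

/-- The shear `(u, y) ↦ (u, y + t u²)`. -/
def shear (t : ℝ) : (ℝ × ℝ) ≃ₜ (ℝ × ℝ) where
  toFun p := (p.1, p.2 + t * p.1 ^ 2)
  invFun p := (p.1, p.2 - t * p.1 ^ 2)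
  left_inv p := by ext <;> simp
  right_inv p := by ext <;> simp
  continuous_toFun := by fun_prop
  continuous_invFun := by fun_prop

lemma measurePreserving_shear (t : ℝ) : MeasurePreserving (shear t) volume volume := by
  have := (MeasurePreserving.id (volume : Measure ℝ)).skew_product (μc := (volume : Measure ℝ))
    (μd := (volume : Measure ℝ)) (g := fun u y => y + t * u ^ 2) (by fun_prop)
    (Eventually.of_forall fun u => (measurePreserving_add_right volume (t * u ^ 2)).map_eq)
  exact this

lemma volume_shear_preimage (t : ℝ) (A : Set (ℝ × ℝ)) : volume (shear t ⁻¹' A) = volume A :=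
  (measurePreserving_shear t).measure_preimage_emb (shear t).measurableEmbedding A

lemma isClosed_strip_near_line (t w C₁ C₂ e : ℝ) :
    IsClosed {p : ℝ × ℝ | |p.1| ≤ 1 ∧ p.2 - t * p.1 ^ 2 ∈ Set.Icc 0 w ∧
      |C₁ * p.1 + C₂ * p.2 - e| ≤ w} :=
  (isClosed_le (continuous_fst.abs : Continuous fun p : ℝ × ℝ => |p.1|) continuous_const).inter
    ((isClosed_Icc.preimage (by fun_prop : Continuous fun p : ℝ × ℝ => p.2 - t * p.1 ^ 2)).inter
      (isClosed_le (by fun_prop : Continuous fun p : ℝ × ℝ => |C₁ * p.1 + C₂ * p.2 - e|)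
        continuous_const))

/-- Volume of the part of a thin strip around a parabola lying close to a transversal line. -/
lemma volume_strip_near_line_le {t w γ C₁ C₂ e : ℝ} (hγ : 0 < γ) (ht : 0 < t)
    (h : γ ≤ |C₁| - 2 * t * |C₂|) :
    volume {p : ℝ × ℝ | |p.1| ≤ 1 ∧ p.2 - t * p.1 ^ 2 ∈ Set.Icc 0 w ∧
      |C₁ * p.1 + C₂ * p.2 - e| ≤ w} ≤ ENNReal.ofReal (2 * w / γ) * ENNReal.ofReal w := by
  set W := {p : ℝ × ℝ | |p.1| ≤ 1 ∧ p.2 - t * p.1 ^ 2 ∈ Set.Icc 0 w ∧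
      |C₁ * p.1 + C₂ * p.2 - e| ≤ w} with hW
  have hWc : IsClosed W := by
    exact isClosed_strip_near_line t w C₁ C₂ e
  -- The shear flattens the strip to `0 ≤ y ≤ w`. On each horizontal line the difference quotients
  -- of `u ↦ C₁ u + C₂ (y + t u²)` over `|u| ≤ 1` are at least `γ` in absolute value, so the section
  -- has diameter at most `2 w / γ`.
  rw [← volume_shear_preimage t, Measure.volume_eq_prod, Measure.prod_apply_symm
    (hWc.measurableSet.preimage (shear t).continuous.measurable)]
  calc _ ≤ ∫⁻ y, (Set.Icc 0 w).indicator (fun _ => ENNReal.ofReal (2 * w / γ)) y := by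
        refine lintegral_mono fun y => ?_
        by_cases hy : y ∈ Set.Icc 0 w
        · rw [Set.indicator_of_mem hy]
          refine (Real.volume_le_diam _).trans (Metric.ediam_le fun u hu u' hu' => ?_)
          rw [edist_dist]
          refine ENNReal.ofReal_le_ofReal ?_
          simp only [Set.mem_preimage, hW, shear, Homeomorph.homeomorph_mk_coe,
            Equiv.coe_fn_mk, Set.mem_ofPred_eq] at hu hu'
          obtain ⟨hu1, -, hu2⟩ := hu
          obtain ⟨hu1', -, hu2'⟩ := hu'
          rw [Real.dist_eq, le_div_iff₀ hγ]
          have e1 : |(u - u') * (C₁ + C₂ * (t * (u + u')))| ≤ 2 * w := by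
            have : (u - u') * (C₁ + C₂ * (t * (u + u'))) =
              (C₁ * u + C₂ * (y + t * u ^ 2) - e) - (C₁ * u' + C₂ * (y + t * u' ^ 2) - e) := by
              ring
            rw [this]
            exact (abs_sub _ _).trans (by linarith)
          rw [abs_mul] at e1
          have e2 : γ ≤ |C₁ + C₂ * (t * (u + u'))| := by
            have h3 : |C₂ * (t * (u + u'))| ≤ 2 * t * |C₂| := by
              rw [abs_mul, abs_mul, abs_of_pos ht]
              have : |u + u'| ≤ 2 := (abs_add_le _ _).trans (by linarith)
              nlinarith [mul_nonneg ht.le (abs_nonneg C₂)]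
            have h4 := abs_sub_abs_le_abs_sub C₁ (-(C₂ * (t * (u + u'))))
            rw [sub_neg_eq_add, abs_neg] at h4
            linarith
          nlinarith [abs_nonneg (u - u')]
        · rw [Set.indicator_of_notMem hy]
          refine le_of_eq ?_
          convert measure_empty (μ := (volume : Measure ℝ))
          ext u
          simp only [Set.mem_preimage, hW, shear, Homeomorph.homeomorph_mk_coe,
            Equiv.coe_fn_mk, Set.mem_ofPred_eq, Set.mem_empty_iff_false, iff_false]
          rintro ⟨-, h2, -⟩
          apply hy
          simpa using h2
    _ = _ := by
        rw [lintegral_indicator measurableSet_Icc, setLIntegral_const, Real.volume_Icc, sub_zero]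

/-- A trapezoidal cut-off equal to `1` for `|u| ≤ 3/4` and to `0` for `|u| ≥ 1`. -/
noncomputable def trapez (u : ℝ) : ℝ := max 0 (min 1 (4 * (1 - |u|)))

/-- A tent supported on `[0, w]`, with height `1/2`. -/
noncomputable def tent (w y : ℝ) : ℝ := max 0 (min y (w - y)) / w

/-- A continuous bump carried by a thin strip above a parabola. -/
noncomputable def strip (t w : ℝ) (p : ℝ × ℝ) : ℝ := trapez p.1 * tent w (p.2 - t * p.1 ^ 2)

/-- The difference of two translates of `strip`. -/
noncomputable def dipole (t w : ℝ) (p : ℝ × ℝ) : ℝ := strip t w p - strip t w (p - (0, w))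

lemma trapez_nonneg (u : ℝ) : 0 ≤ trapez u := le_max_left _ _
lemma trapez_le_one (u : ℝ) : trapez u ≤ 1 := max_le zero_le_one (min_le_left _ _)
lemma tent_nonneg {w : ℝ} (hw : 0 < w) (y : ℝ) : 0 ≤ tent w y :=
  div_nonneg (le_max_left _ _) hw.le
lemma tent_le_one {w : ℝ} (hw : 0 < w) (y : ℝ) : tent w y ≤ 1 := by
  unfold tent
  rw [div_le_one hw]
  refine max_le hw.le ?_
  by_cases h : y ≤ w
  · exact (min_le_left _ _).trans h
  · exact (min_le_right _ _).trans (by linarith)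

lemma tent_eq_zero {w y : ℝ} (h : y ∉ Set.Icc 0 w) : tent w y = 0 := by
  unfold tent
  rw [max_eq_left, zero_div]
  by_contra h2
  push Not at h2
  rw [lt_min_iff] at h2
  exact h ⟨h2.1.le, by linarith [h2.2]⟩

lemma trapez_eq_zero {u : ℝ} (h : ¬ |u| ≤ 1) : trapez u = 0 := by
  unfold trapez
  rw [max_eq_left]
  exact (min_le_right _ _).trans (by linarith)

lemma continuous_strip (t w : ℝ) : Continuous (strip t w) := by
  unfold strip trapez tent; fun_prop

lemma strip_nonneg {w : ℝ} (t : ℝ) (hw : 0 < w) (p : ℝ × ℝ) : 0 ≤ strip t w p :=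
  mul_nonneg (trapez_nonneg _) (tent_nonneg hw _)

lemma strip_le_one {w : ℝ} (t : ℝ) (hw : 0 < w) (p : ℝ × ℝ) : strip t w p ≤ 1 :=
  mul_le_one₀ (trapez_le_one _) (tent_nonneg hw _) (tent_le_one hw _)

lemma strip_ne_zero {t w : ℝ} {p : ℝ × ℝ} (h : strip t w p ≠ 0) :
    |p.1| ≤ 1 ∧ p.2 - t * p.1 ^ 2 ∈ Set.Icc 0 w := by
  constructor
  · by_contra h2; exact h (by rw [strip, trapez_eq_zero h2, zero_mul])
  · by_contra h2; exact h (by rw [strip, tent_eq_zero h2, mul_zero])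

lemma hasCompactSupport_strip {t : ℝ} (w : ℝ) (ht : 0 < t) : HasCompactSupport (strip t w) := by
  refine HasCompactSupport.intro (isCompact_Icc.prod isCompact_Icc :
    IsCompact (Set.Icc (-1 : ℝ) 1 ×ˢ Set.Icc (0 : ℝ) (t + w))) fun p hp => ?_
  by_contra h
  obtain ⟨h1, h2, h3⟩ := strip_ne_zero h
  have h4 : p.1 ^ 2 ≤ 1 := by rw [← sq_abs]; nlinarith [abs_nonneg p.1]
  exact hp ⟨abs_le.1 h1, by nlinarith [sq_nonneg p.1], by nlinarith⟩

lemma integrable_strip {t : ℝ} (w : ℝ) (ht : 0 < t) : Integrable (strip t w) :=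
  (continuous_strip t w).integrable_of_hasCompactSupport (hasCompactSupport_strip w ht)

lemma integral_dipole {t : ℝ} (w : ℝ) (ht : 0 < t) : ∫ p, dipole t w p = 0 := by
  unfold dipole
  rw [integral_sub (integrable_strip w ht) ((integrable_strip w ht).comp_sub_right _),
    integral_sub_right_eq_self, sub_self]

/-- Moving the translation from the function to the set replaces the cancellation by a difference of
indicators, which vanishes except where a shift by `w` crosses the boundary of `A`. -/
lemma setIntegral_dipole {t : ℝ} (w : ℝ) (ht : 0 < t) {A : Set (ℝ × ℝ)} (hA : MeasurableSet A) :
    ∫ p in A, dipole t w p =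
      ∫ p, (A.indicator 1 p - A.indicator 1 (p + (0, w))) * strip t w p := by
  have i1 := integrable_strip w ht
  have i2 : Integrable fun p => A.indicator (1 : ℝ × ℝ → ℝ) p * strip t w p := by
    refine (i1.indicator hA).congr (Eventually.of_forall fun p => ?_)
    by_cases h : p ∈ A <;> simp [h]
  have i3 : Integrable fun p => A.indicator (1 : ℝ × ℝ → ℝ) (p + (0, w)) * strip t w p := by
    have := i1.indicator (hA.preimage (measurable_add_const ((0, w) : ℝ × ℝ)))
    refine this.congr (Eventually.of_forall fun p => ?_)
    by_cases h : p + (0, w) ∈ A <;> simp [Set.indicator, h]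
  have e : ∫ p in A, strip t w (p - (0, w)) =
      ∫ p, A.indicator (1 : ℝ × ℝ → ℝ) (p + (0, w)) * strip t w p := by
    rw [← integral_indicator hA, ← integral_add_right_eq_self _ ((0, w) : ℝ × ℝ)]
    refine integral_congr_ae (Eventually.of_forall fun p => ?_)
    simp only [Set.indicator, Pi.one_apply, add_sub_cancel_right]
    split_ifs <;> simp
  unfold dipole
  rw [integral_sub i1.integrableOn (i1.comp_sub_right _).integrableOn, e]
  simp_rw [sub_mul]
  rw [integral_sub i2 i3, ← integral_indicator hA]
  congr 1
  refine integral_congr_ae (Eventually.of_forall fun p => ?_)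
  simp only [Set.indicator, Pi.one_apply]
  split_ifs <;> simp

lemma near_of_mem_iff_ne {a b φ δ w : ℝ} (hδ : |δ| ≤ w)
    (h : ¬ (φ ∈ Set.Ioo a b ↔ φ + δ ∈ Set.Ioo a b)) : |φ - a| ≤ w ∨ |φ - b| ≤ w := by
  by_contra h2
  push Not at h2
  apply h
  obtain ⟨h3, h4⟩ := h2
  rw [abs_le] at hδ
  rw [lt_abs] at h3 h4
  simp only [Set.mem_Ioo]
  constructor
  · rintro ⟨h5, h6⟩
    constructor <;> rcases h3 with h3 | h3 <;> rcases h4 with h4 | h4 <;> linarith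
  · rintro ⟨h5, h6⟩
    constructor <;> rcases h3 with h3 | h3 <;> rcases h4 with h4 | h4 <;> linarith

/-- Integrals of a dipole over rectangles transversal to the parabola are small. -/
lemma abs_setIntegral_dipole_le {t w C S : ℝ} (ht : 0 < t) (ht' : t ≤ 1 / 3) (hw : 0 < w)
    (hCS : C ^ 2 + S ^ 2 = 1) (h1 : 3 * t * |C| ≤ |S|) (h2 : 3 * t * |S| ≤ |C|) (a b c d : ℝ) :
    |∫ p in {p : ℝ × ℝ | C * p.1 + S * p.2 ∈ Set.Ioo a b ∧ -(S * p.1) + C * p.2 ∈ Set.Ioo c d},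
      dipole t w p| ≤ 8 * w ^ 2 / t ^ 2 := by
  set A := {p : ℝ × ℝ | C * p.1 + S * p.2 ∈ Set.Ioo a b ∧ -(S * p.1) + C * p.2 ∈ Set.Ioo c d}
    with hA
  have hAo : IsOpen A := by
    refine IsOpen.inter ?_ ?_
    · exact isOpen_Ioo.preimage (by fun_prop : Continuous fun p : ℝ × ℝ => C * p.1 + S * p.2)
    · exact isOpen_Ioo.preimage (by fun_prop : Continuous fun p : ℝ × ℝ => -(S * p.1) + C * p.2)
  have hC2 : |C| ^ 2 + |S| ^ 2 = 1 := by rw [sq_abs, sq_abs]; exact hCS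
  have hC1 : |C| ≤ 1 := by nlinarith [abs_nonneg C, abs_nonneg S]
  have hS1 : |S| ≤ 1 := by nlinarith [abs_nonneg C, abs_nonneg S]
  have hCt : t ≤ |C| := by
    rcases le_total |S| |C| with h | h
    · nlinarith [abs_nonneg C, abs_nonneg S]
    · have : 1 / 2 ≤ |S| := by nlinarith [abs_nonneg C, abs_nonneg S]
      nlinarith
  have hSt : t ≤ |S| := by
    rcases le_total |C| |S| with h | h
    · nlinarith [abs_nonneg C, abs_nonneg S]
    · have : 1 / 2 ≤ |C| := by nlinarith [abs_nonneg C, abs_nonneg S]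
      nlinarith
  -- One third of the larger term is left over: `|C| - 2 t |S| ≥ t |S| ≥ t ^ 2`, and likewise with
  -- the roles exchanged.
  have g1 : t ^ 2 ≤ |C| - 2 * t * |S| := by nlinarith
  have g2 : t ^ 2 ≤ |(-S)| - 2 * t * |C| := by rw [abs_neg]; nlinarith
  set V : ℝ → ℝ → ℝ → Set (ℝ × ℝ) := fun C₁ C₂ e => {p : ℝ × ℝ | |p.1| ≤ 1 ∧
    p.2 - t * p.1 ^ 2 ∈ Set.Icc 0 w ∧ |C₁ * p.1 + C₂ * p.2 - e| ≤ w} with hV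
  -- The four sides of the rectangle: on the strip, the two indicators can differ only within
  -- distance `w` of one of these lines.
  set W := (V C S a ∪ V C S b) ∪ (V (-S) C c ∪ V (-S) C d) with hW
  have hvol : volume W ≤ ENNReal.ofReal (8 * w ^ 2 / t ^ 2) := by
    have key : ∀ C₁ C₂ e, t ^ 2 ≤ |C₁| - 2 * t * |C₂| →
        volume (V C₁ C₂ e) ≤ ENNReal.ofReal (2 * w ^ 2 / t ^ 2) := by
      intro C₁ C₂ e h
      refine (volume_strip_near_line_le (by positivity) ht h).trans (le_of_eq ?_)
      rw [← ENNReal.ofReal_mul (by positivity)]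
      congr 1; ring
    have e8 : ENNReal.ofReal (8 * w ^ 2 / t ^ 2) =
        (ENNReal.ofReal (2 * w ^ 2 / t ^ 2) + ENNReal.ofReal (2 * w ^ 2 / t ^ 2)) +
        (ENNReal.ofReal (2 * w ^ 2 / t ^ 2) + ENNReal.ofReal (2 * w ^ 2 / t ^ 2)) := by
      rw [← ENNReal.ofReal_add (by positivity) (by positivity),
        ← ENNReal.ofReal_add (by positivity) (by positivity)]
      congr 1; ring
    rw [e8]
    refine (measure_union_le _ _).trans (add_le_add ?_ ?_)
    · exact (measure_union_le _ _).trans (add_le_add (key _ _ _ g1) (key _ _ _ g1))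
    · exact (measure_union_le _ _).trans (add_le_add (key _ _ _ g2) (key _ _ _ g2))
  have hVm : ∀ C₁ C₂ e, MeasurableSet (V C₁ C₂ e) := by
    intro C₁ C₂ e
    exact (isClosed_strip_near_line t w C₁ C₂ e).measurableSet
  have hWm : MeasurableSet W := ((hVm _ _ _).union (hVm _ _ _)).union ((hVm _ _ _).union (hVm _ _ _))
  have hpt : ∀ p, |(A.indicator (1 : ℝ × ℝ → ℝ) p - A.indicator 1 (p + (0, w))) * strip t w p| ≤
      W.indicator 1 p := by
    intro p
    by_cases hp : strip t w p = 0
    · rw [hp, mul_zero, abs_zero]; exact Set.indicator_nonneg (fun _ _ => zero_le_one) p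
    obtain ⟨q1, q2⟩ := strip_ne_zero hp
    have hs1 := strip_le_one t hw p
    have hs0 := strip_nonneg t hw p
    by_cases hiff : p ∈ A ↔ p + (0, w) ∈ A
    · have : A.indicator (1 : ℝ × ℝ → ℝ) p = A.indicator 1 (p + (0, w)) := by
        simp only [Set.indicator, Pi.one_apply, hiff]
      rw [this, sub_self, zero_mul, abs_zero]; exact Set.indicator_nonneg (fun _ _ => zero_le_one) p
    · have hmem : p ∈ W := by
        have hSw : |S * w| ≤ w := by rw [abs_mul, abs_of_pos hw]; nlinarith
        have hCw : |C * w| ≤ w := by rw [abs_mul, abs_of_pos hw]; nlinarith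
        have : ¬ (C * p.1 + S * p.2 ∈ Set.Ioo a b ↔ C * p.1 + S * p.2 + S * w ∈ Set.Ioo a b) ∨
          ¬ (-(S * p.1) + C * p.2 ∈ Set.Ioo c d ↔ -(S * p.1) + C * p.2 + C * w ∈ Set.Ioo c d) := by
          by_contra h
          push Not at h
          apply hiff
          simp only [hA, Set.mem_ofPred_eq, Prod.fst_add, Prod.snd_add, add_zero]
          rw [h.1, h.2]
          ring_nf
        rcases this with h | h
        · rcases near_of_mem_iff_ne hSw h with h | h
          · exact Or.inl (Or.inl ⟨q1, q2, h⟩)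
          · exact Or.inl (Or.inr ⟨q1, q2, h⟩)
        · rcases near_of_mem_iff_ne hCw h with h | h
          · exact Or.inr (Or.inl ⟨q1, q2, by rwa [neg_mul]⟩)
          · exact Or.inr (Or.inr ⟨q1, q2, by rwa [neg_mul]⟩)
      rw [Set.indicator_of_mem hmem, abs_mul, abs_of_nonneg hs0]
      have : |A.indicator (1 : ℝ × ℝ → ℝ) p - A.indicator 1 (p + (0, w))| ≤ 1 := by
        simp only [Set.indicator, Pi.one_apply]; split_ifs <;> simp
      simp only [Pi.one_apply]
      nlinarith [abs_nonneg (A.indicator (1 : ℝ × ℝ → ℝ) p - A.indicator 1 (p + (0, w)))]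
  have hfin : volume W ≠ ⊤ := ne_top_of_le_ne_top ENNReal.ofReal_ne_top hvol
  rw [setIntegral_dipole w ht hAo.measurableSet, ← Real.norm_eq_abs]
  refine (norm_integral_le_of_norm_le (g := W.indicator 1) ?_ (Eventually.of_forall hpt)).trans ?_
  · exact (integrable_indicator_iff hWm).2 (integrableOn_const hfin)
  · rw [integral_indicator_one hWm]
    exact ENNReal.toReal_le_of_le_ofReal (by positivity) hvol

/-- Integral of a dipole over a half plane whose boundary is nearly tangent to the parabola. -/
lemma le_setIntegral_dipole {t w C S : ℝ} (ht : 0 < t) (hw : 0 < w) (hwt : w ≤ t / 4)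
    (hC : 0 < C) (hS : |S| ≤ t * C) :
    w / 16 * √(w / t) ≤
      ∫ p in {p : ℝ × ℝ | -(S * p.1) + C * p.2 < C * (w - t * (S / C / (2 * t)) ^ 2)},
        dipole t w p := by
  -- Abscissa at which the boundary line is tangent to the lower edge `y = w + t u²` of the
  -- translated strip.
  set u₀ := S / C / (2 * t) with hu₀
  set A := {p : ℝ × ℝ | -(S * p.1) + C * p.2 < C * (w - t * u₀ ^ 2)} with hA
  have hAo : IsOpen A := isOpen_lt (by fun_prop) (by fun_prop)
  have hSu : S = C * (2 * t * u₀) := by rw [hu₀]; field_simp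
  have hmemA : ∀ p, p ∈ A ↔ p.2 - t * p.1 ^ 2 < w - t * (p.1 - u₀) ^ 2 := by
    intro p
    simp only [hA, Set.mem_ofPred_eq]
    have : C * (w - t * u₀ ^ 2) - (-(S * p.1) + C * p.2) =
        C * ((w - t * (p.1 - u₀) ^ 2) - (p.2 - t * p.1 ^ 2)) := by rw [hSu]; ring
    rw [← sub_pos, this, mul_pos_iff_of_pos_left hC, sub_pos]
  have hu₀' : |u₀| ≤ 1 / 2 := by
    rw [hu₀, abs_div, abs_div, abs_of_pos hC, abs_of_pos (by positivity : 0 < 2 * t),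
      div_le_iff₀ (by positivity), div_le_iff₀ hC]
    linarith
  -- With `t r² = w / 4`, the sheared box `B` stays in the half plane because `w / 2 ≤ w - t r²`,
  -- and it stays in the range where `trapez` equals `1` because `|u₀| + r ≤ 3 / 4`.
  set r := √(w / t) / 2 with hr
  have hr2 : t * r ^ 2 = w / 4 := by
    rw [hr, div_pow, Real.sq_sqrt (by positivity)]; field_simp; norm_num
  have hr0 : 0 ≤ r := by positivity
  have hr4 : r ≤ 1 / 4 := by
    rw [hr]
    have : √(w / t) ≤ 1 / 2 := by
      rw [Real.sqrt_le_left (by norm_num), div_le_iff₀ ht]; linarith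
    linarith
  set B := shear t '' (Set.Icc (u₀ - r) (u₀ + r) ×ˢ Set.Ico (w / 4) (w / 2)) with hB
  have hBm : MeasurableSet B :=
    (shear t).measurableEmbedding.measurableSet_image.2 (measurableSet_Icc.prod measurableSet_Ico)
  have hBvol : volume B = ENNReal.ofReal (2 * r) * ENNReal.ofReal (w / 4) := by
    rw [← volume_shear_preimage t, hB, Set.preimage_image_eq _ (shear t).injective,
      volume_prod_set, Real.volume_Icc, Real.volume_Ico]
    congr 2 <;> ring
  have hpt : ∀ p, B.indicator (fun _ => (1 / 4 : ℝ)) p ≤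
      (A.indicator 1 p - A.indicator 1 (p + (0, w))) * strip t w p := by
    intro p
    have hs0 := strip_nonneg t hw p
    by_cases hs : strip t w p = 0 ∧ p ∉ B
    · rw [hs.1, mul_zero, Set.indicator_of_notMem hs.2]
    -- Tangency: the half plane misses the whole negative part of the dipole.
    have h2 : p + (0, w) ∉ A ∨ strip t w p = 0 := by
      by_cases h : strip t w p = 0
      · exact Or.inr h
      left
      obtain ⟨-, q2, -⟩ := strip_ne_zero h
      rw [hmemA]
      simp only [Prod.fst_add, Prod.snd_add, add_zero]
      nlinarith [mul_nonneg ht.le (sq_nonneg (p.1 - u₀))]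
    have h3 : (A.indicator (1 : ℝ × ℝ → ℝ) p - A.indicator 1 (p + (0, w))) * strip t w p =
        A.indicator 1 p * strip t w p := by
      rcases h2 with h2 | h2
      · rw [Set.indicator_of_notMem h2, sub_zero]
      · rw [h2, mul_zero, mul_zero]
    rw [h3]
    by_cases hp : p ∈ B
    · rw [Set.indicator_of_mem hp]
      obtain ⟨⟨u, y⟩, ⟨hu, hy⟩, rfl⟩ := hp
      simp only [Set.mem_Icc, Set.mem_Ico] at hu hy
      have hsq : (u - u₀) ^ 2 ≤ r ^ 2 := by
        apply sq_le_sq'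
        · linarith
        · linarith
      have hmA : shear t (u, y) ∈ A := by
        rw [hmemA]
        simp only [shear, Homeomorph.homeomorph_mk_coe, Equiv.coe_fn_mk]
        nlinarith
      rw [Set.indicator_of_mem hmA, Pi.one_apply, one_mul]
      simp only [strip, shear, Homeomorph.homeomorph_mk_coe, Equiv.coe_fn_mk, add_sub_cancel_right]
      have hu1 : |u| ≤ 3 / 4 := by
        rw [abs_le] at hu₀' ⊢; constructor <;> linarith
      have t1 : trapez u = 1 := by
        unfold trapez
        rw [min_eq_left (by linarith), max_eq_right zero_le_one]
      have t2 : 1 / 4 ≤ tent w y := by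
        unfold tent
        rw [le_div_iff₀ hw]
        refine le_max_of_le_right (le_min ?_ ?_) <;> linarith
      rw [t1, one_mul]; exact t2
    · rw [Set.indicator_of_notMem hp]
      exact mul_nonneg (Set.indicator_nonneg (fun _ _ => zero_le_one) p) hs0
  have hBfin : volume B ≠ ⊤ := by
    rw [hBvol]; exact ENNReal.mul_ne_top ENNReal.ofReal_ne_top ENNReal.ofReal_ne_top
  have i1 := integrable_strip w ht
  have hint : Integrable fun p =>
      (A.indicator (1 : ℝ × ℝ → ℝ) p - A.indicator 1 (p + (0, w))) * strip t w p := by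
    refine i1.mono ?_ (Eventually.of_forall fun p => ?_)
    · refine (Measurable.mul ?_ (continuous_strip t w).measurable).aestronglyMeasurable
      exact (measurable_one.indicator hAo.measurableSet).sub
        ((measurable_one.indicator hAo.measurableSet).comp (measurable_add_const _))
    · rw [norm_mul]
      have : ‖A.indicator (1 : ℝ × ℝ → ℝ) p - A.indicator 1 (p + (0, w))‖ ≤ 1 := by
        simp only [Set.indicator, Pi.one_apply]; split_ifs <;> simp
      nlinarith [norm_nonneg (strip t w p)]
  rw [setIntegral_dipole w ht hAo.measurableSet]
  refine le_trans (le_of_eq ?_) (integral_mono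
    ((integrable_indicator_iff hBm).2 (integrableOn_const hBfin)) hint hpt)
  rw [integral_indicator hBm, setIntegral_const, Measure.real, hBvol, ENNReal.toReal_mul,
    ENNReal.toReal_ofReal (by positivity), ENNReal.toReal_ofReal (by positivity), smul_eq_mul, hr]
  ring

lemma abs_dipole_le_one {t w : ℝ} (hw : 0 < w) (p : ℝ × ℝ) : |dipole t w p| ≤ 1 := by
  have h1 := strip_nonneg t hw p
  have h2 := strip_nonneg t hw (p - (0, w))
  have h3 := strip_le_one t hw p
  have h4 := strip_le_one t hw (p - (0, w))
  rw [dipole, abs_le]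
  constructor <;> linarith

lemma dipole_ne_zero {t w : ℝ} (ht : 0 < t) (ht' : t ≤ 1 / 3) (hw : 0 < w) (hw' : w ≤ 1 / 3)
    {p : ℝ × ℝ} (h : dipole t w p ≠ 0) : |p.1| ≤ 1 ∧ |p.2| ≤ 1 := by
  have h0 : strip t w p ≠ 0 ∨ strip t w (p - (0, w)) ≠ 0 := by
    by_contra h2
    push Not at h2
    exact h (by rw [dipole, h2.1, h2.2, sub_zero])
  have key : |p.1| ≤ 1 ∧ 0 ≤ p.2 - t * p.1 ^ 2 ∧ p.2 - t * p.1 ^ 2 ≤ 2 * w := by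
    rcases h0 with h0 | h0
    · obtain ⟨h1, h2, h3⟩ := strip_ne_zero h0
      exact ⟨h1, h2, by linarith⟩
    · obtain ⟨h1, h2, h3⟩ := strip_ne_zero h0
      simp only [Prod.fst_sub, Prod.snd_sub, sub_zero] at h1 h2 h3
      exact ⟨h1, by linarith, by linarith⟩
  obtain ⟨h1, h2, h3⟩ := key
  have h4 : p.1 ^ 2 ≤ 1 := by rw [← sq_abs]; nlinarith [abs_nonneg p.1]
  have h5 : 0 ≤ t * p.1 ^ 2 := by positivity
  exact ⟨h1, abs_le.2 ⟨by linarith, by nlinarith⟩⟩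

/-- The elementary building block: a bounded function with integral zero whose integral over a
suitable half plane of any slope close to `c` dominates its integrals over all rectangles of slopes
away from `c` modulo `π / 2`. -/
theorem exists_block (c t θ : ℝ) (ht : 0 < t) (ht' : t ≤ 1 / 3) (hθ : 0 < θ) :
    ∃ b : ℝ × ℝ → ℝ, ∃ m > 0, Continuous b ∧ (∀ p, |b p| ≤ 1) ∧
      (∀ p, b p ≠ 0 → ∀ s, |al s p| ≤ 2 ∧ |ac s p| ≤ 2) ∧ ∫ p, b p = 0 ∧
      (∀ s, |Real.sin (s - c)| ≤ t * Real.cos (s - c) →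
        ∃ κ, |κ| ≤ 1 ∧ m ≤ ∫ p in {p | ac s p < κ}, b p) ∧
      (∀ s, 3 * t * |Real.cos (s - c)| ≤ |Real.sin (s - c)| →
        3 * t * |Real.sin (s - c)| ≤ |Real.cos (s - c)| →
        ∀ x₀ x₁ y₀ y₁, |∫ p in Rc s x₀ x₁ y₀ y₁, b p| ≤ θ * m) := by
  -- The second bound gives `√(w / t) ≤ t θ / 128`, which is what makes the transversal bound `8 w²
  -- / t²` at most `θ m` for `m = w / 16 * √(w / t)`.
  set w : ℝ := min (t / 4) (t ^ 3 * θ ^ 2 / 128 ^ 2) with hwdef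
  have hw : 0 < w := lt_min (by positivity) (by positivity)
  have hw1 : w ≤ t / 4 := min_le_left _ _
  have hw2 : w ≤ t ^ 3 * θ ^ 2 / 128 ^ 2 := min_le_right _ _
  have hpull : ∀ A : Set (ℝ × ℝ), MeasurableSet A →
      ∫ p in rot c ⁻¹' A, dipole t w (rot c p) = ∫ q in A, dipole t w q := by
    intro A hA
    exact (measurePreserving_rot c).setIntegral_preimage_emb (rot c).measurableEmbedding _ _
  have hsup : ∀ p, dipole t w (rot c p) ≠ 0 → |al c p| ≤ 1 ∧ |ac c p| ≤ 1 := by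
    intro p hp
    exact dipole_ne_zero ht ht' hw (by linarith) hp
  refine ⟨fun p => dipole t w (rot c p), w / 16 * √(w / t), by positivity, ?_, ?_, ?_, ?_, ?_, ?_⟩
  · have : Continuous (dipole t w) := by
      unfold dipole
      exact (continuous_strip t w).sub ((continuous_strip t w).comp (by fun_prop))
    exact this.comp (rot c).continuous
  · exact fun p => abs_dipole_le_one hw _
  · intro p hp s
    obtain ⟨h1, h2⟩ := hsup p hp
    constructor
    · rw [al_eq_rotate s c, mul_comm, mul_comm (Real.sin _)]
      have := abs_mul_add_mul_le (Real.abs_cos_le_one (s - c)) (Real.abs_sin_le_one (s - c)) h1 h2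
      linarith
    · rw [ac_eq_rotate s c, mul_comm, mul_comm (Real.cos _), ← mul_neg]
      have := abs_mul_add_mul_le (x := -Real.sin (s - c))
        (by simpa using Real.abs_sin_le_one (s - c)) (Real.abs_cos_le_one (s - c)) h1 h2
      linarith
  · rw [integral_comp_rot c (dipole t w), integral_dipole w ht]
  · intro s hs
    set S := Real.sin (s - c)
    set C := Real.cos (s - c)
    have hCS : S ^ 2 + C ^ 2 = 1 := Real.sin_sq_add_cos_sq (s - c)
    have hC0 : 0 ≤ C := by
      have := (abs_nonneg S).trans hs
      exact nonneg_of_mul_nonneg_right this ht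
    have hC : 0 < C := by
      rcases hC0.eq_or_lt with h | h
      · exfalso
        rw [← h, mul_zero] at hs
        have : S = 0 := abs_nonpos_iff.1 hs
        rw [this, ← h] at hCS
        norm_num at hCS
      · exact h
    have hC1 : C ≤ 1 := Real.cos_le_one _
    refine ⟨C * (w - t * (S / C / (2 * t)) ^ 2), ?_, ?_⟩
    · have hu : |S / C / (2 * t)| ≤ 1 / 2 := by
        rw [abs_div, abs_div, abs_of_pos hC, abs_of_pos (by positivity : 0 < 2 * t),
          div_le_iff₀ (by positivity), div_le_iff₀ hC]
        linarith
      have hu2 : (S / C / (2 * t)) ^ 2 ≤ 1 / 4 := by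
        rw [← sq_abs]; nlinarith [abs_nonneg (S / C / (2 * t))]
      have hu3 := sq_nonneg (S / C / (2 * t))
      rw [abs_mul, abs_of_pos hC]
      have : |w - t * (S / C / (2 * t)) ^ 2| ≤ 1 := by
        rw [abs_le]; constructor <;> nlinarith
      nlinarith [abs_nonneg (w - t * (S / C / (2 * t)) ^ 2)]
    · have := le_setIntegral_dipole ht hw hw1 hC hs
      rw [← hpull _ (isOpen_lt (by fun_prop) (by fun_prop)).measurableSet] at this
      convert this using 4
      ext p
      simp only [Set.mem_ofPred_eq, Set.mem_preimage, rot_apply]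
      rw [ac_eq_rotate s c]
  · intro s h1 h2 x₀ x₁ y₀ y₁
    have hb := abs_setIntegral_dipole_le ht ht' hw (Real.cos_sq_add_sin_sq (s - c)) h1 h2 x₀ x₁ y₀ y₁
    have hm : MeasurableSet {p : ℝ × ℝ | Real.cos (s - c) * p.1 + Real.sin (s - c) * p.2 ∈
        Set.Ioo x₀ x₁ ∧ -(Real.sin (s - c) * p.1) + Real.cos (s - c) * p.2 ∈ Set.Ioo y₀ y₁} := by
      refine (IsOpen.inter ?_ ?_).measurableSet
      · exact isOpen_Ioo.preimage
          (by fun_prop : Continuous fun p : ℝ × ℝ =>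
            Real.cos (s - c) * p.1 + Real.sin (s - c) * p.2)
      · exact isOpen_Ioo.preimage
          (by fun_prop : Continuous fun p : ℝ × ℝ =>
            -(Real.sin (s - c) * p.1) + Real.cos (s - c) * p.2)
    rw [← hpull _ hm] at hb
    have hset : rot c ⁻¹' {p : ℝ × ℝ | Real.cos (s - c) * p.1 + Real.sin (s - c) * p.2 ∈
        Set.Ioo x₀ x₁ ∧ -(Real.sin (s - c) * p.1) + Real.cos (s - c) * p.2 ∈ Set.Ioo y₀ y₁} =
        Rc s x₀ x₁ y₀ y₁ := by
      ext p
      simp only [Set.mem_ofPred_eq, Set.mem_preimage, rot_apply, Rc]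
      rw [al_eq_rotate s c, ac_eq_rotate s c]
    rw [hset] at hb
    refine hb.trans ?_
    have hsq : w ≤ t ^ 2 * θ / 128 * √(w / t) := by
      have e1 : w / t ≤ (t * θ / 128) ^ 2 := by
        rw [div_le_iff₀ ht]; refine hw2.trans (le_of_eq (by ring))
      have e2 : √(w / t) ≤ t * θ / 128 := by
        rw [Real.sqrt_le_left (by positivity)]; exact e1
      have e3 : √(w / t) * √(w / t) = w / t := Real.mul_self_sqrt (by positivity)
      have e4 : w = t * (√(w / t) * √(w / t)) := by rw [e3]; field_simp
      have e5 := Real.sqrt_nonneg (w / t)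
      calc w = t * √(w / t) * √(w / t) := by rw [mul_assoc]; exact e4
        _ ≤ t * (t * θ / 128) * √(w / t) := by gcongr
        _ = _ := by ring
    calc 8 * w ^ 2 / t ^ 2 = 8 * w / t ^ 2 * w := by ring
      _ ≤ 8 * w / t ^ 2 * (t ^ 2 * θ / 128 * √(w / t)) := by gcongr
      _ = θ * (w / 16 * √(w / t)) := by field_simp; ring

/-! ### A one-dimensional maximal inequality for point masses. -/

/-- Weak type inequality for the maximal function of a finite combination of point masses on the
line. -/
lemma volume_pointmass_maximal_le {ι : Type*} (F : Finset ι) (y φ : ι → ℝ) (hφ : ∀ k ∈ F, 0 ≤ φ k)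
    {ε : ℝ} (hε : 0 < ε) :
    volume {x : ℝ | ∃ a b, a < x ∧ x < b ∧
      ε * (b - a) < ∑ k ∈ F, (if y k ∈ Set.Ioo a b then φ k else 0)} ≤
      ENNReal.ofReal (5 / ε * ∑ k ∈ F, φ k) := by
  classical
  set Φ := ∑ k ∈ F, φ k with hΦ
  set mass : ℝ × ℝ → ℝ := fun I => ∑ k ∈ F, (if y k ∈ Set.Ioo I.1 I.2 then φ k else 0) with hmass
  set T : Set (ℝ × ℝ) := {I | I.1 < I.2 ∧ ε * (I.2 - I.1) < mass I} with hT
  have hmassle : ∀ I, mass I ≤ Φ := by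
    intro I
    refine Finset.sum_le_sum fun k hk => ?_
    split_ifs
    · exact le_rfl
    · exact hφ k hk
  have hR : ∀ I ∈ T, (I.2 - I.1) / 2 ≤ Φ / ε / 2 := by
    intro I hI
    have := hI.2.le.trans (hmassle I)
    have : I.2 - I.1 ≤ Φ / ε := by rw [le_div_iff₀ hε]; linarith
    linarith
  -- The Vitali covering lemma applies because an interval of large average has length at most `Φ /
  -- ε`; its enlargement factor is the `5` of the statement.
  obtain ⟨u, huT, hud, hu⟩ := Vitali.exists_disjoint_subfamily_covering_enlargement_closedBall T
    (fun I => (I.1 + I.2) / 2) (fun I => (I.2 - I.1) / 2) _ hR 5 (by norm_num)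
  have hball : ∀ I : ℝ × ℝ, Metric.closedBall ((I.1 + I.2) / 2) ((I.2 - I.1) / 2) =
      Set.Icc I.1 I.2 := by
    intro I; rw [Real.closedBall_eq_Icc]; congr 1 <;> ring
  simp only [hball] at hud hu
  have hucount : u.Countable := by
    refine (hud.mono fun I => ?_).countable_of_isOpen (s := fun I => Set.Ioo I.1 I.2)
      (fun I _ => isOpen_Ioo) (fun I hI => ?_)
    · exact Set.Ioo_subset_Icc_self
    · exact Set.nonempty_Ioo.2 (huT hI).1
  have hsum : ∀ G : Finset (ℝ × ℝ), (∀ I ∈ G, I ∈ u) → ∑ I ∈ G, 5 * (I.2 - I.1) ≤ 5 / ε * Φ := by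
    intro G hG
    -- Each point mass lies in at most one of the disjoint intervals.
    have h1 : ∑ I ∈ G, mass I ≤ Φ := by
      simp only [hmass]
      rw [Finset.sum_comm]
      refine Finset.sum_le_sum fun k hk => ?_
      rw [← Finset.sum_filter, Finset.sum_const, nsmul_eq_mul]
      have : (G.filter fun I => y k ∈ Set.Ioo I.1 I.2).card ≤ 1 := by
        rw [Finset.card_le_one]
        intro I hI J hJ
        simp only [Finset.mem_filter] at hI hJ
        by_contra hne
        have := hud (hG I hI.1) (hG J hJ.1) hne
        exact Set.disjoint_left.1 this (Set.Ioo_subset_Icc_self hI.2)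
          (Set.Ioo_subset_Icc_self hJ.2)
      have h2 : ((G.filter fun I => y k ∈ Set.Ioo I.1 I.2).card : ℝ) ≤ 1 := by exact_mod_cast this
      nlinarith [hφ k hk]
    have h2 : ∑ I ∈ G, ε * (I.2 - I.1) ≤ ∑ I ∈ G, mass I :=
      Finset.sum_le_sum fun I hI => (huT (hG I hI)).2.le
    rw [← Finset.mul_sum] at h2 ⊢
    rw [div_mul_eq_mul_div, le_div_iff₀ hε]
    linarith
  have hsub : {x : ℝ | ∃ a b, a < x ∧ x < b ∧
      ε * (b - a) < ∑ k ∈ F, (if y k ∈ Set.Ioo a b then φ k else 0)} ⊆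
      ⋃ I ∈ u, Metric.closedBall ((I.1 + I.2) / 2) (5 * ((I.2 - I.1) / 2)) := by
    rintro x ⟨a, b, ha, hb, hab⟩
    obtain ⟨J, hJ, hsub⟩ := hu (a, b) ⟨ha.trans hb, hab⟩
    exact Set.mem_biUnion hJ (hsub ⟨ha.le, hb.le⟩)
  refine (measure_mono hsub).trans ((measure_biUnion_le _ hucount _).trans ?_)
  rw [ENNReal.tsum_eq_iSup_sum]
  refine iSup_le fun G => ?_
  have h1 : ∀ I ∈ G, volume (Metric.closedBall (((I : ℝ × ℝ).1 + (I : ℝ × ℝ).2) / 2)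
      (5 * (((I : ℝ × ℝ).2 - (I : ℝ × ℝ).1) / 2))) =
      ENNReal.ofReal (5 * ((I : ℝ × ℝ).2 - (I : ℝ × ℝ).1)) := by
    intro I _
    rw [Real.volume_closedBall]; congr 1; ring
  rw [Finset.sum_congr rfl h1, ← ENNReal.ofReal_sum_of_nonneg]
  · refine ENNReal.ofReal_le_ofReal ?_
    have := hsum (G.image Subtype.val) (by
      intro I hI
      obtain ⟨J, -, rfl⟩ := Finset.mem_image.1 hI
      exact J.2)
    rwa [Finset.sum_image (fun _ _ _ _ h => Subtype.ext h)] at this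
  · intro I _
    have := (huT I.2).1
    linarith

/-! ### Lattices of squares and successive generations. -/

/-- The unit square. -/
def unitSq : Set (ℝ × ℝ) := Set.Ico 0 1 ×ˢ Set.Ico 0 1

/-- Reduction of a point modulo the integer lattice. -/
noncomputable def fr (x : ℝ × ℝ) : ℝ × ℝ := (Int.fract x.1, Int.fract x.2)

/-- The half-open square of half-side `K` centered at the origin. -/
def box (K : ℝ) : Set (ℝ × ℝ) := Set.Ico (-K) K ×ˢ Set.Ico (-K) K

/-- The lattice point with integer coordinates `z`. -/
def latt (z : ℤ × ℤ) : ℝ × ℝ := ((z.1 : ℝ), (z.2 : ℝ))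

lemma measurableSet_unitSq : MeasurableSet unitSq := measurableSet_Ico.prod measurableSet_Ico

lemma volume_unitSq : volume unitSq = 1 := by
  rw [unitSq, volume_prod_set, Real.volume_Ico]; simp

lemma fr_mem_unitSq (x : ℝ × ℝ) : fr x ∈ unitSq :=
  ⟨⟨Int.fract_nonneg _, Int.fract_lt_one _⟩, ⟨Int.fract_nonneg _, Int.fract_lt_one _⟩⟩

lemma fr_sub_latt (x : ℝ × ℝ) (z : ℤ × ℤ) : fr (x - latt z) = fr x := by
  simp [fr, latt]

lemma fr_of_mem {x : ℝ × ℝ} (h : x ∈ unitSq) : fr x = x :=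
  Prod.ext (Int.fract_eq_self.2 ⟨h.1.1, h.1.2⟩) (Int.fract_eq_self.2 ⟨h.2.1, h.2.2⟩)

lemma fr_eq_sub_latt (x : ℝ × ℝ) : fr x = x - latt (⌊x.1⌋, ⌊x.2⌋) := rfl

lemma fr_natCast_smul_sub_latt (N : ℕ) (x : ℝ × ℝ) (z : ℤ × ℤ) :
    fr ((N : ℝ) • (x - latt z)) = fr ((N : ℝ) • x) := by
  have : (N : ℝ) • (x - latt z) = (N : ℝ) • x - latt (N * z.1, N * z.2) := by
    ext <;> simp [latt, mul_sub]
  rw [this, fr_sub_latt]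

lemma volume_smul_sub_preimage {r : ℝ} (hr : 0 < r) (v : ℝ × ℝ) (B : Set (ℝ × ℝ)) :
    volume ((fun x => r • x - v) ⁻¹' B) = ENNReal.ofReal ((r ^ 2)⁻¹) * volume B := by
  have : (fun x : ℝ × ℝ => r • x - v) ⁻¹' B = (r • ·) ⁻¹' ((fun x => x - v) ⁻¹' B) := rfl
  rw [this, Measure.addHaar_preimage_smul _ hr.ne', show (fun x : ℝ × ℝ => x - v) ⁻¹' B =
    (fun x => x + (-v)) ⁻¹' B by simp only [sub_eq_add_neg], measure_preimage_add_right]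
  congr 2
  simp [abs_of_pos hr]

lemma abs_le_one_div_of_mul {r a : ℝ} (hr : 0 < r) (h : |r * a| ≤ 1) : |a| ≤ 1 / r := by
  rw [abs_mul, abs_of_pos hr] at h
  rw [le_div_iff₀ hr]; linarith

/-- If on a lattice of ever finer squares (with ratio `M`) each square contains a copy of `A`,
then the part of the unit square missed by the copies of the first `n` generations is small. -/
lemma volume_uncovered_le {M : ℕ} (hM : 0 < M) {A A₀ : Set (ℝ × ℝ)} (hA₀ : A₀ ⊆ unitSq)
    (hm : MeasurableSet A₀)
    (h : ∀ p ∈ A₀, ∀ q : ℝ × ℝ, |p.1 - q.1| ≤ 1 / M → |p.2 - q.2| ≤ 1 / M → q ∈ A) (n : ℕ) :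
    volume {x | x ∈ unitSq ∧ ∀ i < n, fr (((M ^ i : ℕ) : ℝ) • x) ∉ A} ≤
      ENNReal.ofReal ((1 - volume.real A₀) ^ n) := by
  classical
  have hM' : (0 : ℝ) < M := by exact_mod_cast hM
  have hA₀fin : volume A₀ ≠ ⊤ :=
    ne_top_of_le_ne_top (by simp [volume_unitSq]) (measure_mono hA₀)
  have hA₀le : volume.real A₀ ≤ 1 := by
    have := measureReal_mono (μ := volume) hA₀ (by simp [volume_unitSq])
    rwa [Measure.real, Measure.real, volume_unitSq, ENNReal.toReal_one] at this
  set cell : ℤ × ℤ → Set (ℝ × ℝ) := fun d => (fun x => (M : ℝ) • x - latt d) ⁻¹' unitSq with hcell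
  -- Subsquares of side `1 / M` missing `A₀`. A subsquare meeting `A₀` lies entirely in `A`, hence
  -- is covered in generation zero.
  set D : Finset (ℤ × ℤ) := (Finset.Ico (0 : ℤ) M ×ˢ Finset.Ico (0 : ℤ) M).filter
    fun d => Disjoint (cell d) A₀ with hD
  have hcellm : ∀ d, MeasurableSet (cell d) := fun d =>
    measurableSet_unitSq.preimage (by fun_prop)
  have hfloor : ∀ d x, x ∈ cell d → d = (⌊(M : ℝ) * x.1⌋, ⌊(M : ℝ) * x.2⌋) := by
    rintro ⟨d1, d2⟩ x ⟨⟨h1, h2⟩, h3, h4⟩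
    simp only [latt, Prod.fst_sub, Prod.snd_sub, Prod.smul_fst, Prod.smul_snd,
      smul_eq_mul] at h1 h2 h3 h4
    rw [Prod.mk.injEq]
    exact ⟨(Int.floor_eq_iff.2 ⟨by linarith, by linarith⟩).symm,
      (Int.floor_eq_iff.2 ⟨by linarith, by linarith⟩).symm⟩
  have hcard : (D.card : ℝ) * ((M : ℝ) ^ 2)⁻¹ ≤ 1 - volume.real A₀ := by
    have hdisj : (D : Set (ℤ × ℤ)).PairwiseDisjoint cell := by
      intro d _ d' _ hne
      refine Set.disjoint_left.2 fun x hx hx' => hne ?_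
      rw [hfloor d x hx, hfloor d' x hx']
    have h1 := measureReal_biUnion_finset hdisj (fun d _ => hcellm d) (μ := volume)
      (fun d _ => by rw [hcell]; simp only; rw [volume_smul_sub_preimage hM', volume_unitSq]; simp)
    have h2 : ∀ d, volume.real (cell d) = ((M : ℝ) ^ 2)⁻¹ := by
      intro d
      rw [Measure.real, hcell]
      simp only
      rw [volume_smul_sub_preimage hM', volume_unitSq, mul_one, ENNReal.toReal_ofReal (by positivity)]
    simp only [h2, Finset.sum_const, nsmul_eq_mul] at h1
    rw [← h1]
    have h3 : volume.real (unitSq \ A₀) = 1 - volume.real A₀ := by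
      rw [measureReal_sdiff hA₀ hm (by simp [volume_unitSq])]
      simp [Measure.real, volume_unitSq]
    rw [← h3]
    refine measureReal_mono ?_ (ne_top_of_le_ne_top (by simp [volume_unitSq])
      (measure_mono Set.sdiff_subset))
    intro x hx
    obtain ⟨d, hd, hxd⟩ := Set.mem_iUnion₂.1 hx
    simp only [hD, Finset.mem_filter, Finset.mem_product, Finset.mem_Ico] at hd
    refine ⟨?_, Set.disjoint_left.1 hd.2 hxd⟩
    obtain ⟨⟨h1, h2⟩, h3, h4⟩ := hxd
    simp only [latt, Prod.fst_sub, Prod.snd_sub, Prod.smul_fst, Prod.smul_snd,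
      smul_eq_mul] at h1 h2 h3 h4
    obtain ⟨⟨⟨a1, a2⟩, a3, a4⟩, -⟩ := hd
    have b1 : (0 : ℝ) ≤ d.1 := by exact_mod_cast a1
    have b2 : (d.1 : ℝ) + 1 ≤ M := by exact_mod_cast a2
    have b3 : (0 : ℝ) ≤ d.2 := by exact_mod_cast a3
    have b4 : (d.2 : ℝ) + 1 ≤ M := by exact_mod_cast a4
    refine ⟨⟨?_, ?_⟩, ?_, ?_⟩
    · by_contra hh; nlinarith
    · by_contra hh; nlinarith
    · by_contra hh; nlinarith
    · by_contra hh; nlinarith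
  induction n with
  | zero =>
    simp only [not_lt_zero, IsEmpty.forall_iff, implies_true, and_true, pow_zero,
      ENNReal.ofReal_one]
    exact volume_unitSq.le
  | succ n ih =>
    set U := {x | x ∈ unitSq ∧ ∀ i < n, fr (((M ^ i : ℕ) : ℝ) • x) ∉ A} with hU
    -- Self-similarity: inside each subsquare of `D`, the remaining `n` generations look like the
    -- original configuration rescaled by `M`.
    have hsub : {x | x ∈ unitSq ∧ ∀ i < n + 1, fr (((M ^ i : ℕ) : ℝ) • x) ∉ A} ⊆
        ⋃ d ∈ D, (fun x => (M : ℝ) • x - latt d) ⁻¹' U := by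
      rintro x ⟨hx, hxi⟩
      have hfrx : fr ((M : ℝ) • x) = (M : ℝ) • x - latt (⌊(M : ℝ) * x.1⌋, ⌊(M : ℝ) * x.2⌋) := rfl
      have hxc : x ∈ cell (⌊(M : ℝ) * x.1⌋, ⌊(M : ℝ) * x.2⌋) := by
        simp only [hcell, Set.mem_preimage]
        rw [← hfrx]; exact fr_mem_unitSq _
      refine Set.mem_biUnion (x := (⌊(M : ℝ) * x.1⌋, ⌊(M : ℝ) * x.2⌋)) ?_ ?_
      · simp only [hD, Finset.mem_filter, Finset.mem_product, Finset.mem_Ico, Finset.mem_coe]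
        obtain ⟨⟨h1, h2⟩, h3, h4⟩ := hx
        refine ⟨⟨⟨Int.floor_nonneg.2 (by positivity), ?_⟩, Int.floor_nonneg.2 (by positivity), ?_⟩, ?_⟩
        · rw [Int.floor_lt]; push_cast; nlinarith
        · rw [Int.floor_lt]; push_cast; nlinarith
        · rw [Set.disjoint_left]
          intro p hp hpA
          have hx0 := hxi 0 (Nat.succ_pos n)
          rw [pow_zero, Nat.cast_one, one_smul, fr_of_mem ⟨⟨h1, h2⟩, h3, h4⟩] at hx0
          obtain ⟨⟨p1, p2⟩, p3, p4⟩ := hp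
          obtain ⟨⟨q1, q2⟩, q3, q4⟩ := hxc
          simp only [latt, Prod.fst_sub, Prod.snd_sub, Prod.smul_fst, Prod.smul_snd,
            smul_eq_mul] at p1 p2 p3 p4 q1 q2 q3 q4
          refine hx0 (h p hpA x ?_ ?_)
          · refine abs_le_one_div_of_mul hM' (abs_le.2 ⟨?_, ?_⟩) <;> linarith
          · refine abs_le_one_div_of_mul hM' (abs_le.2 ⟨?_, ?_⟩) <;> linarith
      · simp only [Set.mem_preimage, hU, Set.mem_ofPred_eq]
        refine ⟨hxc, fun i hi => ?_⟩
        rw [fr_natCast_smul_sub_latt, smul_smul]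
        have := hxi (i + 1) (by omega)
        rwa [pow_succ, Nat.cast_mul] at this
    refine (measure_mono hsub).trans ((measure_biUnion_finset_le _ _).trans ?_)
    simp only [volume_smul_sub_preimage hM']
    rw [Finset.sum_const, nsmul_eq_mul, ← mul_assoc, pow_succ' (1 - volume.real A₀),
      ENNReal.ofReal_mul (by linarith)]
    refine mul_le_mul' ?_ ih
    rw [← ENNReal.ofReal_natCast, ← ENNReal.ofReal_mul (by positivity)]
    exact ENNReal.ofReal_le_ofReal hcard

lemma fr_natCast_smul_fr (N : ℕ) (x : ℝ × ℝ) : fr ((N : ℝ) • fr x) = fr ((N : ℝ) • x) := by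
  rw [fr_eq_sub_latt x, fr_natCast_smul_sub_latt]

/-- The integer points indexing the squares of side `η` which make up the square `box (L * η)`. -/
noncomputable def cells (L : ℕ) : Finset (ℤ × ℤ) := Finset.Ico (-L : ℤ) L ×ˢ Finset.Ico (-L : ℤ) L

lemma card_cells (L : ℕ) : ((cells L).card : ℝ) = (2 * L) ^ 2 := by
  have : (cells L).card = (2 * L) ^ 2 := by
    rw [cells, Finset.card_product, Int.card_Ico, sq]
    congr 1 <;> omega
  rw [this]; push_cast; ring

lemma floor_mem_cells {L : ℕ} {η : ℝ} (hη : 0 < η) {x : ℝ × ℝ} (hx : x ∈ box (L * η)) :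
    (⌊(η⁻¹ • x).1⌋, ⌊(η⁻¹ • x).2⌋) ∈ cells L := by
  obtain ⟨⟨h1, h2⟩, h3, h4⟩ := hx
  have key : ∀ y : ℝ, -(L * η) ≤ y → y < L * η → -(L : ℤ) ≤ ⌊η⁻¹ * y⌋ ∧ ⌊η⁻¹ * y⌋ < L := by
    intro y h1 h2
    have e : η * (η⁻¹ * y) = y := by field_simp
    constructor
    · rw [Int.le_floor]; push_cast; by_contra hh; push Not at hh; nlinarith
    · rw [Int.floor_lt]; push_cast; by_contra hh; push Not at hh; nlinarith
  simp only [cells, Finset.mem_product, Finset.mem_Ico, Prod.smul_fst, Prod.smul_snd, smul_eq_mul]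
  exact ⟨key _ h1 h2, key _ h3 h4⟩

/-- Volume of the part of a large square where the reduction modulo a lattice lies in `B`. -/
lemma volume_box_fr_mem_le (L : ℕ) {η : ℝ} (hη : 0 < η) (B : Set (ℝ × ℝ)) :
    volume {x | x ∈ box (L * η) ∧ fr (η⁻¹ • x) ∈ B} ≤
      ENNReal.ofReal ((2 * (L * η)) ^ 2) * volume B := by
  have hsub : {x | x ∈ box (L * η) ∧ fr (η⁻¹ • x) ∈ B} ⊆
      ⋃ z ∈ cells L, (fun x => η⁻¹ • x - latt z) ⁻¹' B := by
    rintro x ⟨hx, hxB⟩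
    exact Set.mem_biUnion (floor_mem_cells hη hx) hxB
  refine (measure_mono hsub).trans ((measure_biUnion_finset_le _ _).trans (le_of_eq ?_))
  simp only [volume_smul_sub_preimage (inv_pos.2 hη)]
  rw [Finset.sum_const, nsmul_eq_mul, ← mul_assoc, ← ENNReal.ofReal_natCast,
    ← ENNReal.ofReal_mul (by positivity), card_cells]
  congr 2
  field_simp

/-! ### Blocks and their sums over a lattice. -/

/-- A continuous bounded function with integral zero, supported near the origin. -/
structure IsBlock (b : ℝ × ℝ → ℝ) : Prop where
  cont : Continuous b
  abs_le_one : ∀ p, |b p| ≤ 1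
  supp : ∀ p, b p ≠ 0 → ∀ s, |al s p| ≤ 2 ∧ |ac s p| ≤ 2
  integral_eq_zero : ∫ p, b p = 0

/-- The copy of `b` of size `r` around the point `y`. -/
noncomputable def blk (b : ℝ × ℝ → ℝ) (r : ℝ) (y x : ℝ × ℝ) : ℝ := b (r⁻¹ • (x - y))

lemma integral_comp_inv_smul_sub {r : ℝ} (hr : 0 < r) (y : ℝ × ℝ) (g : ℝ × ℝ → ℝ) :
    ∫ x, g (r⁻¹ • (x - y)) = r ^ 2 * ∫ p, g p := by
  rw [integral_sub_right_eq_self (fun x => g (r⁻¹ • x)) y, Measure.integral_comp_inv_smul]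
  simp [abs_of_pos hr]

lemma setIntegral_blk {b : ℝ × ℝ → ℝ} {r : ℝ} (hr : 0 < r) (y : ℝ × ℝ) {A : Set (ℝ × ℝ)}
    (hA : MeasurableSet A) :
    ∫ x in A, blk b r y x = r ^ 2 * ∫ p in (fun p => r • p + y) ⁻¹' A, b p := by
  rw [← integral_indicator hA, ← integral_indicator (hA.preimage (by fun_prop)),
    ← integral_comp_inv_smul_sub hr y]
  refine integral_congr_ae (Eventually.of_forall fun x => ?_)
  have : r • (r⁻¹ • (x - y)) + y = x := by
    rw [smul_smul, mul_inv_cancel₀ hr.ne', one_smul, sub_add_cancel]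
  beta_reduce
  have hiff : r⁻¹ • (x - y) ∈ (fun p => r • p + y) ⁻¹' A ↔ x ∈ A := by rw [Set.mem_preimage, this]
  by_cases h : x ∈ A
  · rw [Set.indicator_of_mem h, Set.indicator_of_mem (hiff.2 h), blk]
  · rw [Set.indicator_of_notMem h, Set.indicator_of_notMem (fun h' => h (hiff.1 h'))]

lemma setIntegral_blk_Rc {b : ℝ × ℝ → ℝ} {r : ℝ} (hr : 0 < r) (y : ℝ × ℝ) (s x₀ x₁ y₀ y₁ : ℝ) :
    ∫ x in Rc s x₀ x₁ y₀ y₁, blk b r y x =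
      r ^ 2 * ∫ p in Rc s ((x₀ - al s y) / r) ((x₁ - al s y) / r) ((y₀ - ac s y) / r)
        ((y₁ - ac s y) / r), b p := by
  rw [setIntegral_blk hr y (measurableSet_Rc _ _ _ _ _)]
  congr 3
  ext p
  simp only [Rc, Set.mem_preimage, Set.mem_ofPred_eq, Set.mem_Ioo, al_add, ac_add, al_smul, ac_smul,
    div_lt_iff₀ hr, lt_div_iff₀ hr, sub_lt_iff_lt_add, lt_sub_iff_add_lt, mul_comm r]

namespace IsBlock

variable {b : ℝ × ℝ → ℝ}

lemma continuous_blk (hb : IsBlock b) (r : ℝ) (y : ℝ × ℝ) : Continuous (blk b r y) := by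
  unfold blk
  exact hb.cont.comp (by fun_prop)

lemma blk_ne_zero (hb : IsBlock b) {r : ℝ} (hr : 0 < r) {y x : ℝ × ℝ} (h : blk b r y x ≠ 0)
    (s : ℝ) : |al s x - al s y| ≤ 2 * r ∧ |ac s x - ac s y| ≤ 2 * r := by
  obtain ⟨h1, h2⟩ := hb.supp _ h s
  rw [al_smul, al_sub, abs_mul, abs_inv, abs_of_pos hr, inv_mul_le_iff₀ hr] at h1
  rw [ac_smul, ac_sub, abs_mul, abs_inv, abs_of_pos hr, inv_mul_le_iff₀ hr] at h2
  constructor <;> linarith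

lemma hasCompactSupport_blk (hb : IsBlock b) {r : ℝ} (hr : 0 < r) (y : ℝ × ℝ) :
    HasCompactSupport (blk b r y) := by
  refine HasCompactSupport.intro (isCompact_Icc.prod isCompact_Icc :
    IsCompact (Set.Icc (y.1 - 2 * r) (y.1 + 2 * r) ×ˢ Set.Icc (y.2 - 2 * r) (y.2 + 2 * r)))
    fun x hx => ?_
  by_contra h
  obtain ⟨h1, h2⟩ := hb.blk_ne_zero hr h 0
  simp only [al, ac, Real.cos_zero, Real.sin_zero, mul_one, mul_zero, add_zero, neg_zero,
    zero_add] at h1 h2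
  rw [abs_le] at h1 h2
  exact hx ⟨⟨by linarith, by linarith⟩, by linarith, by linarith⟩

lemma integrable_blk (hb : IsBlock b) {r : ℝ} (hr : 0 < r) (y : ℝ × ℝ) : Integrable (blk b r y) :=
  (hb.continuous_blk r y).integrable_of_hasCompactSupport (hb.hasCompactSupport_blk hr y)

lemma integral_blk (hb : IsBlock b) {r : ℝ} (hr : 0 < r) (y : ℝ × ℝ) : ∫ x, blk b r y x = 0 := by
  unfold blk
  rw [integral_comp_inv_smul_sub hr, hb.integral_eq_zero, mul_zero]

lemma setIntegral_abs_blk_le (hb : IsBlock b) {r : ℝ} (hr : 0 < r) (y : ℝ × ℝ) (s : ℝ)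
    (A : Set (ℝ × ℝ)) (hA : MeasurableSet A) :
    ∫ x in A, |blk b r y x| ≤ volume.real (A ∩ rot s ⁻¹'
      (Set.Icc (al s y - 2 * r) (al s y + 2 * r) ×ˢ Set.Icc (ac s y - 2 * r) (ac s y + 2 * r))) := by
  set B := rot s ⁻¹'
      (Set.Icc (al s y - 2 * r) (al s y + 2 * r) ×ˢ Set.Icc (ac s y - 2 * r) (ac s y + 2 * r))
  have hBm : MeasurableSet B :=
    (measurableSet_Icc.prod measurableSet_Icc).preimage (rot s).continuous.measurable
  have hBf : volume (A ∩ B) ≠ ⊤ := by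
    refine ne_top_of_le_ne_top ?_ (measure_mono Set.inter_subset_right)
    rw [volume_rot_preimage, volume_prod_set, Real.volume_Icc, Real.volume_Icc]
    exact ENNReal.mul_ne_top ENNReal.ofReal_ne_top ENNReal.ofReal_ne_top
  rw [← integral_indicator hA, ← integral_indicator_one (hA.inter hBm)]
  refine integral_mono ((hb.integrable_blk hr y).abs.indicator hA)
    ((integrable_indicator_iff (hA.inter hBm)).2 (integrableOn_const hBf)) fun x => ?_
  by_cases hx : x ∈ A
  · rw [Set.indicator_of_mem hx]
    by_cases h : blk b r y x = 0
    · rw [h, abs_zero]; exact Set.indicator_nonneg (fun _ _ => zero_le_one) x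
    · obtain ⟨h1, h2⟩ := hb.blk_ne_zero hr h s
      rw [abs_le] at h1 h2
      have hxB : x ∈ B := by
        simp only [B, Set.mem_preimage, rot_apply, Set.mem_prod, Set.mem_Icc]
        exact ⟨⟨by linarith, by linarith⟩, by linarith, by linarith⟩
      rw [Set.indicator_of_mem (show x ∈ A ∩ B from ⟨hx, hxB⟩)]
      exact hb.abs_le_one _
  · rw [Set.indicator_of_notMem hx]; exact Set.indicator_nonneg (fun _ _ => zero_le_one) x

lemma integral_abs_blk_le (hb : IsBlock b) {r : ℝ} (hr : 0 < r) (y : ℝ × ℝ) :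
    ∫ x, |blk b r y x| ≤ 16 * r ^ 2 := by
  have := hb.setIntegral_abs_blk_le hr y 0 Set.univ MeasurableSet.univ
  rw [setIntegral_univ, Set.univ_inter, Measure.real, volume_rot_preimage, volume_prod_set,
    Real.volume_Icc, Real.volume_Icc, ENNReal.toReal_mul, ENNReal.toReal_ofReal (by linarith),
    ENNReal.toReal_ofReal (by linarith)] at this
  linarith

lemma abs_setIntegral_blk_le (hb : IsBlock b) {r : ℝ} (hr : 0 < r) (y : ℝ × ℝ)
    (A : Set (ℝ × ℝ)) : |∫ x in A, blk b r y x| ≤ 16 * r ^ 2 := by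
  refine (abs_integral_le_integral_abs).trans ((setIntegral_le_integral
    (hb.integrable_blk hr y).abs (Eventually.of_forall fun x => abs_nonneg _)).trans
    (hb.integral_abs_blk_le hr y))

/-- The block is bounded by `1`, and the rectangle meets its supporting square in a piece of width
at most `4 r` and height at most `y₁ - y₀`. This is better than the area of the square for thin
rectangles. -/
lemma abs_setIntegral_blk_Rc_le (hb : IsBlock b) {r : ℝ} (hr : 0 < r) (y : ℝ × ℝ)
    (s x₀ x₁ : ℝ) {y₀ y₁ : ℝ} (h : y₀ ≤ y₁) :
    |∫ x in Rc s x₀ x₁ y₀ y₁, blk b r y x| ≤ 4 * r * (y₁ - y₀) := by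
  refine (abs_integral_le_integral_abs).trans
    ((hb.setIntegral_abs_blk_le hr y s _ (measurableSet_Rc _ _ _ _ _)).trans ?_)
  rw [Rc_eq_preimage, ← Set.preimage_inter, Measure.real, volume_rot_preimage, Set.prod_inter_prod,
    volume_prod_set]
  refine ENNReal.toReal_le_of_le_ofReal (by have := sub_nonneg.2 h; positivity) ?_
  rw [ENNReal.ofReal_mul (by positivity)]
  refine mul_le_mul' ((measure_mono Set.inter_subset_right).trans ?_)
    ((measure_mono Set.inter_subset_left).trans ?_)
  · rw [Real.volume_Icc]; exact ENNReal.ofReal_le_ofReal (by linarith)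
  · rw [Real.volume_Ioo]

lemma setIntegral_blk_eq_zero_of_disjoint {r : ℝ} {y : ℝ × ℝ}
    {A : Set (ℝ × ℝ)} (hA : MeasurableSet A) (h : ∀ x ∈ A, blk b r y x = 0) :
    ∫ x in A, blk b r y x = 0 := by
  rw [setIntegral_congr_fun hA (g := 0) (fun x hx => h x hx)]
  simp

/-- The mean zero property makes interior blocks invisible, so only blocks met by the boundary
count. -/
lemma setIntegral_blk_eq_zero_of_subset (hb : IsBlock b) {r : ℝ} (hr : 0 < r) {y : ℝ × ℝ}
    {A : Set (ℝ × ℝ)} (h : ∀ x, blk b r y x ≠ 0 → x ∈ A) :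
    ∫ x in A, blk b r y x = 0 := by
  rw [setIntegral_eq_integral_of_forall_compl_eq_zero, hb.integral_blk hr]
  intro x hx
  by_contra h2
  exact hx (h x h2)

end IsBlock

/-- The center of the square of side `η` with index `z`. -/
noncomputable def cent (η : ℝ) (z : ℤ × ℤ) : ℝ × ℝ := η • (latt z + (1 / 2, 1 / 2))

/-- The sum of the copies of `b` of size `δ * η` placed at the centers of the squares of side `η`
which make up the square `box (L * η)`. -/
noncomputable def stage (b : ℝ × ℝ → ℝ) (δ : ℝ) (L : ℕ) (η : ℝ) (x : ℝ × ℝ) : ℝ :=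
  ∑ z ∈ cells L, blk b (δ * η) (cent η z) x

lemma mem_cell_near_cent {η : ℝ} (hη : 0 < η) {z : ℤ × ℤ} {p : ℝ × ℝ}
    (h : η⁻¹ • p - latt z ∈ unitSq) :
    |p.1 - (cent η z).1| ≤ η / 2 ∧ |p.2 - (cent η z).2| ≤ η / 2 := by
  obtain ⟨⟨h1, h2⟩, h3, h4⟩ := h
  simp only [latt, Prod.fst_sub, Prod.snd_sub, Prod.smul_fst, Prod.smul_snd,
    smul_eq_mul] at h1 h2 h3 h4
  simp only [cent, latt, Prod.smul_fst, Prod.smul_snd, Prod.fst_add, Prod.snd_add, smul_eq_mul]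
  have key : ∀ y k : ℝ, 0 ≤ η⁻¹ * y - k → η⁻¹ * y - k < 1 → |y - η * (k + 1 / 2)| ≤ η / 2 := by
    intro y k h1 h2
    have e : y = η * (η⁻¹ * y) := by field_simp
    rw [abs_le]
    constructor <;> nlinarith
  exact ⟨key _ _ h1 h2, key _ _ h3 h4⟩

namespace IsBlock

variable {b : ℝ × ℝ → ℝ} {δ : ℝ}

lemma continuous_stage (hb : IsBlock b) (δ : ℝ) (L : ℕ) (η : ℝ) : Continuous (stage b δ L η) := by
  unfold stage
  exact continuous_finsetSum _ fun z _ => hb.continuous_blk _ _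

lemma hasCompactSupport_stage (hb : IsBlock b) (hδ : 0 < δ) (L : ℕ) {η : ℝ} (hη : 0 < η) :
    HasCompactSupport (stage b δ L η) := by
  have : stage b δ L η = ∑ z ∈ cells L, blk b (δ * η) (cent η z) := by
    funext x; rw [Finset.sum_apply]; rfl
  rw [this]
  refine Finset.sum_induction _ HasCompactSupport (fun f g hf hg => hf.add hg)
    HasCompactSupport.zero fun z _ => hb.hasCompactSupport_blk (by positivity) _

lemma integrable_stage (hb : IsBlock b) (hδ : 0 < δ) (L : ℕ) {η : ℝ} (hη : 0 < η) :
    Integrable (stage b δ L η) :=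
  (hb.continuous_stage δ L η).integrable_of_hasCompactSupport (hb.hasCompactSupport_stage hδ L hη)

lemma integral_abs_stage_le (hb : IsBlock b) (hδ : 0 < δ) (L : ℕ) {η : ℝ} (hη : 0 < η) :
    ∫ x, |stage b δ L η x| ≤ 16 * δ ^ 2 * (2 * (L * η)) ^ 2 := by
  have hr : 0 < δ * η := by positivity
  calc ∫ x, |stage b δ L η x| ≤ ∫ x, ∑ z ∈ cells L, |blk b (δ * η) (cent η z) x| := by
        refine integral_mono (hb.integrable_stage hδ L hη).abs
          (integrable_finsetSum _ fun z _ => (hb.integrable_blk hr _).abs) fun x => ?_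
        exact Finset.abs_sum_le_sum_abs _ _
    _ = ∑ z ∈ cells L, ∫ x, |blk b (δ * η) (cent η z) x| :=
        integral_finsetSum _ fun z _ => (hb.integrable_blk hr _).abs
    _ ≤ ∑ z ∈ cells L, 16 * (δ * η) ^ 2 :=
        Finset.sum_le_sum fun z _ => hb.integral_abs_blk_le hr _
    _ = _ := by rw [Finset.sum_const, nsmul_eq_mul, card_cells]; ring

lemma setIntegral_stage (hb : IsBlock b) (hδ : 0 < δ) (L : ℕ) {η : ℝ} (hη : 0 < η)
    (A : Set (ℝ × ℝ)) :
    ∫ x in A, stage b δ L η x = ∑ z ∈ cells L, ∫ x in A, blk b (δ * η) (cent η z) x := by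
  unfold stage
  exact integral_finsetSum _ fun z _ => (hb.integrable_blk (by positivity) _).integrableOn

/-- Only the squares near the boundary contribute to the integral of a `stage` over a rectangle. -/
lemma abs_setIntegral_stage_le (hb : IsBlock b) (hδ : 0 < δ) (hδ' : δ ≤ 1 / 8) (L : ℕ) {η : ℝ}
    (hη : 0 < η) (s : ℝ) {x₀ x₁ y₀ y₁ : ℝ} (hx : η ≤ x₁ - x₀) (hy : η ≤ y₁ - y₀) :
    |∫ x in Rc s x₀ x₁ y₀ y₁, stage b δ L η x| ≤
      640 * δ ^ 2 * η * ((x₁ - x₀) + (y₁ - y₀)) := by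
  classical
  have hr : 0 < δ * η := by positivity
  have hrη : 2 * (δ * η) ≤ η / 4 := by nlinarith
  set R := Rc s x₀ x₁ y₀ y₁ with hR
  set Rp := Rc s (x₀ - 2 * η) (x₁ + 2 * η) (y₀ - 2 * η) (y₁ + 2 * η) with hRp
  set Rm := Rc s (x₀ + 2 * η) (x₁ - 2 * η) (y₀ + 2 * η) (y₁ - 2 * η) with hRm
  set cell : ℤ × ℤ → Set (ℝ × ℝ) := fun z => (fun x => η⁻¹ • x - latt z) ⁻¹' unitSq with hcell
  have hcellm : ∀ d, MeasurableSet (cell d) := fun d =>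
    measurableSet_unitSq.preimage (by fun_prop)
  -- A contributing block is neither outside `R` nor inside it, so its cell lies in the frame `Rp \
  -- Rm`. Counting these disjoint cells by area bounds their number.
  set G := (cells L).filter fun z => ∫ x in R, blk b (δ * η) (cent η z) x ≠ 0 with hG
  have hsubN : ∀ z ∈ G, cell z ⊆ Rp \ Rm := by
    intro z hz p hp
    have hz2 := (Finset.mem_filter.1 hz).2
    obtain ⟨n1, n2⟩ := mem_cell_near_cent hη hp
    have n3 := abs_al_le s (p := p - cent η z) n1 n2
    have n4 := abs_ac_le s (p := p - cent η z) n1 n2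
    rw [al_sub, abs_le] at n3
    rw [ac_sub, abs_le] at n4
    have hsup : ∀ x, blk b (δ * η) (cent η z) x ≠ 0 →
        al s p - 2 * η < al s x ∧ al s x < al s p + 2 * η ∧
        ac s p - 2 * η < ac s x ∧ ac s x < ac s p + 2 * η := by
      intro x hx
      obtain ⟨h1, h2⟩ := hb.blk_ne_zero hr hx s
      rw [abs_le] at h1 h2
      refine ⟨by linarith, by linarith, by linarith, by linarith⟩
    constructor
    · by_contra hpR
      apply hz2
      refine setIntegral_blk_eq_zero_of_disjoint (measurableSet_Rc _ _ _ _ _) fun x hx => ?_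
      by_contra hne
      obtain ⟨h1, h2, h3, h4⟩ := hsup x hne
      obtain ⟨⟨h5, h6⟩, h7, h8⟩ := hx
      exact hpR ⟨⟨by linarith, by linarith⟩, by linarith, by linarith⟩
    · intro hpR
      apply hz2
      refine hb.setIntegral_blk_eq_zero_of_subset hr fun x hne => ?_
      obtain ⟨h1, h2, h3, h4⟩ := hsup x hne
      obtain ⟨⟨h5, h6⟩, h7, h8⟩ := hpR
      exact ⟨⟨by linarith, by linarith⟩, by linarith, by linarith⟩
  have hvolN : volume.real (Rp \ Rm) ≤ 40 * η * ((x₁ - x₀) + (y₁ - y₀)) := by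
    have hp : volume.real Rp = (x₁ - x₀ + 4 * η) * (y₁ - y₀ + 4 * η) := by
      rw [hRp, volume_real_Rc (by linarith) (by linarith)]; ring
    -- If one side is shorter than `4 η`, the inner rectangle may degenerate, but the whole outer
    -- rectangle already satisfies the bound.
    by_cases hbig : 4 * η ≤ x₁ - x₀ ∧ 4 * η ≤ y₁ - y₀
    · have hm : volume.real Rm = (x₁ - x₀ - 4 * η) * (y₁ - y₀ - 4 * η) := by
        rw [hRm, volume_real_Rc (by linarith) (by linarith)]; ring
      have hsub : Rm ⊆ Rp := by
        rintro x ⟨⟨h5, h6⟩, h7, h8⟩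
        exact ⟨⟨by linarith, by linarith⟩, by linarith, by linarith⟩
      rw [measureReal_sdiff hsub (measurableSet_Rc _ _ _ _ _) (volume_Rc_lt_top _ _ _ _ _).ne, hp, hm]
      nlinarith
    · refine (measureReal_mono Set.sdiff_subset (volume_Rc_lt_top _ _ _ _ _).ne).trans ?_
      rw [hp]
      rcases not_and_or.1 hbig with h | h <;> push Not at h <;> nlinarith
  have hdisj : (G : Set (ℤ × ℤ)).PairwiseDisjoint cell := by
    have hfloor : ∀ d x, x ∈ cell d → d = (⌊η⁻¹ * x.1⌋, ⌊η⁻¹ * x.2⌋) := by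
      rintro ⟨d1, d2⟩ x ⟨⟨h1, h2⟩, h3, h4⟩
      simp only [latt, Prod.fst_sub, Prod.snd_sub, Prod.smul_fst, Prod.smul_snd,
        smul_eq_mul] at h1 h2 h3 h4
      rw [Prod.mk.injEq]
      exact ⟨(Int.floor_eq_iff.2 ⟨by linarith, by linarith⟩).symm,
        (Int.floor_eq_iff.2 ⟨by linarith, by linarith⟩).symm⟩
    intro d _ d' _ hne
    refine Set.disjoint_left.2 fun x hx hx' => hne ?_
    rw [hfloor d x hx, hfloor d' x hx']
  have hcellv : ∀ d, volume (cell d) = ENNReal.ofReal (η ^ 2) := by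
    intro d
    rw [hcell]
    simp only
    rw [volume_smul_sub_preimage (inv_pos.2 hη), volume_unitSq, mul_one, inv_pow, inv_inv]
  have hcard : (G.card : ℝ) * η ^ 2 ≤ 40 * η * ((x₁ - x₀) + (y₁ - y₀)) := by
    have h1 := measureReal_biUnion_finset hdisj (fun d _ => hcellm d) (μ := volume)
      (fun d _ => by rw [hcellv]; exact ENNReal.ofReal_ne_top)
    have h2 : ∀ d, volume.real (cell d) = η ^ 2 := by
      intro d
      rw [Measure.real, hcellv, ENNReal.toReal_ofReal (by positivity)]
    simp only [h2, Finset.sum_const, nsmul_eq_mul] at h1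
    rw [← h1]
    refine (measureReal_mono (Set.iUnion₂_subset hsubN)
      (ne_top_of_le_ne_top (volume_Rc_lt_top _ _ _ _ _).ne
        (measure_mono Set.sdiff_subset))).trans hvolN
  rw [hb.setIntegral_stage hδ L hη, ← Finset.sum_filter_ne_zero]
  refine (Finset.abs_sum_le_sum_abs _ _).trans ?_
  refine (Finset.sum_le_sum fun z _ => hb.abs_setIntegral_blk_le hr _ _).trans ?_
  rw [Finset.sum_const, nsmul_eq_mul]
  calc (G.card : ℝ) * (16 * (δ * η) ^ 2) = 16 * δ ^ 2 * ((G.card : ℝ) * η ^ 2) := by ring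
    _ ≤ 16 * δ ^ 2 * (40 * η * ((x₁ - x₀) + (y₁ - y₀))) := by gcongr
    _ = _ := by ring

end IsBlock

/-! ### The maximal estimate in transversal directions. -/

lemma lintegral_inv_Icc {a b : ℝ} (ha : 0 < a) (hab : a ≤ b) :
    ∫⁻ t in Set.Icc a b, ENNReal.ofReal t⁻¹ = ENNReal.ofReal (Real.log (b / a)) := by
  have h0 : ∀ t ∈ Set.Icc a b, 0 < t := fun t ht => ha.trans_le ht.1
  rw [← ofReal_integral_eq_lintegral_ofReal]
  · rw [integral_Icc_eq_integral_Ioc, ← intervalIntegral.integral_of_le hab,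
      integral_inv_of_pos ha (ha.trans_le hab)]
  · exact (continuousOn_inv₀.mono fun t ht => (h0 t ht).ne').integrableOn_compact isCompact_Icc
  · filter_upwards [ae_restrict_mem measurableSet_Icc] with t ht
    exact inv_nonneg.2 (h0 t ht).le

/-- A truncated hyperbolic profile: it bounds the averages, over rectangles with a long side in a
fixed direction, of a block of size `ρ`, as a function of the distance to the line through the
center of the block. -/
noncomputable def profile (ρ η κ t : ℝ) : ℝ :=
  if |t| < 4 * ρ then 4 * ρ else if |t| ≤ 2 * η then 2 * κ * ρ ^ 2 / |t| else 0

lemma profile_nonneg {ρ η κ : ℝ} (hρ : 0 ≤ ρ) (hκ : 0 ≤ κ) (t : ℝ) : 0 ≤ profile ρ η κ t := by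
  unfold profile; split_ifs <;> positivity

lemma measurable_profile (ρ η κ : ℝ) : Measurable (profile ρ η κ) := by
  unfold profile
  refine Measurable.ite (measurableSet_lt (by fun_prop) (by fun_prop)) (by fun_prop)
    (Measurable.ite (measurableSet_le (by fun_prop) (by fun_prop)) (by fun_prop) (by fun_prop))

/-- The core contributes `8 ρ` times `4 ρ`, the two hyperbolic tails a logarithm each. The factor
`κ` multiplies only the logarithm; this is where the smallness of transversal block integrals
enters. -/
lemma lintegral_profile_le {ρ η κ : ℝ} (hρ : 0 < ρ) (hρη : 2 * ρ ≤ η) (hκ : 0 ≤ κ) :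
    ∫⁻ t, ENNReal.ofReal (profile ρ η κ t) ≤
      ENNReal.ofReal (32 * ρ ^ 2 + 4 * κ * ρ ^ 2 * Real.log (η / (2 * ρ))) := by
  set g : ℝ → ENNReal := (Set.Icc (4 * ρ) (2 * η)).indicator fun t => ENNReal.ofReal t⁻¹ with hg
  have hgm : Measurable g := Measurable.indicator (by fun_prop) measurableSet_Icc
  have hgint : ∫⁻ t, g t = ENNReal.ofReal (Real.log (η / (2 * ρ))) := by
    rw [hg, lintegral_indicator measurableSet_Icc, lintegral_inv_Icc (by linarith) (by linarith)]
    congr 2; field_simp; ring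
  have hlog : 0 ≤ Real.log (η / (2 * ρ)) :=
    Real.log_nonneg (by rw [le_div_iff₀ (by linarith)]; linarith)
  have hpt : ∀ t, ENNReal.ofReal (profile ρ η κ t) ≤
      (Set.Ioo (-(4 * ρ)) (4 * ρ)).indicator (fun _ => ENNReal.ofReal (4 * ρ)) t +
        (ENNReal.ofReal (2 * κ * ρ ^ 2) * g t + ENNReal.ofReal (2 * κ * ρ ^ 2) * g (-t)) := by
    intro t
    unfold profile
    split_ifs with h1 h2
    · rw [Set.indicator_of_mem (show t ∈ Set.Ioo (-(4 * ρ)) (4 * ρ) from abs_lt.1 h1)]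
      exact le_self_add
    · refine le_trans ?_ le_add_self
      rw [div_eq_mul_inv, ENNReal.ofReal_mul (by positivity)]
      rcases le_total 0 t with h | h
      · rw [abs_of_nonneg h] at h1 h2 ⊢
        refine le_trans (le_of_eq ?_) le_self_add
        rw [hg, Set.indicator_of_mem (show t ∈ Set.Icc (4 * ρ) (2 * η) from ⟨not_lt.1 h1, h2⟩)]
      · rw [abs_of_nonpos h] at h1 h2 ⊢
        refine le_trans (le_of_eq ?_) le_add_self
        rw [hg, Set.indicator_of_mem (show -t ∈ Set.Icc (4 * ρ) (2 * η) from ⟨not_lt.1 h1, h2⟩)]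
    · simp
  refine (lintegral_mono hpt).trans ?_
  rw [lintegral_add_left (Measurable.indicator (by fun_prop) measurableSet_Ioo),
    lintegral_add_left (by fun_prop), lintegral_const_mul _ hgm,
    lintegral_const_mul _ (by fun_prop), lintegral_neg_eq_self (fun t => g t), hgint,
    lintegral_indicator measurableSet_Ioo, setLIntegral_const, Real.volume_Ioo,
    ← ENNReal.ofReal_mul (by positivity), ← ENNReal.ofReal_mul (by positivity),
    ← ENNReal.ofReal_add (by positivity) (by positivity),
    ← ENNReal.ofReal_add (by nlinarith) (by positivity)]
  exact ENNReal.ofReal_le_ofReal (by ring_nf; rfl)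

/-- The sum of `n` generations of copies of `b`, on lattices of ratio `M`. -/
noncomputable def multi (b : ℝ × ℝ → ℝ) (δ : ℝ) (L : ℕ) (η : ℝ) (M n : ℕ) (x : ℝ × ℝ) : ℝ :=
  ∑ i ∈ Finset.range n, stage b δ (L * M ^ i) (η / M ^ i) x

/-- Every generation subdivides the same large square. -/
lemma cast_mul_div_pow {M : ℕ} (hM : 0 < M) (L : ℕ) (η : ℝ) (i : ℕ) :
    ((L * M ^ i : ℕ) : ℝ) * (η / M ^ i) = L * η := by
  have : (M : ℝ) ^ i ≠ 0 := pow_ne_zero _ (by exact_mod_cast hM.ne')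
  push_cast; field_simp

/-- The points which are close to a block, in rotated coordinates. -/
def nearBlocks (s ρ : ℝ) (L : ℕ) (η : ℝ) : Set (ℝ × ℝ) :=
  ⋃ z ∈ cells L, rot s ⁻¹' (Set.Icc (al s (cent η z) - ρ * η) (al s (cent η z) + ρ * η) ×ˢ
    Set.Icc (ac s (cent η z) - ρ * η) (ac s (cent η z) + ρ * η))

lemma measurableSet_nearBlocks (s ρ : ℝ) (L : ℕ) (η : ℝ) :
    MeasurableSet (nearBlocks s ρ L η) :=
  Finset.measurableSet_biUnion _ fun _ _ =>
    (measurableSet_Icc.prod measurableSet_Icc).preimage (rot s).continuous.measurable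

lemma volume_nearBlocks_le (s : ℝ) {ρ η : ℝ} (hρ : 0 ≤ ρ) (hη : 0 ≤ η) (L : ℕ) :
    volume (nearBlocks s ρ L η) ≤ ENNReal.ofReal (4 * ρ ^ 2 * (2 * (L * η)) ^ 2) := by
  refine (measure_biUnion_finset_le _ _).trans ?_
  have : ∀ z, volume (rot s ⁻¹' (Set.Icc (al s (cent η z) - ρ * η) (al s (cent η z) + ρ * η) ×ˢ
    Set.Icc (ac s (cent η z) - ρ * η) (ac s (cent η z) + ρ * η))) =
      ENNReal.ofReal ((2 * ρ * η) ^ 2) := by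
    intro z
    rw [volume_rot_preimage, volume_prod_set, Real.volume_Icc, Real.volume_Icc,
      ← ENNReal.ofReal_mul (by nlinarith [mul_nonneg hρ hη])]
    congr 1; ring
  simp only [this]
  rw [Finset.sum_const, nsmul_eq_mul, ← ENNReal.ofReal_natCast,
    ← ENNReal.ofReal_mul (by positivity), card_cells]
  exact ENNReal.ofReal_le_ofReal (le_of_eq (by ring))

lemma volume_iUnion_nearBlocks_le (s : ℝ) {ρ η : ℝ} (hρ : 0 ≤ ρ) (hη : 0 ≤ η) (L n : ℕ) {M : ℕ}
    (hM : 0 < M) :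
    volume (⋃ i ∈ Finset.range n, nearBlocks s ρ (L * M ^ i) (η / M ^ i)) ≤
      ENNReal.ofReal (n * (4 * ρ ^ 2 * (2 * (L * η)) ^ 2)) := by
  refine (measure_biUnion_finset_le _ _).trans ?_
  refine (Finset.sum_le_sum fun i _ => volume_nearBlocks_le s hρ (by positivity) _).trans ?_
  simp only [cast_mul_div_pow hM]
  rw [Finset.sum_const, nsmul_eq_mul, Finset.card_range, ← ENNReal.ofReal_natCast,
    ← ENNReal.ofReal_mul (by positivity)]

namespace IsBlock

variable {b : ℝ × ℝ → ℝ} {δ : ℝ}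

lemma setIntegral_multi (hb : IsBlock b) (hδ : 0 < δ) (L : ℕ) {η : ℝ} (hη : 0 < η) {M : ℕ}
    (hM : 0 < M) (n : ℕ) (A : Set (ℝ × ℝ)) :
    ∫ x in A, multi b δ L η M n x =
      ∑ i ∈ Finset.range n, ∫ x in A, stage b δ (L * M ^ i) (η / M ^ i) x := by
  unfold multi
  exact integral_finsetSum _ fun i _ => (hb.integrable_stage hδ _ (by positivity)).integrableOn

/-- Bound for the integral of one block over a rectangle containing a point which is not too close
to the block. -/
lemma abs_setIntegral_blk_le_profile (hb : IsBlock b) {ρ η κ s : ℝ} (hρ : 0 < ρ)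
    (hρη : 2 * ρ ≤ η)
    (hκ : ∀ x₀ x₁ y₀ y₁, |∫ p in Rc s x₀ x₁ y₀ y₁, b p| ≤ κ) {y x : ℝ × ℝ} {x₀ x₁ y₀ y₁ : ℝ}
    (hx : x ∈ Rc s x₀ x₁ y₀ y₁) (hlong : y₁ - y₀ ≤ x₁ - x₀) (hη : y₁ - y₀ ≤ η)
    (hfar : ¬ (|al s x - al s y| ≤ 6 * ρ ∧ |ac s x - ac s y| ≤ 6 * ρ)) :
    |∫ p in Rc s x₀ x₁ y₀ y₁, blk b ρ y p| ≤ (y₁ - y₀) *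
      (if al s y ∈ Set.Ioo (x₀ - (x₁ - x₀)) (x₁ + (x₁ - x₀)) then
        profile ρ η κ (ac s x - ac s y) else 0) := by
  have hκ0 : 0 ≤ κ := (abs_nonneg _).trans (hκ 0 0 0 0)
  obtain ⟨⟨hx1, hx2⟩, hx3, hx4⟩ := hx
  have hpos : 0 < y₁ - y₀ := by linarith
  by_cases hzero : ∀ p ∈ Rc s x₀ x₁ y₀ y₁, blk b ρ y p = 0
  · rw [setIntegral_blk_eq_zero_of_disjoint (measurableSet_Rc _ _ _ _ _) hzero, abs_zero]
    refine mul_nonneg hpos.le ?_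
    split_ifs
    · exact profile_nonneg hρ.le hκ0 _
    · exact le_rfl
  push Not at hzero
  obtain ⟨p, ⟨⟨hp1, hp2⟩, hp3, hp4⟩, hp⟩ := hzero
  obtain ⟨h1, h2⟩ := hb.blk_ne_zero hρ hp s
  rw [abs_le] at h1 h2
  -- The support reaches `2 ρ` from the center; a rectangle with long side at most `4 ρ` meeting it
  -- would keep `x` within `6 ρ` in both coordinates.
  have hlen : 4 * ρ < x₁ - x₀ := by
    by_contra hle
    push Not at hle
    apply hfar
    rw [abs_le, abs_le]
    refine ⟨⟨by linarith, by linarith⟩, by linarith, by linarith⟩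
  rw [if_pos (show al s y ∈ Set.Ioo (x₀ - (x₁ - x₀)) (x₁ + (x₁ - x₀)) from
    ⟨by linarith, by linarith⟩)]
  have ht : |ac s x - ac s y| ≤ (y₁ - y₀) + 2 * ρ := by
    rw [abs_le]; constructor <;> linarith
  unfold profile
  -- Near the axis of the block the overlap bound is used. Farther away, reaching the block from `x`
  -- forces the short side to be at least half the transversal distance, and this turns the constant
  -- `κ ρ²` into a multiple of the short side. Beyond `2 η` the block cannot be reached.
  split_ifs with hc1 hc2
  · exact (hb.abs_setIntegral_blk_Rc_le hρ y s x₀ x₁ (by linarith)).trans (le_of_eq (by ring))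
  · push Not at hc1
    have hpos2 : 0 < |ac s x - ac s y| := by linarith
    rw [setIntegral_blk_Rc hρ, abs_mul, abs_of_pos (by positivity : 0 < ρ ^ 2), mul_div_assoc',
      le_div_iff₀ hpos2]
    have h5 := hκ ((x₀ - al s y) / ρ) ((x₁ - al s y) / ρ) ((y₀ - ac s y) / ρ) ((y₁ - ac s y) / ρ)
    have h6 : |ac s x - ac s y| ≤ 2 * (y₁ - y₀) := by linarith
    calc _ ≤ ρ ^ 2 * κ * (2 * (y₁ - y₀)) := by gcongr
      _ = _ := by ring
  · exfalso; apply hc2; linarith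

/-- Maximal estimate for slopes which are transversal to the blocks: the set of points belonging to
a rectangle of slope `s`, with its longer side along the first direction, over which the average of
`multi` is large. -/
lemma volume_bad_half_le (hb : IsBlock b) (hδ : 0 < δ) (hδ' : δ ≤ 1 / 8) (L : ℕ) {η : ℝ}
    (hη : 0 < η) {M : ℕ} (hM : 0 < M) (n : ℕ) {s κ ε : ℝ} (hε : 0 < ε)
    (hκ : ∀ x₀ x₁ y₀ y₁, |∫ p in Rc s x₀ x₁ y₀ y₁, b p| ≤ κ)
    (hn : n * (1280 * δ ^ 2) ≤ ε / 2) :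
    volume {x | ∃ x₀ x₁ y₀ y₁, x ∈ Rc s x₀ x₁ y₀ y₁ ∧ y₁ - y₀ ≤ x₁ - x₀ ∧
      ε * ((x₁ - x₀) * (y₁ - y₀)) < |∫ p in Rc s x₀ x₁ y₀ y₁, multi b δ L η M n p|} ≤
    ENNReal.ofReal (n * δ ^ 2 * (2 * (L * η)) ^ 2 *
      (144 + 30 / ε * (32 + 4 * κ * Real.log (1 / (2 * δ))))) := by
  classical
  have hκ0 : 0 ≤ κ := (abs_nonneg _).trans (hκ 0 0 0 0)
  have hM' : (0 : ℝ) < M := by exact_mod_cast hM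
  have hlog : 0 ≤ Real.log (1 / (2 * δ)) :=
    Real.log_nonneg (by rw [le_div_iff₀ (by linarith)]; linarith)
  have hηi : ∀ i : ℕ, 0 < η / M ^ i := fun i => by positivity
  set Bad := {x | ∃ x₀ x₁ y₀ y₁, x ∈ Rc s x₀ x₁ y₀ y₁ ∧ y₁ - y₀ ≤ x₁ - x₀ ∧
      ε * ((x₁ - x₀) * (y₁ - y₀)) < |∫ p in Rc s x₀ x₁ y₀ y₁, multi b δ L η M n p|} with hBad
  have hBadm : MeasurableSet Bad := by
    refine IsOpen.measurableSet (isOpen_iff_mem_nhds.2 ?_)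
    rintro x ⟨x₀, x₁, y₀, y₁, hx, h⟩
    exact mem_of_superset ((isOpen_Rc _ _ _ _ _).mem_nhds hx)
      fun y hy => ⟨x₀, x₁, y₀, y₁, hy, h⟩
  set Near := ⋃ i ∈ Finset.range n, nearBlocks s (6 * δ) (L * M ^ i) (η / M ^ i) with hNear
  have hNearm : MeasurableSet Near :=
    Finset.measurableSet_biUnion _ fun _ _ => measurableSet_nearBlocks _ _ _ _
  set F : Finset ((_ : ℕ) × (ℤ × ℤ)) := (Finset.range n).sigma fun i => cells (L * M ^ i) with hF
  set Y : ((_ : ℕ) × (ℤ × ℤ)) → ℝ × ℝ := fun k => cent (η / M ^ k.1) k.2 with hY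
  set φ : ((_ : ℕ) × (ℤ × ℤ)) → ℝ → ℝ := fun k q =>
    profile (δ * (η / M ^ k.1)) (η / M ^ k.1) κ (q - ac s (Y k)) with hφ
  have hφ0 : ∀ k q, 0 ≤ φ k q := fun k q =>
    profile_nonneg (by have := hηi k.1; positivity) hκ0 _
  -- a point of the bad set away from the blocks lies in the set of the maximal inequality
  have hkey : ∀ x ∈ Bad \ Near, ∃ a c, a < al s x ∧ al s x < c ∧ ε / 6 * (c - a) <
      ∑ k ∈ F, (if al s (Y k) ∈ Set.Ioo a c then φ k (ac s x) else 0) := by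
    rintro x ⟨⟨x₀, x₁, y₀, y₁, hx, hlong, hlarge⟩, hnear⟩
    have hx' := hx
    obtain ⟨⟨hx1, hx2⟩, hx3, hx4⟩ := hx
    have hpx : 0 < x₁ - x₀ := by linarith
    have hpy : 0 < y₁ - y₀ := by linarith
    -- The interval is three times the long side, which turns the remaining `ε / 2` into `ε / 6`.
    refine ⟨x₀ - (x₁ - x₀), x₁ + (x₁ - x₀), by linarith, by linarith, ?_⟩
    have hfar : ∀ i ∈ Finset.range n, ∀ z ∈ cells (L * M ^ i),
        ¬ (|al s x - al s (cent (η / M ^ i) z)| ≤ 6 * (δ * (η / M ^ i)) ∧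
          |ac s x - ac s (cent (η / M ^ i) z)| ≤ 6 * (δ * (η / M ^ i))) := by
      rintro i hi z hz ⟨h1, h2⟩
      rw [abs_le] at h1 h2
      apply hnear
      refine Set.mem_biUnion hi (Set.mem_biUnion hz ?_)
      simp only [Set.mem_preimage, rot_apply, Set.mem_prod, Set.mem_Icc]
      exact ⟨⟨by linarith, by linarith⟩, by linarith, by linarith⟩
    have hstage : ∀ i ∈ Finset.range n,
        |∫ p in Rc s x₀ x₁ y₀ y₁, stage b δ (L * M ^ i) (η / M ^ i) p| ≤
        1280 * δ ^ 2 * ((x₁ - x₀) * (y₁ - y₀)) + (y₁ - y₀) * ∑ z ∈ cells (L * M ^ i),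
          (if al s (Y ⟨i, z⟩) ∈ Set.Ioo (x₀ - (x₁ - x₀)) (x₁ + (x₁ - x₀)) then
            φ ⟨i, z⟩ (ac s x) else 0) := by
      intro i hi
      have hsum0 : 0 ≤ ∑ z ∈ cells (L * M ^ i),
          (if al s (Y ⟨i, z⟩) ∈ Set.Ioo (x₀ - (x₁ - x₀)) (x₁ + (x₁ - x₀)) then
            φ ⟨i, z⟩ (ac s x) else 0) :=
        Finset.sum_nonneg fun z _ => by
          split_ifs
          · exact hφ0 _ _
          · exact le_rfl
      have hi0 := hηi i
      -- Generations finer than the short side are handled by the boundary estimate, and their total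
      -- is absorbed by `ε / 2` through `hn`. Coarser generations are bounded block by block with
      -- the profile.
      by_cases hcase : η / M ^ i ≤ y₁ - y₀
      · have h1 := hb.abs_setIntegral_stage_le hδ hδ' (L * M ^ i) hi0 s
          (hcase.trans hlong) hcase
        have h2 : 640 * δ ^ 2 * (η / M ^ i) * ((x₁ - x₀) + (y₁ - y₀)) ≤
            640 * δ ^ 2 * (y₁ - y₀) * ((x₁ - x₀) + (x₁ - x₀)) := by gcongr
        nlinarith [mul_nonneg hpy.le hsum0]
      · push Not at hcase
        rw [hb.setIntegral_stage hδ _ hi0]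
        refine (Finset.abs_sum_le_sum_abs _ _).trans ?_
        rw [Finset.mul_sum]
        have h3 : 0 ≤ 1280 * δ ^ 2 * ((x₁ - x₀) * (y₁ - y₀)) := by positivity
        refine le_trans (Finset.sum_le_sum fun z hz => ?_) (le_add_of_nonneg_left h3)
        exact hb.abs_setIntegral_blk_le_profile (by positivity) (by nlinarith) hκ hx' hlong
          hcase.le (hfar i hi z hz)
    rw [hb.setIntegral_multi hδ L hη hM] at hlarge
    have h4 := hlarge.trans_le ((Finset.abs_sum_le_sum_abs _ _).trans (Finset.sum_le_sum hstage))
    rw [Finset.sum_add_distrib, Finset.sum_const, Finset.card_range, nsmul_eq_mul,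
      ← Finset.mul_sum, ← Finset.sum_sigma (f := fun k : (_ : ℕ) × (ℤ × ℤ) =>
        if al s (Y k) ∈ Set.Ioo (x₀ - (x₁ - x₀)) (x₁ + (x₁ - x₀)) then
            φ k (ac s x) else 0)] at h4
    have h5 : n * (1280 * δ ^ 2 * ((x₁ - x₀) * (y₁ - y₀))) ≤ ε / 2 * ((x₁ - x₀) * (y₁ - y₀)) := by
      rw [← mul_assoc]; gcongr
    have h6 : (y₁ - y₀) * (ε / 2 * (x₁ - x₀)) < (y₁ - y₀) * ∑ k ∈ F,
        (if al s (Y k) ∈ Set.Ioo (x₀ - (x₁ - x₀)) (x₁ + (x₁ - x₀)) then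
            φ k (ac s x) else 0) := by
      refine lt_of_le_of_lt ?_ (lt_of_lt_of_le (sub_lt_sub_right h4
        (ε / 2 * ((x₁ - x₀) * (y₁ - y₀)))) ?_)
      · exact le_of_eq (by ring)
      · linarith
    have h7 := lt_of_mul_lt_mul_left h6 hpy.le
    refine lt_of_le_of_lt (le_of_eq ?_) h7
    ring
  -- slicing
  have hE : volume (Bad \ Near) ≤ ∫⁻ q, ENNReal.ofReal (5 / (ε / 6) * ∑ k ∈ F, φ k q) := by
    set E' := (rot s).symm ⁻¹' (Bad \ Near) with hE'
    have hE'm : MeasurableSet E' :=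
      (hBadm.diff hNearm).preimage (rot s).symm.continuous.measurable
    have hE'v : volume (Bad \ Near) = volume E' := by
      rw [← volume_rot_preimage s E', hE', ← Set.preimage_comp]
      simp
    rw [hE'v, Measure.volume_eq_prod, Measure.prod_apply_symm hE'm]
    refine lintegral_mono fun q => ?_
    refine le_trans (measure_mono ?_) (volume_pointmass_maximal_le F (fun k => al s (Y k))
      (fun k => φ k q) (fun k _ => hφ0 k q) (by positivity : 0 < ε / 6))
    intro p hp
    have hpq : (rot s).symm (p, q) ∈ Bad \ Near := hp
    have hrot : rot s ((rot s).symm (p, q)) = (p, q) := (rot s).apply_symm_apply _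
    rw [rot_apply, Prod.mk.injEq] at hrot
    have := hkey _ hpq
    rwa [hrot.1, hrot.2] at this
  have hint : ∫⁻ q, ENNReal.ofReal (5 / (ε / 6) * ∑ k ∈ F, φ k q) ≤
      ENNReal.ofReal (30 / ε * (n * δ ^ 2 * (2 * (L * η)) ^ 2 *
        (32 + 4 * κ * Real.log (1 / (2 * δ))))) := by
    have hprof : ∀ i : ℕ, ∫⁻ t, ENNReal.ofReal (profile (δ * (η / M ^ i)) (η / M ^ i) κ t) ≤
        ENNReal.ofReal ((η / M ^ i) ^ 2 * (δ ^ 2 * (32 + 4 * κ * Real.log (1 / (2 * δ))))) := by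
      intro i
      have hi0 := hηi i
      refine (lintegral_profile_le (by positivity) (by nlinarith) hκ0).trans
        (ENNReal.ofReal_le_ofReal (le_of_eq ?_))
      have : η / (M : ℝ) ^ i / (2 * (δ * (η / M ^ i))) = 1 / (2 * δ) := by field_simp
      rw [this]; ring
    have hφm : ∀ k, Measurable fun q => ENNReal.ofReal (φ k q) := fun k =>
      ((measurable_profile _ _ _).comp (by fun_prop)).ennreal_ofReal
    simp only [ENNReal.ofReal_mul (show 0 ≤ 5 / (ε / 6) by positivity),
      ENNReal.ofReal_sum_of_nonneg (fun k _ => hφ0 k _)]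
    rw [lintegral_const_mul _ (Finset.measurable_fun_sum _ fun k _ => hφm k),
      lintegral_finsetSum _ fun k _ => hφm k,
      ENNReal.ofReal_mul (show 0 ≤ 30 / ε by positivity), Finset.sum_sigma]
    refine mul_le_mul' (ENNReal.ofReal_le_ofReal (le_of_eq (by field_simp; norm_num))) ?_
    have hone : ∀ i ∈ Finset.range n, ∑ z ∈ cells (L * M ^ i), ∫⁻ q, ENNReal.ofReal (φ ⟨i, z⟩ q) ≤
        ENNReal.ofReal (δ ^ 2 * (2 * (L * η)) ^ 2 * (32 + 4 * κ * Real.log (1 / (2 * δ)))) := by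
      intro i _
      have h1 : ∀ z ∈ cells (L * M ^ i), ∫⁻ q, ENNReal.ofReal (φ ⟨i, z⟩ q) ≤
          ENNReal.ofReal ((η / M ^ i) ^ 2 * (δ ^ 2 * (32 + 4 * κ * Real.log (1 / (2 * δ))))) := by
        intro z _
        simp only [hφ]
        rw [lintegral_sub_right_eq_self (fun q => ENNReal.ofReal
          (profile (δ * (η / M ^ i)) (η / M ^ i) κ q))]
        exact hprof i
      refine (Finset.sum_le_sum h1).trans ?_
      rw [Finset.sum_const, nsmul_eq_mul, ← ENNReal.ofReal_natCast,
        ← ENNReal.ofReal_mul (by positivity), card_cells]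
      refine ENNReal.ofReal_le_ofReal (le_of_eq ?_)
      rw [← cast_mul_div_pow hM L η i]; ring
    refine (Finset.sum_le_sum hone).trans ?_
    rw [Finset.sum_const, nsmul_eq_mul, Finset.card_range, ← ENNReal.ofReal_natCast,
      ← ENNReal.ofReal_mul (by positivity)]
    exact ENNReal.ofReal_le_ofReal (le_of_eq (by ring))
  have hNearv : volume Near ≤ ENNReal.ofReal (n * (4 * (6 * δ) ^ 2 * (2 * (L * η)) ^ 2)) :=
    volume_iUnion_nearBlocks_le s (by positivity) hη.le L n hM
  have hsub : Bad ⊆ Near ∪ (Bad \ Near) := fun x hx => by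
    by_cases h : x ∈ Near
    · exact Or.inl h
    · exact Or.inr ⟨hx, h⟩
  refine (measure_mono hsub).trans ((measure_union_le _ _).trans
    ((add_le_add hNearv (hE.trans hint)).trans ?_))
  rw [← ENNReal.ofReal_add (by positivity) (by positivity)]
  exact ENNReal.ofReal_le_ofReal (le_of_eq (by ring))

end IsBlock

/-! ### Hyperbolic regions and large averages in the good directions. -/

/-- The points of the unit square which, in coordinates of slope `s` around its center, lie in a
part of a quadrant bounded by a hyperbola. -/
def hyperbolic (s δ : ℝ) : Set (ℝ × ℝ) :=
  {ξ | 4 * δ ≤ al s (ξ - (1 / 2, 1 / 2)) ∧ al s (ξ - (1 / 2, 1 / 2)) ≤ 1 / 6 ∧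
    4 * δ ≤ -ac s (ξ - (1 / 2, 1 / 2)) ∧ -ac s (ξ - (1 / 2, 1 / 2)) ≤ 1 / 6 ∧
    al s (ξ - (1 / 2, 1 / 2)) * -ac s (ξ - (1 / 2, 1 / 2)) ≤ 16 * δ}

/-- A slightly smaller set than `hyperbolic`. -/
def hyperbolicCore (s δ : ℝ) : Set (ℝ × ℝ) :=
  {ξ | 64 * δ ≤ al s (ξ - (1 / 2, 1 / 2)) ∧ al s (ξ - (1 / 2, 1 / 2)) ≤ 1 / 8 ∧
    5 * δ ≤ -ac s (ξ - (1 / 2, 1 / 2)) ∧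
    al s (ξ - (1 / 2, 1 / 2)) * -ac s (ξ - (1 / 2, 1 / 2)) ≤ 8 * δ}

lemma neg_ac_le_of_mem_hyperbolicCore {s δ : ℝ} (hδ : 0 < δ) {ξ : ℝ × ℝ}
    (h : ξ ∈ hyperbolicCore s δ) : -ac s (ξ - (1 / 2, 1 / 2)) ≤ 1 / 8 := by
  obtain ⟨h1, -, h3, h4⟩ := h
  by_contra hh
  push Not at hh
  nlinarith

lemma hyperbolicCore_subset {s δ : ℝ} (hδ : 0 < δ) : hyperbolicCore s δ ⊆ unitSq := by
  intro ξ h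
  have h5 := neg_ac_le_of_mem_hyperbolicCore hδ h
  obtain ⟨h1, h2, h3, h4⟩ := h
  have e1 : |al s (ξ - (1 / 2, 1 / 2))| ≤ 1 / 8 := abs_le.2 ⟨by linarith, h2⟩
  have e2 : |ac s (ξ - (1 / 2, 1 / 2))| ≤ 1 / 8 := abs_le.2 ⟨by linarith, by linarith⟩
  have e3 := abs_le.1 (abs_fst_le s e1 e2)
  have e4 := abs_le.1 (abs_snd_le s e1 e2)
  simp only [Prod.fst_sub, Prod.snd_sub] at e3 e4
  exact ⟨⟨by linarith, by linarith⟩, by linarith, by linarith⟩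

/-- A shift by `r` changes each rotated coordinate by at most `2 r ≤ δ`, and the constants of the
two regions leave that much room. So a subsquare touching the core lies in `hyperbolic`, as the
covering argument requires. -/
lemma mem_hyperbolic_of_near {s δ r : ℝ} (hδ : 0 < δ) (hδ' : δ ≤ 1 / 1024) (hr : 2 * r ≤ δ)
    {p q : ℝ × ℝ} (hp : p ∈ hyperbolicCore s δ) (h1 : |p.1 - q.1| ≤ r) (h2 : |p.2 - q.2| ≤ r) :
    q ∈ hyperbolic s δ := by
  have h5 := neg_ac_le_of_mem_hyperbolicCore hδ hp
  obtain ⟨p1, p2, p3, p4⟩ := hp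
  have n1 := abs_al_le s (p := p - q) h1 h2
  have n2 := abs_ac_le s (p := p - q) h1 h2
  have e : p - q = (p - (1 / 2, 1 / 2)) - (q - (1 / 2, 1 / 2)) := by abel
  rw [e, al_sub] at n1
  rw [e, ac_sub] at n2
  unfold hyperbolic
  simp only [Set.mem_ofPred_eq]
  set a := al s (p - (1 / 2, 1 / 2))
  set c := ac s (p - (1 / 2, 1 / 2))
  set a' := al s (q - (1 / 2, 1 / 2))
  set c' := ac s (q - (1 / 2, 1 / 2))
  rw [abs_le] at n1 n2
  refine ⟨by linarith, by linarith, by linarith, by linarith, ?_⟩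
  have i1 : a' ≤ a + δ := by linarith
  have i2 : -c' ≤ -c + δ := by linarith
  have i3 : 0 ≤ -c' := by linarith
  calc a' * -c' ≤ (a + δ) * (-c + δ) := by
        apply mul_le_mul i1 i2 i3; linarith
    _ ≤ 16 * δ := by nlinarith

lemma measurableSet_hyperbolicCore (s δ : ℝ) : MeasurableSet (hyperbolicCore s δ) := by
  have m1 : Measurable fun ξ : ℝ × ℝ => al s (ξ - (1 / 2, 1 / 2)) :=
    (continuous_al s).measurable.comp (by fun_prop)
  have m2 : Measurable fun ξ : ℝ × ℝ => ac s (ξ - (1 / 2, 1 / 2)) :=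
    (continuous_ac s).measurable.comp (by fun_prop)
  exact (measurableSet_le measurable_const m1).inter ((measurableSet_le m1 measurable_const).inter
    ((measurableSet_le measurable_const m2.neg).inter
      (measurableSet_le (m1.mul m2.neg) measurable_const)))

/-- The section at abscissa `p` has length `8 δ / p - 5 δ`, at least `3 δ / p` since `p ≤ 1`.
Integrating `1 / p` from `64 δ` to `1 / 8` gives the logarithm. -/
lemma le_volume_hyperbolicCore {s δ : ℝ} (hδ : 0 < δ) (hδ' : δ ≤ 1 / 1024) :
    3 * δ * Real.log (1 / (512 * δ)) ≤ volume.real (hyperbolicCore s δ) := by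
  have hlog : 0 ≤ Real.log (1 / (512 * δ)) :=
    Real.log_nonneg (by rw [le_div_iff₀ (by linarith)]; linarith)
  set W : Set (ℝ × ℝ) := {p | 64 * δ ≤ p.1 ∧ p.1 ≤ 1 / 8 ∧ 5 * δ ≤ -p.2 ∧ p.1 * -p.2 ≤ 8 * δ}
    with hW
  have hWm : MeasurableSet W := by
    have m1 : Measurable fun p : ℝ × ℝ => p.1 := measurable_fst
    have m2 : Measurable fun p : ℝ × ℝ => p.2 := measurable_snd
    exact (measurableSet_le measurable_const m1).inter ((measurableSet_le m1 measurable_const).inter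
      ((measurableSet_le measurable_const m2.neg).inter
        (measurableSet_le (m1.mul m2.neg) measurable_const)))
  have heq : hyperbolicCore s δ = (fun ξ => ξ - ((1 / 2, 1 / 2) : ℝ × ℝ)) ⁻¹' (rot s ⁻¹' W) := rfl
  have hvol : volume (hyperbolicCore s δ) = volume W := by
    rw [heq, show (fun ξ : ℝ × ℝ => ξ - ((1 / 2, 1 / 2) : ℝ × ℝ)) =
      fun ξ => ξ + -((1 / 2, 1 / 2) : ℝ × ℝ) by simp only [sub_eq_add_neg],
      measure_preimage_add_right, volume_rot_preimage]
  have hfin : volume (hyperbolicCore s δ) ≠ ⊤ :=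
    ne_top_of_le_ne_top (by simp [volume_unitSq]) (measure_mono (hyperbolicCore_subset hδ))
  rw [Measure.real, ← ENNReal.ofReal_le_iff_le_toReal hfin, hvol, Measure.volume_eq_prod,
    Measure.prod_apply hWm, ENNReal.ofReal_mul (by positivity)]
  have e : Real.log (1 / (512 * δ)) = Real.log (1 / 8 / (64 * δ)) := by congr 1; field_simp; norm_num
  rw [e, ← lintegral_inv_Icc (by positivity) (by linarith), ← lintegral_const_mul _ (by fun_prop),
    ← lintegral_indicator measurableSet_Icc]
  refine lintegral_mono fun p => ?_
  by_cases hp : p ∈ Set.Icc (64 * δ) (1 / 8)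
  · rw [Set.indicator_of_mem hp]
    have hp0 : 0 < p := by have := hp.1; linarith
    have : Set.Icc (-(8 * δ * p⁻¹)) (-(5 * δ)) ⊆ Prod.mk p ⁻¹' W := by
      intro q hq
      refine ⟨hp.1, hp.2, by have := hq.2; linarith, ?_⟩
      have h1 : -q ≤ 8 * δ * p⁻¹ := by have := hq.1; linarith
      calc p * -q ≤ p * (8 * δ * p⁻¹) := by gcongr
        _ = 8 * δ := by field_simp
    refine le_trans ?_ (measure_mono this)
    rw [Real.volume_Icc, ← ENNReal.ofReal_mul (by positivity)]
    refine ENNReal.ofReal_le_ofReal ?_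
    have h1 : 1 ≤ p⁻¹ := (one_le_inv₀ hp0).2 (by have := hp.2; linarith)
    nlinarith
  · rw [Set.indicator_of_notMem hp]; exact zero_le

lemma al_inv_smul_sub (s : ℝ) {η : ℝ} (hη : 0 < η) (x y : ℝ × ℝ) :
    al s x - al s y = η * al s (η⁻¹ • (x - y)) := by
  rw [al_smul, al_sub]; field_simp

lemma ac_inv_smul_sub (s : ℝ) {η : ℝ} (hη : 0 < η) (x y : ℝ × ℝ) :
    ac s x - ac s y = η * ac s (η⁻¹ • (x - y)) := by
  rw [ac_smul, ac_sub]; field_simp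

lemma inv_smul_sub_cent {η : ℝ} (hη : 0 < η) (x : ℝ × ℝ) (z : ℤ × ℤ) :
    η⁻¹ • (x - cent η z) = η⁻¹ • x - latt z - (1 / 2, 1 / 2) := by
  rw [smul_sub, cent, smul_smul, inv_mul_cancel₀ hη.ne', one_smul, sub_sub]

lemma eq_of_cent_near {η : ℝ} (hη : 0 < η) {z z' : ℤ × ℤ}
    (h1 : |(cent η z).1 - (cent η z').1| < η) (h2 : |(cent η z).2 - (cent η z').2| < η) :
    z = z' := by
  have key : ∀ k k' : ℤ, |η * ((k : ℝ) + 1 / 2) - η * (k' + 1 / 2)| < η → k = k' := by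
    intro k k' h
    have e : η * ((k : ℝ) + 1 / 2) - η * (k' + 1 / 2) = η * (k - k') := by ring
    rw [e, abs_mul, abs_of_pos hη] at h
    have h3 : |((k : ℝ) - k')| < 1 := by
      by_contra hh; push Not at hh; nlinarith
    have h4 : |k - k'| < 1 := by exact_mod_cast h3
    have := Int.abs_lt_one_iff.1 h4
    omega
  simp only [cent, latt, Prod.smul_fst, Prod.smul_snd, Prod.fst_add, Prod.snd_add,
    smul_eq_mul] at h1 h2
  exact Prod.ext (key _ _ h1) (key _ _ h2)

namespace IsBlock

variable {b : ℝ × ℝ → ℝ} {δ : ℝ}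

set_option maxHeartbeats 1000000 in
/-- Points in the hyperbolic part of one of the squares of generation `i`, away from the earlier
blocks, belong to a rectangle with a large average. -/
lemma exists_good_rect (hb : IsBlock b) (hδ : 0 < δ) (hδ' : δ ≤ 1 / 1024) (L : ℕ) {η : ℝ}
    (hη : 0 < η) {M n : ℕ} {s κ m : ℝ} (hm : 0 < m) (hM1 : 2 / δ ≤ M) (hM2 : 32000 * n / m ≤ M)
    (hκ : |κ| ≤ 1) (hκm : m ≤ ∫ p in {p | ac s p < κ}, b p) {x : ℝ × ℝ} {i : ℕ} (hi : i < n)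
    {z : ℤ × ℤ} (hz : z ∈ cells (L * M ^ i))
    (hx : (η / M ^ i)⁻¹ • x - latt z ∈ hyperbolic s δ)
    (hnear : x ∉ ⋃ i ∈ Finset.range n, nearBlocks s (6 * δ) (L * M ^ i) (η / M ^ i)) :
    ∃ x₀ x₁ y₀ y₁, x ∈ Rc s x₀ x₁ y₀ y₁ ∧ x₁ - x₀ ≤ η ∧ y₁ - y₀ ≤ η ∧
      16 * δ ^ 2 * (η / M ^ n) ^ 2 ≤ (x₁ - x₀) * (y₁ - y₀) ∧
      δ * m / 128 * ((x₁ - x₀) * (y₁ - y₀)) ≤ ∫ p in Rc s x₀ x₁ y₀ y₁, multi b δ L η M n p := by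
  have hMpos : (0 : ℝ) < M := lt_of_lt_of_le (by positivity) hM1
  have hM0 : 0 < M := by exact_mod_cast hMpos
  have hM1' : (1 : ℝ) ≤ M := by exact_mod_cast hM0
  have hMδ : 2 ≤ δ * M := by rw [div_le_iff₀ hδ] at hM1; linarith
  set H := η / M ^ i with hH
  have hH0 : 0 < H := by positivity
  have hHη : H ≤ η := div_le_self hη.le (one_le_pow₀ hM1')
  have hHn : η / M ^ n ≤ H := by
    rw [hH]; gcongr
  set y := cent H z with hy
  set P := al s (H⁻¹ • (x - y)) with hP
  set Q := -ac s (H⁻¹ • (x - y)) with hQ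
  have hxy : H⁻¹ • x - latt z - (1 / 2, 1 / 2) = H⁻¹ • (x - y) := (inv_smul_sub_cent hH0 x z).symm
  obtain ⟨g1, g2, g3, g4, g5⟩ := hx
  rw [hxy] at g1 g2 g3 g4 g5
  have hal : al s x = al s y + H * P := by
    have := al_inv_smul_sub s hH0 x y; linarith
  have hac : ac s x = ac s y - H * Q := by
    have := ac_inv_smul_sub s hH0 x y; rw [hQ]; linarith
  obtain ⟨hκ1, hκ2⟩ := abs_le.1 hκ
  set ρ := δ * H with hρ
  have hρ0 : 0 < ρ := by positivity
  have hPH : 4 * ρ ≤ H * P := by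
    have := mul_le_mul_of_nonneg_left g1 hH0.le
    rw [hρ]; linarith
  have hQH : 4 * ρ ≤ H * Q := by
    have := mul_le_mul_of_nonneg_left g3 hH0.le
    rw [hρ]; linarith
  have hPH' : H * P ≤ H / 6 := by
    have := mul_le_mul_of_nonneg_left g2 hH0.le
    linarith
  have hQH' : H * Q ≤ H / 6 := by
    have := mul_le_mul_of_nonneg_left g4 hH0.le
    linarith
  have hρH : ρ ≤ H / 1024 := by
    have := mul_le_mul_of_nonneg_right hδ' hH0.le
    rw [hρ]; linarith
  have hκρ : |κ * ρ| ≤ ρ := by 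
    rw [abs_mul, abs_of_pos hρ0]
    exact mul_le_of_le_one_left hρ0.le hκ
  obtain ⟨k1, k2⟩ := abs_le.1 hκρ
  have hx₁ : al s x + ρ - (al s y - 3 * ρ) = H * P + 4 * ρ := by rw [hal]; ring
  have hy₁ : ac s y + κ * ρ - (ac s x - ρ) = H * Q + (ρ + κ * ρ) := by rw [hac]; ring
  set ℓ₁ := al s x + ρ - (al s y - 3 * ρ) with hℓ₁
  set ℓ₂ := ac s y + κ * ρ - (ac s x - ρ) with hℓ₂
  -- The rectangle has the block near one corner and `x` near the opposite one. Three of its sides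
  -- clear the support of the block; the fourth, at height `κ ρ` above the center, cuts it along the
  -- good half plane.
  set R := Rc s (al s y - 3 * ρ) (al s x + ρ) (ac s x - ρ) (ac s y + κ * ρ) with hR
  have hℓ₁4 : 4 * ρ ≤ ℓ₁ := by linarith
  have hℓ₂4 : 4 * ρ ≤ ℓ₂ := by linarith
  have harea : ℓ₁ * ℓ₂ ≤ 48 * δ * H ^ 2 := by
    have a1 : ℓ₁ ≤ 2 * (H * P) := by linarith
    have a2 : ℓ₂ ≤ 3 / 2 * (H * Q) := by linarith
    calc ℓ₁ * ℓ₂ ≤ (2 * (H * P)) * (3 / 2 * (H * Q)) := by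
          apply mul_le_mul a1 a2 <;> linarith
      _ = 3 * (P * Q) * H ^ 2 := by ring
      _ ≤ 3 * (16 * δ) * H ^ 2 := by gcongr
      _ = _ := by ring
  have hℓ0 : 0 < ℓ₁ * ℓ₂ := mul_pos (by linarith) (by linarith)
  refine ⟨al s y - 3 * ρ, al s x + ρ, ac s x - ρ, ac s y + κ * ρ, ⟨⟨by linarith, by linarith⟩,
    by linarith, by linarith⟩, by linarith, by linarith, ?_, ?_⟩
  · calc 16 * δ ^ 2 * (η / M ^ n) ^ 2 ≤ 16 * δ ^ 2 * H ^ 2 := by gcongr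
      _ = (4 * ρ) * (4 * ρ) := by rw [hρ]; ring
      _ ≤ ℓ₁ * ℓ₂ := by gcongr; linarith
  -- points of the rectangle are close to the center of the square
  have hnearc : ∀ p ∈ R, |al s p - al s y| ≤ H / 6 + ρ ∧ |ac s p - ac s y| ≤ H / 6 + ρ := by
    rintro p ⟨⟨p1, p2⟩, p3, p4⟩
    rw [abs_le, abs_le]
    refine ⟨⟨by linarith, by linarith⟩, by linarith, by linarith⟩
  -- the contribution of the generation `i`
  have hmain : m * ρ ^ 2 ≤ ∫ p in R, stage b δ (L * M ^ i) H p := by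
    rw [hb.setIntegral_stage hδ _ hH0, Finset.sum_eq_single_of_mem z hz]
    · rw [setIntegral_blk_Rc hρ0, mul_comm m]
      refine mul_le_mul_of_nonneg_left (hκm.trans (le_of_eq ?_)) (by positivity)
      rw [← integral_indicator (isOpen_lt (continuous_ac s) continuous_const).measurableSet,
        ← integral_indicator (measurableSet_Rc _ _ _ _ _)]
      refine integral_congr_ae (Eventually.of_forall fun p => ?_)
      by_cases hp : b p = 0
      · rw [Set.indicator_apply_eq_zero.2 fun _ => hp, Set.indicator_apply_eq_zero.2 fun _ => hp]
      · obtain ⟨h1, h2⟩ := hb.supp p hp s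
        rw [abs_le] at h1 h2
        have q1 := mul_le_mul_of_nonneg_right h1.1 hρ0.le
        have q2 := mul_le_mul_of_nonneg_right h1.2 hρ0.le
        have q3 := mul_le_mul_of_nonneg_right h2.1 hρ0.le
        have e1 : (al s y - 3 * ρ - al s y) / ρ < al s p := by
          rw [div_lt_iff₀ hρ0]; linarith
        have e2 : al s p < (al s x + ρ - al s y) / ρ := by
          rw [lt_div_iff₀ hρ0]; linarith
        have e3 : (ac s x - ρ - ac s y) / ρ < ac s p := by
          rw [div_lt_iff₀ hρ0]; linarith
        have e4 : (ac s y + κ * ρ - ac s y) / ρ = κ := by field_simp; ring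
        have hiff : p ∈ Rc s ((al s y - 3 * ρ - al s y) / ρ) ((al s x + ρ - al s y) / ρ)
            ((ac s x - ρ - ac s y) / ρ) ((ac s y + κ * ρ - ac s y) / ρ) ↔
            p ∈ {p | ac s p < κ} := by
          rw [e4]
          exact ⟨fun h => h.2.2, fun h => ⟨⟨e1, e2⟩, e3, h⟩⟩
        by_cases h : p ∈ {p | ac s p < κ}
        · rw [Set.indicator_of_mem h, Set.indicator_of_mem (hiff.2 h)]
        · rw [Set.indicator_of_notMem h, Set.indicator_of_notMem fun h' => h (hiff.1 h')]
    · intro z' _ hne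
      refine setIntegral_blk_eq_zero_of_disjoint (measurableSet_Rc _ _ _ _ _) fun p hp => ?_
      by_contra hbp
      obtain ⟨h1, h2⟩ := hb.blk_ne_zero hρ0 hbp s
      obtain ⟨h3, h4⟩ := hnearc p hp
      rw [abs_le] at h1 h2 h3 h4
      have h5 : |al s (y - cent H z')| ≤ H / 6 + 3 * ρ := by
        rw [al_sub, abs_le]; constructor <;> linarith
      have h6 : |ac s (y - cent H z')| ≤ H / 6 + 3 * ρ := by
        rw [ac_sub, abs_le]; constructor <;> linarith
      refine hne (eq_of_cent_near hH0 ?_ ?_).symm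
      · exact (abs_fst_le s h5 h6).trans_lt (by linarith)
      · exact (abs_snd_le s h5 h6).trans_lt (by linarith)
  -- the contribution of the other generations
  have hother : ∀ j ∈ (Finset.range n).erase i,
      |∫ p in R, stage b δ (L * M ^ j) (η / M ^ j) p| ≤ 320 * δ / M * (ℓ₁ * ℓ₂) := by
    intro j hj
    obtain ⟨hji, hjn⟩ := Finset.mem_erase.1 hj
    have hj0 : 0 < η / M ^ j := by positivity
    -- The cells of generation `i` are tiny compared with the blocks of an earlier generation, and
    -- `x` is not near those, so the rectangle misses them. Blocks of a later generation are seen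
    -- only along the boundary, at relative cost `1 / M`.
    rcases lt_or_gt_of_ne hji with hlt | hgt
    · have hscale : H ≤ δ * (η / M ^ j) / 2 := by
        have h1 : H * M ≤ η / M ^ j := by
          rw [hH, div_mul_eq_mul_div, div_le_div_iff₀ (by positivity) (by positivity), mul_assoc,
            ← pow_succ']
          gcongr
          omega
        have a1 := mul_le_mul_of_nonneg_left h1 hδ.le
        have a2 := mul_le_mul_of_nonneg_left hMδ hH0.le
        linarith
      rw [hb.setIntegral_stage hδ _ hj0, Finset.sum_eq_zero, abs_zero]
      · positivity
      intro z' hz'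
      refine setIntegral_blk_eq_zero_of_disjoint (measurableSet_Rc _ _ _ _ _) fun p hp => ?_
      by_contra hbp
      obtain ⟨h1, h2⟩ := hb.blk_ne_zero (by positivity) hbp s
      obtain ⟨h3, h4⟩ := hnearc p hp
      rw [abs_le] at h1 h2 h3 h4
      refine hnear (Set.mem_biUnion hjn (Set.mem_biUnion hz' ?_))
      simp only [Set.mem_preimage, rot_apply, Set.mem_prod, Set.mem_Icc]
      exact ⟨⟨by linarith, by linarith⟩, by linarith, by linarith⟩
    · have hscale : η / M ^ j * M ≤ H := by
        rw [hH, div_mul_eq_mul_div, div_le_div_iff₀ (by positivity) (by positivity), mul_assoc,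
          ← pow_succ']
        gcongr
        omega
      have hscale2 : η / M ^ j ≤ ρ := by
        have a1 := mul_le_mul_of_nonneg_left hscale hδ.le
        have a2 := mul_le_mul_of_nonneg_left hMδ hj0.le
        rw [hρ]; linarith
      refine (hb.abs_setIntegral_stage_le hδ (by linarith) _ hj0 s (by linarith)
        (by linarith)).trans ?_
      have h1 : ρ * (ℓ₁ + ℓ₂) ≤ ℓ₁ * ℓ₂ / 2 := by
        have a1 := mul_le_mul_of_nonneg_right hℓ₁4 (show 0 ≤ ℓ₂ by linarith)
        have a2 := mul_le_mul_of_nonneg_left hℓ₂4 (show 0 ≤ ℓ₁ by linarith)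
        linarith
      have h2 : η / M ^ j ≤ H / M := by rw [le_div_iff₀ hMpos]; exact hscale
      calc 640 * δ ^ 2 * (η / M ^ j) * (ℓ₁ + ℓ₂) ≤ 640 * δ ^ 2 * (H / M) * (ℓ₁ + ℓ₂) := by
            gcongr
            linarith
        _ = 640 * δ / M * (ρ * (ℓ₁ + ℓ₂)) := by rw [hρ]; ring
        _ ≤ 640 * δ / M * (ℓ₁ * ℓ₂ / 2) := by gcongr
        _ = _ := by ring
  rw [hb.setIntegral_multi hδ L hη hM0, ← Finset.add_sum_erase _ _ (Finset.mem_range.2 hi)]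
  have hsum : |∑ j ∈ (Finset.range n).erase i,
      ∫ p in R, stage b δ (L * M ^ j) (η / M ^ j) p| ≤ δ * m / 100 * (ℓ₁ * ℓ₂) := by
    refine (Finset.abs_sum_le_sum_abs _ _).trans ((Finset.sum_le_sum hother).trans ?_)
    rw [Finset.sum_const, nsmul_eq_mul]
    have hc : (((Finset.range n).erase i).card : ℝ) ≤ n := by
      exact_mod_cast (Finset.card_le_card (Finset.erase_subset _ _)).trans (by simp)
    have h3 : n * (320 * δ / M) ≤ δ * m / 100 := by
      rw [div_le_iff₀ hm] at hM2
      rw [mul_div_assoc', div_le_div_iff₀ hMpos (by norm_num)]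
      have := mul_le_mul_of_nonneg_left hM2 hδ.le
      linarith
    calc _ ≤ n * (320 * δ / M * (ℓ₁ * ℓ₂)) := by gcongr
      _ = n * (320 * δ / M) * (ℓ₁ * ℓ₂) := by ring
      _ ≤ _ := by gcongr
  have hmain2 : δ * m / 48 * (ℓ₁ * ℓ₂) ≤ m * ρ ^ 2 := by
    calc δ * m / 48 * (ℓ₁ * ℓ₂) ≤ δ * m / 48 * (48 * δ * H ^ 2) := by gcongr
      _ = m * ρ ^ 2 := by rw [hρ]; ring
  -- Numerically, `1 / 48 - 1 / 100` exceeds `1 / 128`.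
  have := (abs_le.1 hsum).1
  have h9 : 0 ≤ δ * m * (ℓ₁ * ℓ₂) := by positivity
  linarith

/-- For slopes along which the blocks have a good half plane, most points belong to a rectangle
with a large average. -/
lemma volume_not_good_le (hb : IsBlock b) (hδ : 0 < δ) (hδ' : δ ≤ 1 / 1024) (L : ℕ) {η : ℝ}
    (hη : 0 < η) {M n : ℕ} {s κ m : ℝ} (hm : 0 < m) (hM1 : 2 / δ ≤ M) (hM2 : 32000 * n / m ≤ M)
    (hκ : |κ| ≤ 1) (hκm : m ≤ ∫ p in {p | ac s p < κ}, b p) :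
    volume {x | x ∈ box (L * η) ∧ ¬ ∃ x₀ x₁ y₀ y₁, x ∈ Rc s x₀ x₁ y₀ y₁ ∧ x₁ - x₀ ≤ η ∧
      y₁ - y₀ ≤ η ∧ 16 * δ ^ 2 * (η / M ^ n) ^ 2 ≤ (x₁ - x₀) * (y₁ - y₀) ∧
      δ * m / 128 * ((x₁ - x₀) * (y₁ - y₀)) ≤ ∫ p in Rc s x₀ x₁ y₀ y₁, multi b δ L η M n p} ≤
    ENNReal.ofReal ((2 * (L * η)) ^ 2 *
      (144 * n * δ ^ 2 + Real.exp (-(n * (3 * δ * Real.log (1 / (512 * δ))))))) := by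
  have hMpos : (0 : ℝ) < M := lt_of_lt_of_le (by positivity) hM1
  have hM0 : 0 < M := by exact_mod_cast hMpos
  set U := {x | x ∈ unitSq ∧ ∀ i < n, fr (((M ^ i : ℕ) : ℝ) • x) ∉ hyperbolic s δ} with hU
  set Near := ⋃ i ∈ Finset.range n, nearBlocks s (6 * δ) (L * M ^ i) (η / M ^ i) with hNear
  have hUv : volume U ≤ ENNReal.ofReal
      (Real.exp (-(n * (3 * δ * Real.log (1 / (512 * δ)))))) := by
    refine (volume_uncovered_le hM0 (hyperbolicCore_subset hδ) (measurableSet_hyperbolicCore s δ)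
      (fun p hp q h1 h2 => mem_hyperbolic_of_near hδ hδ' ?_ hp h1 h2) n).trans
      (ENNReal.ofReal_le_ofReal ?_)
    · rw [mul_one_div, div_le_iff₀ hMpos]; rw [div_le_iff₀ hδ] at hM1; linarith
    · have h1 := le_volume_hyperbolicCore (s := s) hδ hδ'
      have hle1 : volume.real (hyperbolicCore s δ) ≤ 1 := by
        have := measureReal_mono (μ := volume) (hyperbolicCore_subset (s := s) hδ)
          (by simp [volume_unitSq])
        rwa [measureReal_def volume unitSq, volume_unitSq, ENNReal.toReal_one] at this
      -- The inequality `1 - v ≤ exp (-v)` converts the uncovered proportion `(1 - v) ^ n` into an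
      -- exponential.
      have h2 : 1 - volume.real (hyperbolicCore s δ) ≤
          Real.exp (-(3 * δ * Real.log (1 / (512 * δ)))) := by
        have := Real.add_one_le_exp (-(3 * δ * Real.log (1 / (512 * δ))))
        linarith
      calc _ ≤ Real.exp (-(3 * δ * Real.log (1 / (512 * δ)))) ^ n :=
            pow_le_pow_left₀ (by linarith) h2 n
        _ = _ := by rw [← Real.exp_nat_mul]; congr 1; ring
  have hsub : {x | x ∈ box (L * η) ∧ ¬ ∃ x₀ x₁ y₀ y₁, x ∈ Rc s x₀ x₁ y₀ y₁ ∧ x₁ - x₀ ≤ η ∧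
      y₁ - y₀ ≤ η ∧ 16 * δ ^ 2 * (η / M ^ n) ^ 2 ≤ (x₁ - x₀) * (y₁ - y₀) ∧
      δ * m / 128 * ((x₁ - x₀) * (y₁ - y₀)) ≤ ∫ p in Rc s x₀ x₁ y₀ y₁, multi b δ L η M n p} ⊆
      Near ∪ {x | x ∈ box (L * η) ∧ fr (η⁻¹ • x) ∈ U} := by
    rintro x ⟨hx, hbad⟩
    by_cases hnear : x ∈ Near
    · exact Or.inl hnear
    refine Or.inr ⟨hx, fr_mem_unitSq _, fun i hi hhyp => hbad ?_⟩
    rw [fr_natCast_smul_fr, smul_smul] at hhyp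
    have e : ((M ^ i : ℕ) : ℝ) * η⁻¹ = (η / M ^ i)⁻¹ := by push_cast; field_simp
    rw [e, fr_eq_sub_latt] at hhyp
    have hx' : x ∈ box ((L * M ^ i : ℕ) * (η / M ^ i)) := by rwa [cast_mul_div_pow hM0]
    exact hb.exists_good_rect hδ hδ' L hη hm hM1 hM2 hκ hκm hi
      (floor_mem_cells (by positivity) hx') hhyp hnear
  refine (measure_mono hsub).trans ((measure_union_le _ _).trans ((add_le_add
    (volume_iUnion_nearBlocks_le s (by positivity) hη.le L n hM0)
    ((volume_box_fr_mem_le L hη U).trans (mul_le_mul_right hUv _))).trans ?_))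
  rw [← ENNReal.ofReal_mul (by positivity), ← ENNReal.ofReal_add (by positivity) (by positivity)]
  exact ENNReal.ofReal_le_ofReal (le_of_eq (by ring))

end IsBlock

/-! ### Choice of scales and the function attached to one angular interval. -/

/-- For `δ = exp (-u)` the logarithm of `1 / δ` is `u`. Choosing `n` with `n δ u` between `Λ` and `Λ
+ 1` fixes the covering exponent, while `n δ`, at most `(Λ + 1) / u`, is made small by enlarging
`u`. -/
lemma exists_scale {Λ X : ℝ} (hΛ : 0 ≤ Λ) (hX : 0 ≤ X) :
    ∃ (δ : ℝ) (n : ℕ), 0 < δ ∧ δ ≤ 1 / 1024 ∧ n * δ * X ≤ 1 ∧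
      Λ ≤ n * (3 * δ * Real.log (1 / (512 * δ))) ∧ n * δ * Real.log (1 / (2 * δ)) ≤ Λ + 1 := by
  set u := max 1024 ((Λ + 1) * X) with hu
  have hu1 : 1024 ≤ u := le_max_left _ _
  have hu2 : (Λ + 1) * X ≤ u := le_max_right _ _
  have hu0 : 0 < u := by linarith
  set δ := Real.exp (-u) with hδ
  have hδ0 : 0 < δ := Real.exp_pos _
  have hδu : δ * u ≤ 1 := by
    have h1 := Real.add_one_le_exp u
    rw [hδ, Real.exp_neg, inv_mul_le_iff₀ (Real.exp_pos _)]
    linarith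
  have hlogδ : Real.log δ = -u := Real.log_exp _
  have hlog1 : Real.log (1 / (512 * δ)) = u - Real.log 512 := by
    rw [one_div, Real.log_inv, Real.log_mul (by norm_num) hδ0.ne', hlogδ]; ring
  have hlog2 : Real.log (1 / (2 * δ)) = u - Real.log 2 := by
    rw [one_div, Real.log_inv, Real.log_mul (by norm_num) hδ0.ne', hlogδ]; ring
  have h512 : Real.log 512 ≤ 511 := by
    have := Real.log_le_sub_one_of_pos (show (0 : ℝ) < 512 by norm_num); linarith
  have hl2 : 0 ≤ Real.log 2 := Real.log_nonneg (by norm_num)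
  set n := ⌈Λ / (δ * u)⌉₊ with hn
  have hn1 : Λ ≤ n * (δ * u) := by
    have := Nat.le_ceil (Λ / (δ * u))
    rwa [div_le_iff₀ (by positivity)] at this
  have hn2 : n * (δ * u) ≤ Λ + 1 := by
    have := (Nat.ceil_lt_add_one (show 0 ≤ Λ / (δ * u) by positivity)).le
    have h3 : (n : ℝ) * (δ * u) ≤ (Λ / (δ * u) + 1) * (δ * u) := by gcongr
    have h4 : (Λ / (δ * u) + 1) * (δ * u) = Λ + δ * u := by field_simp
    linarith
  have hn0 : (0 : ℝ) ≤ n := Nat.cast_nonneg n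
  refine ⟨δ, n, hδ0, ?_, ?_, ?_, ?_⟩
  · nlinarith
  · have h5 : n * δ * X * u ≤ 1 * u := by
      calc n * δ * X * u = n * (δ * u) * X := by ring
        _ ≤ (Λ + 1) * X := by gcongr
        _ ≤ 1 * u := by linarith
    exact le_of_mul_le_mul_right h5 hu0
  · rw [hlog1]
    have h6 : u / 3 ≤ u - Real.log 512 := by linarith
    have h7 : n * (3 * δ * (u / 3)) ≤ n * (3 * δ * (u - Real.log 512)) := by gcongr
    linarith
  · rw [hlog2]
    have h8 : n * δ * (u - Real.log 2) ≤ n * δ * u := by gcongr; linarith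
    linarith

namespace IsBlock

variable {b : ℝ × ℝ → ℝ} {δ : ℝ}

lemma continuous_multi (hb : IsBlock b) (δ : ℝ) (L : ℕ) (η : ℝ) (M n : ℕ) :
    Continuous (multi b δ L η M n) := by
  unfold multi
  exact continuous_finsetSum _ fun i _ => hb.continuous_stage _ _ _

lemma hasCompactSupport_multi (hb : IsBlock b) (hδ : 0 < δ) (L : ℕ) {η : ℝ} (hη : 0 < η) {M : ℕ}
    (hM : 0 < M) (n : ℕ) : HasCompactSupport (multi b δ L η M n) := by
  have : multi b δ L η M n = ∑ i ∈ Finset.range n, stage b δ (L * M ^ i) (η / M ^ i) := by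
    funext x; rw [Finset.sum_apply]; rfl
  rw [this]
  refine Finset.sum_induction _ HasCompactSupport (fun f g hf hg => hf.add hg)
    HasCompactSupport.zero fun i _ => hb.hasCompactSupport_stage hδ _ (by positivity)

lemma integral_abs_multi_le (hb : IsBlock b) (hδ : 0 < δ) (L : ℕ) {η : ℝ} (hη : 0 < η) {M : ℕ}
    (hM : 0 < M) (n : ℕ) :
    ∫ x, |multi b δ L η M n x| ≤ n * (16 * δ ^ 2 * (2 * (L * η)) ^ 2) := by
  have hi : ∀ i : ℕ, Integrable (stage b δ (L * M ^ i) (η / M ^ i)) := fun i =>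
    hb.integrable_stage hδ _ (by positivity)
  calc ∫ x, |multi b δ L η M n x|
      ≤ ∫ x, ∑ i ∈ Finset.range n, |stage b δ (L * M ^ i) (η / M ^ i) x| := by
        refine integral_mono ((hb.continuous_multi δ L η M n).integrable_of_hasCompactSupport
          (hb.hasCompactSupport_multi hδ L hη hM n)).abs
          (integrable_finsetSum _ fun i _ => (hi i).abs) fun x => ?_
        exact Finset.abs_sum_le_sum_abs _ _
    _ = ∑ i ∈ Finset.range n, ∫ x, |stage b δ (L * M ^ i) (η / M ^ i) x| :=
        integral_finsetSum _ fun i _ => (hi i).abs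
    _ ≤ ∑ i ∈ Finset.range n, 16 * δ ^ 2 * (2 * (L * η)) ^ 2 := by
        refine Finset.sum_le_sum fun i _ => ?_
        rw [← cast_mul_div_pow hM L η i]
        exact hb.integral_abs_stage_le hδ _ (by positivity)
    _ = _ := by rw [Finset.sum_const, nsmul_eq_mul, Finset.card_range]

/-- Either side may be the longer one: the half estimate is applied at `s` and at `s + π / 2`, where
the hypothesis on block integrals is the same. -/
lemma volume_bad_le (hb : IsBlock b) (hδ : 0 < δ) (hδ' : δ ≤ 1 / 8) (L : ℕ) {η : ℝ}
    (hη : 0 < η) {M : ℕ} (hM : 0 < M) (n : ℕ) {s κ ε : ℝ} (hε : 0 < ε)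
    (hκ : ∀ x₀ x₁ y₀ y₁, |∫ p in Rc s x₀ x₁ y₀ y₁, b p| ≤ κ)
    (hn : n * (1280 * δ ^ 2) ≤ ε / 2) :
    volume {x | ∃ x₀ x₁ y₀ y₁, x ∈ Rc s x₀ x₁ y₀ y₁ ∧
      ε * ((x₁ - x₀) * (y₁ - y₀)) < |∫ p in Rc s x₀ x₁ y₀ y₁, multi b δ L η M n p|} ≤
    ENNReal.ofReal (2 * (n * δ ^ 2 * (2 * (L * η)) ^ 2 *
      (144 + 30 / ε * (32 + 4 * κ * Real.log (1 / (2 * δ)))))) := by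
  have hκ0 : 0 ≤ κ := (abs_nonneg _).trans (hκ 0 0 0 0)
  have hlog : 0 ≤ Real.log (1 / (2 * δ)) :=
    Real.log_nonneg (by rw [le_div_iff₀ (by linarith)]; linarith)
  have hκ' : ∀ x₀ x₁ y₀ y₁, |∫ p in Rc (s + Real.pi / 2) x₀ x₁ y₀ y₁, b p| ≤ κ := by
    intro x₀ x₁ y₀ y₁
    have := Rc_add_pi_div_two s (-y₁) (-y₀) x₀ x₁
    rw [neg_neg, neg_neg] at this
    rw [this]; exact hκ _ _ _ _
  have h1 := hb.volume_bad_half_le hδ hδ' L hη hM n hε hκ hn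
  have h2 := hb.volume_bad_half_le hδ hδ' L hη hM n hε hκ' hn
  rw [two_mul, ENNReal.ofReal_add (by positivity) (by positivity)]
  refine le_trans (measure_mono ?_) ((measure_union_le _ _).trans (add_le_add h1 h2))
  rintro x ⟨x₀, x₁, y₀, y₁, hx, h⟩
  rcases le_total (y₁ - y₀) (x₁ - x₀) with hle | hle
  · exact Or.inl ⟨x₀, x₁, y₀, y₁, hx, hle, h⟩
  · refine Or.inr ⟨y₀, y₁, -x₁, -x₀, ?_, by linarith, ?_⟩
    · rwa [Rc_add_pi_div_two]
    · rw [Rc_add_pi_div_two]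
      refine lt_of_le_of_lt (le_of_eq ?_) h
      ring

end IsBlock

/-- For every small angular interval around `c` there is a continuous function of small integral
norm which has large averages, at most points of a large square, over small rectangles of any slope
in the interval, and whose averages over all rectangles of any slope outside a larger interval
(modulo `π / 2`) are small at most points. -/
theorem exists_group (c t : ℝ) (ht : 0 < t) (ht' : t ≤ 1 / 3) (K : ℕ) {ε lam : ℝ} (hε : 0 < ε)
    (hlam : 0 < lam) :
    ∃ f : ℝ × ℝ → ℝ, Continuous f ∧ HasCompactSupport f ∧ ∫ x, |f x| ≤ ε ∧
      (∃ a > 0, ∀ s, |Real.sin (s - c)| ≤ t * Real.cos (s - c) →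
        volume {x | x ∈ box K ∧ ¬ ∃ x₀ x₁ y₀ y₁, x ∈ Rc s x₀ x₁ y₀ y₁ ∧ x₁ - x₀ ≤ ε ∧
          y₁ - y₀ ≤ ε ∧ a ≤ (x₁ - x₀) * (y₁ - y₀) ∧
          lam * ((x₁ - x₀) * (y₁ - y₀)) ≤ ∫ p in Rc s x₀ x₁ y₀ y₁, f p} ≤ ENNReal.ofReal ε) ∧
      ∀ s, 3 * t * |Real.cos (s - c)| ≤ |Real.sin (s - c)| →
        3 * t * |Real.sin (s - c)| ≤ |Real.cos (s - c)| →
        volume {x | ∃ x₀ x₁ y₀ y₁, x ∈ Rc s x₀ x₁ y₀ y₁ ∧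
          ε * ((x₁ - x₀) * (y₁ - y₀)) < |∫ p in Rc s x₀ x₁ y₀ y₁, f p|} ≤ ENNReal.ofReal ε := by
  set A : ℝ := (2 * K) ^ 2 with hA
  have hA0 : 0 ≤ A := by positivity
  set Λ := 2 * (A + 1) / ε with hΛ
  have hΛ0 : 0 ≤ Λ := by positivity
  have hexp : A * Real.exp (-Λ) ≤ ε / 2 := by
    rw [Real.exp_neg, ← div_eq_mul_inv, div_le_iff₀ (Real.exp_pos _)]
    have h1 := Real.add_one_le_exp Λ
    have h2 : ε / 2 * Λ = A + 1 := by rw [hΛ]; field_simp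
    nlinarith
  -- This ratio must be fixed before the block, so it cannot depend on `m`. That is possible because
  -- in the logarithmic term of the bad estimate the factor `m` of `κ = θ m` cancels the `1 / m` of
  -- the normalization `H`.
  set θ := ε ^ 2 / (4 * 2 * (A + 1) * 30 * 512 * lam * (Λ + 1)) with hθ
  have hθ0 : 0 < θ := by positivity
  obtain ⟨b, m, hm, hcont, hle, hsupp, hint, hgood, hbad⟩ := exists_block c t θ ht ht' hθ0
  have hb : IsBlock b := ⟨hcont, hle, hsupp, hint⟩
  -- Each `X` encodes one smallness condition `n δ X ≤ 1`: `X₁` the integral norm, `X₂` the points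
  -- near blocks, `X₃` the hypothesis on large rectangles, and `X₄`, `X₅` the terms of the bad
  -- estimate without logarithm.
  set X₁ := 2048 * lam * A / (m * ε) with hX₁
  set X₂ := 288 * A / ε with hX₂
  set X₃ := 327680 * lam / (m * ε) with hX₃
  set X₄ := 16 * 144 * A / ε with hX₄
  set X₅ := 16 * 30 * 128 * 32 * A * lam / (ε ^ 2 * m) with hX₅
  have p1 : 0 ≤ X₁ := by positivity
  have p2 : 0 ≤ X₂ := by positivity
  have p3 : 0 ≤ X₃ := by positivity
  have p4 : 0 ≤ X₄ := by positivity
  have p5 : 0 ≤ X₅ := by positivity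
  obtain ⟨δ, n, hδ, hδ', hX, hn1, hn2⟩ := exists_scale hΛ0 (show 0 ≤ X₁ + X₂ + X₃ + X₄ + X₅ by
    positivity)
  have hnδ : 0 ≤ n * δ := by positivity
  have hδ1 : δ ≤ 1 := by linarith
  have q1 : n * δ * X₁ ≤ 1 := le_trans (mul_le_mul_of_nonneg_left (by linarith) hnδ) hX
  have q2 : n * δ * X₂ ≤ 1 := le_trans (mul_le_mul_of_nonneg_left (by linarith) hnδ) hX
  have q3 : n * δ * X₃ ≤ 1 := le_trans (mul_le_mul_of_nonneg_left (by linarith) hnδ) hX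
  have q4 : n * δ * X₄ ≤ 1 := le_trans (mul_le_mul_of_nonneg_left (by linarith) hnδ) hX
  have q5 : n * δ * X₅ ≤ 1 := le_trans (mul_le_mul_of_nonneg_left (by linarith) hnδ) hX
  clear_value X₁ X₂ X₃ X₄ X₅
  have hlogpos : 0 ≤ Real.log (1 / (2 * δ)) :=
    Real.log_nonneg (by rw [le_div_iff₀ (by linarith)]; linarith)
  obtain ⟨M, hM⟩ := exists_nat_ge (max (2 / δ) (32000 * n / m))
  have hM1 : 2 / δ ≤ M := (le_max_left _ _).trans hM
  have hM2 : 32000 * n / m ≤ M := (le_max_right _ _).trans hM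
  have hMpos : (0 : ℝ) < M := lt_of_lt_of_le (by positivity) hM1
  have hM0 : 0 < M := by exact_mod_cast hMpos
  obtain ⟨N, hN⟩ := exists_nat_gt (1 / ε)
  have hN0 : (0 : ℝ) < N := lt_trans (by positivity) hN
  -- An inverse integer, so that the cells tile `box K` exactly.
  set η : ℝ := 1 / N with hη
  have hη0 : 0 < η := by positivity
  have hηε : η ≤ ε := by
    rw [hη, div_le_iff₀ hN0]; rw [div_lt_iff₀ hε] at hN; linarith
  have hLη : ((K * N : ℕ) : ℝ) * η = K := by push_cast; rw [hη]; field_simp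
  -- Normalization raising the guaranteed average `δ m / 128` to `lam`.
  set H := 128 * lam / (δ * m) with hH
  have hH0 : 0 < H := by positivity
  have hHδ : H * δ = 128 * lam / m := by rw [hH]; field_simp
  set g := multi b δ (K * N) η M n with hg
  have hgint : ∀ A, ∫ x in A, H * g x = H * ∫ x in A, g x := fun A => integral_const_mul _ _
  refine ⟨fun x => H * g x, continuous_const.mul (hb.continuous_multi _ _ _ _ _),
    (hb.hasCompactSupport_multi hδ (K * N) hη0 hM0 n).mul_left, ?_,
    ⟨16 * δ ^ 2 * (η / M ^ n) ^ 2, by positivity, ?_⟩, ?_⟩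
  · have h1 := hb.integral_abs_multi_le hδ (K * N) hη0 hM0 n
    rw [hLη] at h1
    simp only [abs_mul, abs_of_pos hH0]
    rw [integral_const_mul]
    calc H * ∫ x, |g x| ≤ H * (n * (16 * δ ^ 2 * A)) := by gcongr
      _ = n * δ * (H * δ) * 16 * A := by ring
      _ = ε * (n * δ * X₁) := by rw [hHδ, hX₁]; field_simp; ring
      _ ≤ ε * 1 := by gcongr
      _ = ε := mul_one _
  · intro s hs
    obtain ⟨κ, hκ, hκm⟩ := hgood s hs
    have h1 := hb.volume_not_good_le hδ hδ' (K * N) hη0 hm hM1 hM2 hκ hκm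
    rw [hLη] at h1
    refine le_trans (measure_mono ?_) (h1.trans (ENNReal.ofReal_le_ofReal ?_))
    · rintro x ⟨hx, hno⟩
      refine ⟨hx, fun ⟨x₀, x₁, y₀, y₁, h2, h3, h4, h5, h6⟩ => hno ⟨x₀, x₁, y₀, y₁, h2,
        h3.trans hηε, h4.trans hηε, h5, ?_⟩⟩
      rw [hgint]
      have h7 := mul_le_mul_of_nonneg_left h6 hH0.le
      refine le_trans (le_of_eq ?_) h7
      rw [hH]; field_simp
    · have h2 : Real.exp (-(n * (3 * δ * Real.log (1 / (512 * δ))))) ≤ Real.exp (-Λ) :=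
        Real.exp_le_exp.2 (by linarith)
      have h3 : A * Real.exp (-(n * (3 * δ * Real.log (1 / (512 * δ))))) ≤ ε / 2 :=
        (mul_le_mul_of_nonneg_left h2 hA0).trans hexp
      have h4 : A * (144 * n * δ ^ 2) ≤ ε / 2 := by
        calc A * (144 * n * δ ^ 2) = ε / 2 * (n * δ * X₂) * δ := by
              rw [hX₂]; field_simp; ring
          _ ≤ ε / 2 * 1 * 1 := by gcongr
          _ = ε / 2 := by ring
      rw [mul_add]; linarith
  · intro s hs1 hs2
    have hκ := hbad s hs1 hs2
    have hn3 : n * (1280 * δ ^ 2) ≤ ε / H / 2 := by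
      rw [div_div, le_div_iff₀ (by positivity)]
      calc n * (1280 * δ ^ 2) * (H * 2) = n * δ * (H * δ) * 2560 := by ring
        _ = ε * (n * δ * X₃) := by rw [hHδ, hX₃]; field_simp; ring
        _ ≤ ε * 1 := by gcongr
        _ = ε := mul_one _
    have h1 := hb.volume_bad_le hδ (by linarith) (K * N) hη0 hM0 n
      (show 0 < ε / H by positivity) hκ hn3
    rw [hLη] at h1
    refine le_trans (measure_mono ?_) (h1.trans (ENNReal.ofReal_le_ofReal ?_))
    · rintro x ⟨x₀, x₁, y₀, y₁, h2, h3⟩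
      refine ⟨x₀, x₁, y₀, y₁, h2, ?_⟩
      rw [hgint, abs_mul, abs_of_pos hH0] at h3
      rw [div_mul_eq_mul_div, div_lt_iff₀ hH0]
      linarith
    · have e1 : 2 * (n * δ ^ 2 * A * (144 + 30 / (ε / H) *
          (32 + 4 * (θ * m) * Real.log (1 / (2 * δ))))) =
          ε / 8 * (n * δ * X₄) * δ + ε / 8 * (n * δ * X₅) +
            2 * 30 * 512 * lam / ε * A * θ * (n * δ * Real.log (1 / (2 * δ))) := by
        have : 30 / (ε / H) = 30 * 128 * lam / (ε * δ * m) := by rw [hH]; field_simp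
        rw [this, hX₄, hX₅]; field_simp; ring
      rw [← hA, e1]
      have f1 : ε / 8 * (n * δ * X₄) * δ ≤ ε / 8 := by
        calc ε / 8 * (n * δ * X₄) * δ ≤ ε / 8 * 1 * 1 := by gcongr
          _ = ε / 8 := by ring
      have f2 : ε / 8 * (n * δ * X₅) ≤ ε / 8 := by
        calc ε / 8 * (n * δ * X₅) ≤ ε / 8 * 1 := by gcongr
          _ = ε / 8 := by ring
      have f3 : 2 * 30 * 512 * lam / ε * A * θ * (n * δ * Real.log (1 / (2 * δ))) ≤ ε / 4 := by
        calc _ ≤ 2 * 30 * 512 * lam / ε * (A + 1) * θ * (Λ + 1) := by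
              gcongr
              linarith
          _ = ε / 4 := by rw [hθ]; field_simp
      linarith

/-! ### Whitney intervals and the combinatorics of a `G_δ` set of slopes. -/

/-- The side of the dyadic intervals of generation `n`. -/
noncomputable def dyad (n : ℕ) : ℝ := (1 / 2) ^ (n + 4)

lemma dyad_pos (n : ℕ) : 0 < dyad n := by unfold dyad; positivity

lemma dyad_le (n : ℕ) : dyad n ≤ 1 / 16 := by
  unfold dyad
  rw [pow_add]
  have : (1 / 2 : ℝ) ^ n ≤ 1 := pow_le_one₀ (by norm_num) (by norm_num)
  norm_num at this ⊢
  linarith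

lemma dyad_succ (n : ℕ) : dyad n = 2 * dyad (n + 1) := by
  unfold dyad; rw [show n + 1 + 4 = (n + 4) + 1 by ring, pow_succ (1 / 2 : ℝ) (n + 4)]; ring

lemma tendsto_dyad : Tendsto dyad atTop (𝓝 0) :=
  (tendsto_pow_atTop_nhds_zero_of_lt_one (by norm_num) (by norm_num)).comp
    (tendsto_add_atTop_nat 4)

/-- The Whitney dyadic intervals of the set `G`. -/
def whitney (G : Set ℝ) : Set (ℕ × ℤ) :=
  {q | Metric.ball (q.2 * dyad q.1) (12 * dyad q.1) ⊆ G ∧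
    (q.1 = 0 ∨ ¬ Metric.ball (q.2 * dyad q.1) (48 * dyad q.1) ⊆ G)}

lemma exists_int_near (s : ℝ) {h : ℝ} (hh : 0 < h) : ∃ p : ℤ, |s - p * h| ≤ h := by
  refine ⟨⌊s / h⌋, ?_⟩
  have h1 := Int.floor_le (s / h)
  have h2 := (Int.lt_floor_add_one (s / h)).le
  rw [le_div_iff₀ hh] at h1
  rw [div_le_iff₀ hh] at h2
  rw [abs_le]; constructor <;> linarith

/-- The coarsest admissible generation works. If the ball of radius `48` units were still in `G`, a
dyadic point of the preceding generation near `s` would already be admissible, its ball of radius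
`24` units being off center by at most `3`. -/
lemma exists_mem_whitney {G : Set ℝ} (hG : IsOpen G) {s : ℝ} (hs : s ∈ G) :
    ∃ q ∈ whitney G, |s - q.2 * dyad q.1| ≤ dyad q.1 := by
  classical
  have hex : ∃ n : ℕ, ∃ p : ℤ, |s - p * dyad n| ≤ dyad n ∧
      Metric.ball (p * dyad n) (12 * dyad n) ⊆ G := by
    obtain ⟨ρ, hρ, hball⟩ := Metric.isOpen_iff.1 hG s hs
    obtain ⟨n, hn⟩ := (tendsto_dyad.eventually (gt_mem_nhds (show 0 < ρ / 13 by positivity))).exists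
    obtain ⟨p, hp⟩ := exists_int_near s (dyad_pos n)
    refine ⟨n, p, hp, fun x hx => hball ?_⟩
    rw [Metric.mem_ball, Real.dist_eq, abs_lt] at hx ⊢
    rw [abs_le] at hp
    constructor <;> linarith
  obtain ⟨p, hp, hball⟩ := Nat.find_spec hex
  set n := Nat.find hex with hn
  refine ⟨(n, p), ⟨hball, ?_⟩, hp⟩
  by_contra hcon
  push Not at hcon
  obtain ⟨hn0, hbig⟩ := hcon
  obtain ⟨k, hk⟩ := Nat.exists_eq_succ_of_ne_zero hn0
  obtain ⟨p', hp'⟩ := exists_int_near s (dyad_pos k)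
  have hmin := Nat.find_min hex (m := k) (by omega)
  apply hmin
  refine ⟨p', hp', fun x hx => hbig ?_⟩
  have hdn : dyad n = dyad (k + 1) := congrArg dyad hk
  change x ∈ Metric.ball (p * dyad n) (48 * dyad n)
  rw [dyad_succ k] at hp' hx
  rw [Metric.mem_ball, Real.dist_eq, abs_lt] at hx ⊢
  rw [abs_le] at hp hp'
  have := dyad_pos (k + 1)
  constructor <;> linarith

lemma finite_whitney_near {G : Set ℝ} (hG : IsOpen G) (s : ℝ) :
    {q | q ∈ whitney G ∧ |s - q.2 * dyad q.1| < 12 * dyad q.1}.Finite := by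
  by_cases hs : s ∈ G
  · obtain ⟨ρ, hρ, hball⟩ := Metric.isOpen_iff.1 hG s hs
    obtain ⟨N, hN⟩ := eventually_atTop.1
      (tendsto_dyad.eventually (gt_mem_nhds (show 0 < ρ / 60 by positivity)))
    refine Set.Finite.subset (s := ⋃ n ∈ Finset.range (N + 1),
      (fun p : ℤ => (n, p)) '' Set.Icc ⌊s / dyad n - 12⌋ ⌈s / dyad n + 12⌉) ?_ ?_
    · exact Set.Finite.biUnion (Finset.finite_toSet _)
        fun n _ => (Set.finite_Icc _ _).image _
    · rintro ⟨n, p⟩ ⟨⟨h1, h2⟩, h3⟩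
      simp only at h1 h2 h3
      have hd := dyad_pos n
      -- Since `s` is at distance more than `60 * dyad n` from the complement when `n` is large, the
      -- maximality clause bounds the generation.
      have hnN : n < N + 1 := by
        by_contra hlt
        push Not at hlt
        rcases h2 with h2 | h2
        · omega
        · have := hN n (by omega)
          refine h2 fun x hx => hball ?_
          rw [Metric.mem_ball, Real.dist_eq, abs_lt] at hx ⊢
          rw [abs_lt] at h3
          constructor <;> linarith
      refine Set.mem_biUnion (Finset.mem_coe.2 (Finset.mem_range.2 hnN)) ⟨p, ⟨?_, ?_⟩, rfl⟩
      · rw [← Int.cast_le (R := ℝ)]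
        refine (Int.floor_le _).trans ?_
        rw [abs_lt] at h3
        rw [sub_le_iff_le_add, div_le_iff₀ hd]
        linarith
      · rw [← Int.cast_le (R := ℝ)]
        refine le_trans ?_ (Int.le_ceil _)
        rw [abs_lt] at h3
        rw [← sub_le_iff_le_add, le_div_iff₀ hd]
        linarith
  · convert Set.finite_empty
    ext q
    simp only [Set.mem_ofPred_eq, Set.mem_empty_iff_false, iff_false, not_and]
    intro hq h
    exact hs (hq.1 (by rwa [Metric.mem_ball, Real.dist_eq]))

lemma abs_sin_le_mul_cos {σ h : ℝ} (hσ : |σ| ≤ h) (hh : h ≤ 1) :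
    |Real.sin σ| ≤ 2 * h * Real.cos σ := by
  have h1 : |Real.sin σ| ≤ |σ| := Real.abs_sin_le_abs
  have h2 := Real.one_sub_sq_div_two_le_cos (x := σ)
  have h0 := abs_nonneg σ
  have h3 : σ ^ 2 ≤ 1 := by rw [← sq_abs]; nlinarith
  nlinarith

lemma le_abs_sin_of_abs_le {τ : ℝ} (h : |τ| ≤ Real.pi / 2) : |τ| / 2 ≤ |Real.sin τ| := by
  have key : ∀ x : ℝ, 0 ≤ x → x ≤ Real.pi / 2 → x / 2 ≤ Real.sin x := by
    intro x h0 h1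
    refine le_trans ?_ (Real.mul_le_sin h0 h1)
    have : 1 / 2 ≤ 2 / Real.pi := by
      rw [div_le_div_iff₀ (by norm_num) Real.pi_pos]; linarith [Real.pi_le_four]
    nlinarith
  rcases le_total 0 τ with h0 | h0
  · rw [abs_of_nonneg h0] at h ⊢
    exact (key τ h0 h).trans (le_abs_self _)
  · rw [abs_of_nonpos h0] at h ⊢
    have := key (-τ) (by linarith) h
    rw [Real.sin_neg] at this
    exact this.trans (neg_le_abs _)

/-- Distance `12 h` from `0` and `± π / 2` bounds both `|sin σ|` and `|cos σ|` below by `6 h`, which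
suffices since each is at most `1`. Here `2 h` plays the role of `t`. -/
lemma transversal_of_far {σ h : ℝ} (hh : 0 < h) (hh' : h ≤ 1 / 16) (h1 : 12 * h ≤ |σ|)
    (h2 : 12 * h ≤ |σ - Real.pi / 2|) (h3 : 12 * h ≤ |σ + Real.pi / 2|)
    (hσ : |σ| ≤ Real.pi / 2 + 1) :
    3 * (2 * h) * |Real.cos σ| ≤ |Real.sin σ| ∧ 3 * (2 * h) * |Real.sin σ| ≤ |Real.cos σ| := by
  have hpi := Real.pi_gt_three
  have hcos1 : |Real.cos σ| ≤ 1 := Real.abs_cos_le_one σ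
  have hsin1 : |Real.sin σ| ≤ 1 := Real.abs_sin_le_one σ
  have hs : 6 * h ≤ |Real.sin σ| := by
    rcases le_total |σ| (Real.pi / 2) with h | h
    · have := le_abs_sin_of_abs_le h; linarith
    · have e : |Real.sin σ| = |Real.cos (|σ| - Real.pi / 2)| := by
        rw [Real.cos_sub_pi_div_two]
        rcases abs_cases σ with ⟨e, -⟩ | ⟨e, -⟩ <;> rw [e]
        rw [Real.sin_neg, abs_neg]
      have h4 := Real.one_sub_sq_div_two_le_cos (x := |σ| - Real.pi / 2)
      have h5 : (|σ| - Real.pi / 2) ^ 2 ≤ 1 := by nlinarith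
      rw [e]
      refine le_trans ?_ (le_abs_self _)
      linarith
  have hc : 6 * h ≤ |Real.cos σ| := by
    have e : |Real.cos σ| = |Real.sin (Real.pi / 2 - |σ|)| := by
      rw [Real.sin_pi_div_two_sub, Real.cos_abs]
    have h4 : |Real.pi / 2 - (|σ|)| ≤ Real.pi / 2 := by
      rw [abs_le]; constructor <;> linarith [abs_nonneg σ]
    have h5 : 12 * h ≤ |Real.pi / 2 - (|σ|)| := by
      rcases abs_cases σ with ⟨e, -⟩ | ⟨e, -⟩ <;> rw [e]
      · rwa [abs_sub_comm]
      · rwa [sub_neg_eq_add, add_comm]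
    rw [e]
    have := le_abs_sin_of_abs_le h4
    linarith
  constructor <;> nlinarith

/-- A `G_δ` set of slopes is squeezed by a decreasing sequence of open sets which also separates it
from the other slopes modulo `π / 2`. -/
lemma exists_open_seq {S : Set ℝ} (hS : S ⊆ Set.Ico 0 (Real.pi / 2))
    (hG : IsGδ ((fun s : Set.Ico (0 : ℝ) (Real.pi / 2) => (s : ℝ)) ⁻¹' S)) :
    ∃ G : ℕ → Set ℝ, (∀ k, IsOpen (G k)) ∧ (∀ k, G k ⊆ Set.Ioo (-1) (Real.pi / 2)) ∧
      (∀ s ∈ S, ∀ k, s ∈ G k) ∧ ∀ s ∈ Set.Ico 0 (Real.pi / 2) \ S, ∃ k₀, ∀ k ≥ k₀,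
        s ∉ G k ∧ s - Real.pi / 2 ∉ G k ∧ s + Real.pi / 2 ∉ G k := by
  have hpi := Real.pi_gt_three
  obtain ⟨f, hf, hfS⟩ := hG.eq_iInter_nat
  choose V hV hVf using fun n => isOpen_induced_iff.1 (hf n)
  have hmem : ∀ s ∈ Set.Ico (0 : ℝ) (Real.pi / 2), s ∈ S ↔ ∀ n, s ∈ V n := by
    intro s hs
    have h1 : (⟨s, hs⟩ : Set.Ico (0 : ℝ) (Real.pi / 2)) ∈
        (fun s : Set.Ico (0 : ℝ) (Real.pi / 2) => (s : ℝ)) ⁻¹' S ↔ ∀ n, s ∈ V n := by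
      rw [hfS, Set.mem_iInter]
      refine forall_congr' fun n => ?_
      rw [← hVf n]; rfl
    exact h1
  -- The endpoint `0` is handled by shrinking balls, added only when `0 ∈ S`. These can reach below
  -- zero, hence meet slopes `s - π / 2` with `s` close to `π / 2`, but only for finitely many `k`.
  refine ⟨fun k => ((⋂ j ∈ Set.Iic k, V j) ∩ Set.Ioo 0 (Real.pi / 2)) ∪
    {x | 0 ∈ S ∧ x ∈ Metric.ball (0 : ℝ) (1 / (k + 1))}, ?_, ?_, ?_, ?_⟩
  · intro k
    refine (((Set.finite_Iic k).isOpen_biInter fun j _ => hV j).inter isOpen_Ioo).union ?_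
    by_cases h : (0 : ℝ) ∈ S
    · simp only [h, true_and]; exact Metric.isOpen_ball
    · simp only [h, false_and]; exact isOpen_empty
  · rintro k x (⟨-, h1, h2⟩ | ⟨-, hx⟩)
    · exact ⟨by linarith, h2⟩
    · rw [Metric.mem_ball, Real.dist_eq, sub_zero, abs_lt] at hx
      have h1 : 1 / ((k : ℝ) + 1) ≤ 1 := by
        rw [div_le_one (by positivity)]; linarith [Nat.cast_nonneg (α := ℝ) k]
      exact ⟨by linarith, by linarith⟩
  · intro s hs k
    rcases (hS hs).1.eq_or_lt with h | h
    · right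
      subst h
      exact ⟨hs, Metric.mem_ball_self (by positivity)⟩
    · left
      refine ⟨Set.mem_iInter₂.2 fun j _ => (hmem s (hS hs)).1 hs j, h, (hS hs).2⟩
  · rintro s ⟨hs, hsS⟩
    have h1 : ∃ j, s ∉ V j := by
      by_contra h; push Not at h; exact hsS ((hmem s hs).2 h)
    obtain ⟨j, hj⟩ := h1
    have hlt : 0 < Real.pi / 2 - s := sub_pos.2 hs.2
    obtain ⟨k₁, hk₁⟩ := exists_nat_one_div_lt hlt
    have h2 : ∃ k₂ : ℕ, 0 ∈ S → 1 / ((k₂ : ℝ) + 1) < s := by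
      by_cases h : (0 : ℝ) ∈ S
      · have : 0 < s := by
          rcases hs.1.eq_or_lt with h' | h'
          · subst h'; exact absurd h hsS
          · exact h'
        obtain ⟨k₂, hk₂⟩ := exists_nat_one_div_lt this
        exact ⟨k₂, fun _ => hk₂⟩
      · exact ⟨0, fun h' => absurd h' h⟩
    obtain ⟨k₂, hk₂⟩ := h2
    refine ⟨max j (max k₁ k₂), fun k hk => ?_⟩
    have hkj : j ≤ k := (le_max_left _ _).trans hk
    have hk1 : k₁ ≤ k := (le_max_left _ _).trans ((le_max_right _ _).trans hk)
    have hk2 : k₂ ≤ k := (le_max_right _ _).trans ((le_max_right _ _).trans hk)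
    have b1 : 1 / ((k : ℝ) + 1) ≤ 1 / ((k₁ : ℝ) + 1) := one_div_le_one_div_of_le (by positivity)
      (by exact_mod_cast Nat.succ_le_succ hk1)
    have b2 : 1 / ((k : ℝ) + 1) ≤ 1 / ((k₂ : ℝ) + 1) := one_div_le_one_div_of_le (by positivity)
      (by exact_mod_cast Nat.succ_le_succ hk2)
    have b3 : 1 / ((k : ℝ) + 1) ≤ 1 := by
      rw [div_le_one (by positivity)]; linarith [Nat.cast_nonneg (α := ℝ) k]
    refine ⟨?_, ?_, ?_⟩
    · rintro (⟨h, -⟩ | ⟨h0, h⟩)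
      · exact hj (Set.mem_iInter₂.1 h j hkj)
      · rw [Metric.mem_ball, Real.dist_eq, sub_zero, abs_lt] at h
        have := hk₂ h0
        linarith
    · rintro (⟨-, h, -⟩ | ⟨h0, h⟩)
      · linarith [hs.2]
      · rw [Metric.mem_ball, Real.dist_eq, sub_zero, abs_lt] at h
        linarith
    · rintro (⟨-, -, h⟩ | ⟨h0, h⟩)
      · linarith [hs.1]
      · rw [Metric.mem_ball, Real.dist_eq, sub_zero, abs_lt] at h
        linarith [hs.1]

/-- A `G_δ` set of slopes is the upper limit of a sequence of angular intervals, in such a way that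
every slope outside the set avoids, modulo `π / 2`, all but finitely many enlarged intervals. -/
lemma exists_intervals {S : Set ℝ} (hS : S ⊆ Set.Ico 0 (Real.pi / 2))
    (hG : IsGδ ((fun s : Set.Ico (0 : ℝ) (Real.pi / 2) => (s : ℝ)) ⁻¹' S)) :
    ∃ (sel : ℕ → Prop) (c t : ℕ → ℝ), (∀ j, 0 < t j) ∧ (∀ j, t j ≤ 1 / 3) ∧
      (∀ s ∈ S, ∃ᶠ j in atTop, sel j ∧ |Real.sin (s - c j)| ≤ t j * Real.cos (s - c j)) ∧
      ∀ s ∈ Set.Ico 0 (Real.pi / 2) \ S, ∀ᶠ j in atTop, sel j →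
        3 * t j * |Real.cos (s - c j)| ≤ |Real.sin (s - c j)| ∧
        3 * t j * |Real.sin (s - c j)| ≤ |Real.cos (s - c j)| := by
  obtain ⟨G, hGo, hGsub, hGS, hGc⟩ := exists_open_seq hS hG
  -- One sequence enumerates all triples (index of the open set, generation, position); `sel` keeps
  -- those which are Whitney intervals.
  set e : ℕ ≃ ℕ × ℕ × ℤ := (Denumerable.eqv (ℕ × ℕ × ℤ)).symm with he
  refine ⟨fun j => (e j).2 ∈ whitney (G (e j).1), fun j => (e j).2.2 * dyad (e j).2.1,
    fun j => 2 * dyad (e j).2.1, fun j => mul_pos two_pos (dyad_pos _),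
    fun j => by linarith [dyad_le (e j).2.1], ?_, ?_⟩
  · intro s hs
    rw [Nat.frequently_atTop_iff_infinite]
    choose q hq hqs using fun k => exists_mem_whitney (hGo k) (hGS s hs k)
    refine Set.infinite_of_injective_forall_mem (f := fun k => e.symm (k, q k)) ?_ ?_
    · intro k k' h
      have := e.symm.injective h
      exact (Prod.mk.inj this).1
    · intro k
      simp only [Set.mem_ofPred_eq, Equiv.apply_symm_apply]
      exact ⟨hq k, abs_sin_le_mul_cos (hqs k) (by linarith [dyad_le (q k).1])⟩
  · rintro s hs
    obtain ⟨k₀, hk₀⟩ := hGc s hs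
    -- Exceptional intervals. They come only from the finitely many `G k` that may contain `s` or `s
    -- ± π / 2`, and each of these has finitely many Whitney intervals nearby.
    set E : Set (ℕ × ℕ × ℤ) := ⋃ k ∈ Finset.range k₀, (fun q : ℕ × ℤ => (k, q)) ''
      ({q | q ∈ whitney (G k) ∧ |s - q.2 * dyad q.1| < 12 * dyad q.1} ∪
        ({q | q ∈ whitney (G k) ∧ |(s - Real.pi / 2) - q.2 * dyad q.1| < 12 * dyad q.1} ∪
        {q | q ∈ whitney (G k) ∧ |(s + Real.pi / 2) - q.2 * dyad q.1| < 12 * dyad q.1})) with hE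
    have hEfin : E.Finite := Set.Finite.biUnion (Finset.finite_toSet _) fun k _ =>
      (((finite_whitney_near (hGo k) s).union ((finite_whitney_near (hGo k) _).union
        (finite_whitney_near (hGo k) _)))).image _
    have hev : ∀ᶠ j in atTop, e j ∉ E := by
      rw [← Nat.cofinite_eq_atTop, eventually_cofinite]
      refine (hEfin.preimage e.injective.injOn).subset fun j hj => ?_
      simpa using hj
    filter_upwards [hev] with j hj hsel
    set k := (e j).1 with hk
    set q := (e j).2 with hq
    have hejE : e j = (k, q) := rfl
    have hd := dyad_pos q.1
    have hbound : ∀ x, (x ∉ G k ∨ k < k₀ ∧ ∃ B : Set (ℕ × ℤ), q ∉ B ∧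
        B = {q | q ∈ whitney (G k) ∧ |x - q.2 * dyad q.1| < 12 * dyad q.1}) →
        12 * dyad q.1 ≤ |x - q.2 * dyad q.1| := by
      rintro x (hx | ⟨-, B, hB, rfl⟩)
      · by_contra hlt
        push Not at hlt
        exact hx (hsel.1 (by rwa [Metric.mem_ball, Real.dist_eq]))
      · by_contra hlt
        push Not at hlt
        exact hB ⟨hsel, hlt⟩
    have hthree : 12 * dyad q.1 ≤ |s - q.2 * dyad q.1| ∧
        12 * dyad q.1 ≤ |(s - Real.pi / 2) - q.2 * dyad q.1| ∧
        12 * dyad q.1 ≤ |(s + Real.pi / 2) - q.2 * dyad q.1| := by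
      rcases le_or_gt k₀ k with hle | hlt
      · obtain ⟨h1, h2, h3⟩ := hk₀ k hle
        exact ⟨hbound _ (Or.inl h1), hbound _ (Or.inl h2), hbound _ (Or.inl h3)⟩
      · have hnot : ∀ q' ∈ _, q' ≠ q := fun q' hq' h => hj (by
          rw [hejE, ← h]
          exact Set.mem_biUnion (Finset.mem_coe.2 (Finset.mem_range.2 hlt)) ⟨q', hq', rfl⟩)
        refine ⟨hbound _ (Or.inr ⟨hlt, _, fun h => hnot q (Or.inl h) rfl, rfl⟩),
          hbound _ (Or.inr ⟨hlt, _, fun h => hnot q (Or.inr (Or.inl h)) rfl, rfl⟩),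
          hbound _ (Or.inr ⟨hlt, _, fun h => hnot q (Or.inr (Or.inr h)) rfl, rfl⟩)⟩
    obtain ⟨h1, h2, h3⟩ := hthree
    have hc := hGsub k (hsel.1 (Metric.mem_ball_self (by positivity)))
    refine transversal_of_far hd (dyad_le _) h1 ?_ ?_ ?_
    · rwa [sub_right_comm]
    · rwa [sub_add_eq_add_sub]
    · obtain ⟨c1, c2⟩ := hc
      obtain ⟨s1, s2⟩ := hs.1
      rw [abs_le]; constructor <;> linarith

/-! ### Summation of the groups. -/

/-- A summable sequence of groups: `f j` has large averages over rectangles in the directions close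
to `c j` and small averages over those in the transversal directions, and later groups are
negligible on the rectangles which witness the large averages of `f j`. -/
structure IsGroupSeq (sel : ℕ → Prop) (c t : ℕ → ℝ) (f : ℕ → ℝ × ℝ → ℝ) (M a e : ℕ → ℝ) : Prop where
  cont : ∀ j, Continuous (f j)
  compact : ∀ j, HasCompactSupport (f j)
  bound : ∀ j p, |f j p| ≤ M j
  a_pos : ∀ j, 0 < a j
  e_pos : ∀ j, 0 < e j
  e_le : ∀ j, e j ≤ (1 / 2) ^ j
  e_le_mul : ∀ i j, i < j → e j ≤ a i * (1 / 2) ^ j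
  norm_le : ∀ j, ∫ x, |f j x| ≤ e j
  good : ∀ j s, sel j → |Real.sin (s - c j)| ≤ t j * Real.cos (s - c j) →
    volume {x | x ∈ box (j : ℕ) ∧ ¬ ∃ x₀ x₁ y₀ y₁, x ∈ Rc s x₀ x₁ y₀ y₁ ∧ x₁ - x₀ ≤ e j ∧
      y₁ - y₀ ≤ e j ∧ a j ≤ (x₁ - x₀) * (y₁ - y₀) ∧
      (j + 1 + ∑ i ∈ Finset.range j, M i) * ((x₁ - x₀) * (y₁ - y₀)) ≤
        ∫ p in Rc s x₀ x₁ y₀ y₁, f j p} ≤ ENNReal.ofReal (e j)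
  bad : ∀ j s, (sel j → 3 * t j * |Real.cos (s - c j)| ≤ |Real.sin (s - c j)| ∧
      3 * t j * |Real.sin (s - c j)| ≤ |Real.cos (s - c j)|) →
    volume {x | ∃ x₀ x₁ y₀ y₁, x ∈ Rc s x₀ x₁ y₀ y₁ ∧
      e j * ((x₁ - x₀) * (y₁ - y₀)) < |∫ p in Rc s x₀ x₁ y₀ y₁, f j p|} ≤ ENNReal.ofReal (e j)

lemma Rc_lt {s x₀ x₁ y₀ y₁ : ℝ} {x : ℝ × ℝ} (h : x ∈ Rc s x₀ x₁ y₀ y₁) : x₀ < x₁ ∧ y₀ < y₁ :=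
  ⟨h.1.1.trans h.1.2, h.2.1.trans h.2.2⟩

lemma exists_isGroupSeq (sel : ℕ → Prop) (c t : ℕ → ℝ) (ht : ∀ j, 0 < t j)
    (ht' : ∀ j, t j ≤ 1 / 3) : ∃ f M a e, IsGroupSeq sel c t f M a e := by
  classical
  have key : ∀ (j : ℕ) (A : {A : ℝ // 0 < A}) (B : ℝ), ∃ (f : ℝ × ℝ → ℝ) (M : ℝ)
      (a : {A : ℝ // 0 < A}), Continuous f ∧ HasCompactSupport f ∧ (∀ p, |f p| ≤ M) ∧
      ∫ x, |f x| ≤ A * (1 / 2) ^ j ∧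
      (∀ s, sel j → |Real.sin (s - c j)| ≤ t j * Real.cos (s - c j) →
        volume {x | x ∈ box (j : ℕ) ∧ ¬ ∃ x₀ x₁ y₀ y₁, x ∈ Rc s x₀ x₁ y₀ y₁ ∧
          x₁ - x₀ ≤ A * (1 / 2) ^ j ∧ y₁ - y₀ ≤ A * (1 / 2) ^ j ∧
          a ≤ (x₁ - x₀) * (y₁ - y₀) ∧ (j + 1 + |B|) * ((x₁ - x₀) * (y₁ - y₀)) ≤
            ∫ p in Rc s x₀ x₁ y₀ y₁, f p} ≤ ENNReal.ofReal (A * (1 / 2) ^ j)) ∧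
      (∀ s, (sel j → 3 * t j * |Real.cos (s - c j)| ≤ |Real.sin (s - c j)| ∧
          3 * t j * |Real.sin (s - c j)| ≤ |Real.cos (s - c j)|) →
        volume {x | ∃ x₀ x₁ y₀ y₁, x ∈ Rc s x₀ x₁ y₀ y₁ ∧
          A * (1 / 2) ^ j * ((x₁ - x₀) * (y₁ - y₀)) < |∫ p in Rc s x₀ x₁ y₀ y₁, f p|}
            ≤ ENNReal.ofReal (A * (1 / 2) ^ j)) := by
    rintro j ⟨A, hA⟩ B
    have hε : 0 < A * (1 / 2) ^ j := by positivity
    by_cases hj : sel j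
    · obtain ⟨f, h1, h2, h3, ⟨a, ha, h4⟩, h5⟩ := exists_group (c j) (t j) (ht j) (ht' j) j hε
        (lam := j + 1 + |B|) (by positivity)
      obtain ⟨M, hM⟩ := h2.exists_bound_of_continuous h1
      exact ⟨f, M, ⟨a, ha⟩, h1, h2, hM, h3, fun s _ => h4 s, fun s h => h5 s (h hj).1 (h hj).2⟩
    · refine ⟨fun _ => 0, 0, ⟨1, one_pos⟩, continuous_const, HasCompactSupport.zero, by simp,
        by simpa using hε.le, fun s h => absurd h hj, fun s _ => ?_⟩
      refine le_of_eq_of_le ?_ bot_le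
      rw [ENNReal.bot_eq_zero]
      convert measure_empty (μ := (volume : Measure (ℝ × ℝ)))
      ext x
      simp only [Set.mem_ofPred_eq, Set.mem_empty_iff_false, iff_false, integral_zero, abs_zero,
        not_exists, not_and, not_lt]
      intro x₀ x₁ y₀ y₁ hx
      obtain ⟨h1, h2⟩ := Rc_lt hx
      exact mul_nonneg hε.le (mul_nonneg (sub_pos.2 h1).le (sub_pos.2 h2).le)
  choose F N α hF1 hF2 hF3 hF4 hF5 hF6 using key
  -- The state carries the minimum of `1` and all earlier area bounds `a i`, and the sum of all
  -- earlier sup bounds `M i`.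
  let st : ℕ → {A : ℝ // 0 < A} × ℝ := fun n => Nat.rec (⟨1, one_pos⟩, 0)
    (fun j p => (⟨min p.1.1 (α j p.1 p.2).1, lt_min p.1.2 (α j p.1 p.2).2⟩, p.2 + N j p.1 p.2)) n
  have st1 : ∀ j, ((st (j + 1)).1 : ℝ) = min (st j).1.1 (α j (st j).1 (st j).2).1 := fun _ => rfl
  have st2 : ∀ j, (st (j + 1)).2 = (st j).2 + N j (st j).1 (st j).2 := fun _ => rfl
  have hanti : Antitone fun j => ((st j).1 : ℝ) :=
    antitone_nat_of_succ_le fun j => (st1 j).trans_le (min_le_left _ _)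
  have hN : ∀ j, 0 ≤ N j (st j).1 (st j).2 := fun j =>
    (abs_nonneg _).trans (hF3 j (st j).1 (st j).2 0)
  have hsum : ∀ j, (st j).2 = ∑ i ∈ Finset.range j, N i (st i).1 (st i).2 := by
    intro j
    induction j with
    | zero => rfl
    | succ j ih => rw [st2, Finset.sum_range_succ, ← ih]
  have hpos : ∀ j : ℕ, (0 : ℝ) < (1 / 2) ^ j := fun j => by positivity
  refine ⟨fun j => F j (st j).1 (st j).2, fun j => N j (st j).1 (st j).2,
    fun j => (α j (st j).1 (st j).2).1, fun j => (st j).1 * (1 / 2) ^ j,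
    fun j => hF1 _ _ _, fun j => hF2 _ _ _, fun j => hF3 _ _ _, fun j => (α _ _ _).2,
    fun j => mul_pos (st j).1.2 (hpos j), fun j => ?_, fun i j hij => ?_, fun j => hF4 _ _ _,
    fun j s h1 h2 => ?_, fun j s h => hF6 _ _ _ s h⟩
  · exact mul_le_of_le_one_left (hpos j).le (hanti (Nat.zero_le j))
  · refine mul_le_mul_of_nonneg_right ?_ (hpos j).le
    exact (hanti (show i + 1 ≤ j from hij)).trans ((st1 i).trans_le (min_le_right _ _))
  · have hB : |(st j).2| = ∑ i ∈ Finset.range j, N i (st i).1 (st i).2 := by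
      rw [hsum, abs_of_nonneg (Finset.sum_nonneg fun i _ => hN i)]
    have := hF5 j (st j).1 (st j).2 s h1 h2
    rwa [hB] at this

lemma ae_eventually_notMem_of_le {T : ℕ → Set (ℝ × ℝ)} {e : ℕ → ℝ} (he : ∀ j, e j ≤ (1 / 2) ^ j)
    (hT : ∀ j, volume (T j) ≤ ENNReal.ofReal (e j)) :
    ∀ᵐ x ∂(volume : Measure (ℝ × ℝ)), ∀ᶠ j in atTop, x ∉ T j := by
  refine ae_eventually_notMem (ne_top_of_le_ne_top
    (summable_geometric_two.tsum_ofReal_ne_top) (ENNReal.tsum_le_tsum fun j => ?_))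
  exact (hT j).trans (ENNReal.ofReal_le_ofReal (he j))

lemma abs_sub_sum_range_le {g : ℕ → ℝ} {G C : ℝ} (hg : HasSum g G) {J : ℕ}
    (h : ∀ j ≥ J, |g j| ≤ C * (1 / 2) ^ j) :
    |G - ∑ j ∈ Finset.range J, g j| ≤ 2 * C * (1 / 2) ^ J := by
  have h1 := (hasSum_nat_add_iff' J).2 hg
  refine h1.norm_le_of_bounded (g := fun i => C * (1 / 2) ^ J * (1 / 2) ^ i) ?_ fun i => ?_
  · have := hasSum_geometric_two.mul_left (C * (1 / 2) ^ J)
    rwa [show 2 * C * (1 / 2) ^ J = C * (1 / 2) ^ J * 2 by ring]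
  · rw [mul_assoc, ← pow_add, add_comm J i]
    exact h _ (Nat.le_add_left _ _)

lemma abs_setIntegral_Rc_sub_le {f : ℝ × ℝ → ℝ} (hf : Continuous f) (s : ℝ) (x : ℝ × ℝ) {η : ℝ}
    (hη : 0 < η) : ∃ δ > 0, ∀ a b c d, x ∈ Rc s a b c d → b - a < δ → d - c < δ →
      |(∫ p in Rc s a b c d, f p) - f x * ((b - a) * (d - c))| ≤ η * ((b - a) * (d - c)) := by
  obtain ⟨ρ, hρ, hfρ⟩ := Metric.continuous_iff.1 hf x η hη
  refine ⟨ρ / 3, by positivity, fun a b c d hx hb hd => ?_⟩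
  obtain ⟨hab, hcd⟩ := Rc_lt hx
  have hnear : ∀ p ∈ Rc s a b c d, |f p - f x| ≤ η := by
    intro p hp
    refine (hfρ p ?_).le
    have h1 : |al s (p - x)| ≤ ρ / 3 := by
      rw [al_sub, abs_le]; constructor <;> linarith [hp.1.1, hp.1.2, hx.1.1, hx.1.2]
    have h2 : |ac s (p - x)| ≤ ρ / 3 := by
      rw [ac_sub, abs_le]; constructor <;> linarith [hp.2.1, hp.2.2, hx.2.1, hx.2.2]
    have h3 := abs_fst_le s h1 h2
    have h4 := abs_snd_le s h1 h2
    rw [Prod.dist_eq, Real.dist_eq, Real.dist_eq]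
    exact max_lt (by simpa using h3.trans_lt (by linarith)) (by simpa using h4.trans_lt (by linarith))
  have hv : volume (Rc s a b c d) ≠ ⊤ := (volume_Rc_lt_top s a b c d).ne
  have hint : IntegrableOn f (Rc s a b c d) := by
    refine Measure.integrableOn_of_bounded (M := |f x| + η) hv hf.aestronglyMeasurable ?_
    refine (ae_restrict_iff' (measurableSet_Rc s a b c d)).2 (Eventually.of_forall fun p hp => ?_)
    have := abs_sub_abs_le_abs_sub (f p) (f x)
    rw [Real.norm_eq_abs]; linarith [hnear p hp]
  have e : (∫ p in Rc s a b c d, f p) - f x * ((b - a) * (d - c))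
      = ∫ p in Rc s a b c d, (f p - f x) := by
    rw [integral_sub hint (integrableOn_const hv), setIntegral_const, smul_eq_mul,
      volume_real_Rc hab.le hcd.le, mul_comm (f x)]
  have := norm_setIntegral_le_of_norm_le_const (volume_Rc_lt_top s a b c d)
    (f := fun p => f p - f x) (C := η) hnear
  rwa [volume_real_Rc hab.le hcd.le, Real.norm_eq_abs, ← e] at this

namespace IsGroupSeq

variable {sel : ℕ → Prop} {c t : ℕ → ℝ} {f : ℕ → ℝ × ℝ → ℝ} {M a e : ℕ → ℝ}

lemma integrable (h : IsGroupSeq sel c t f M a e) (j : ℕ) : Integrable (f j) :=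
  (h.cont j).integrable_of_hasCompactSupport (h.compact j)

lemma summable_e (h : IsGroupSeq sel c t f M a e) : Summable e :=
  summable_geometric_two.of_nonneg_of_le (fun j => (h.e_pos j).le) h.e_le

lemma integrable_tsum (h : IsGroupSeq sel c t f M a e) : Integrable fun x => ∑' j, f j x := by
  refine ⟨(Measurable.tsum fun j => (h.cont j).measurable).aestronglyMeasurable, ?_⟩
  have h1 : ∫⁻ x, ‖∑' j, f j x‖ₑ ≤ ∑' j, ENNReal.ofReal (e j) := by
    calc ∫⁻ x, ‖∑' j, f j x‖ₑ ≤ ∫⁻ x, ∑' j, ‖f j x‖ₑ :=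
          lintegral_mono fun x => enorm_tsum_le_tsum_enorm
      _ = ∑' j, ∫⁻ x, ‖f j x‖ₑ := lintegral_tsum fun j => (h.cont j).measurable.enorm.aemeasurable
      _ ≤ ∑' j, ENNReal.ofReal (e j) := by
          refine ENNReal.tsum_le_tsum fun j => ?_
          rw [← ofReal_integral_norm_eq_lintegral_enorm (h.integrable j)]
          exact ENNReal.ofReal_le_ofReal (h.norm_le j)
  exact h1.trans_lt h.summable_e.tsum_ofReal_ne_top.lt_top

lemma abs_setIntegral_le (h : IsGroupSeq sel c t f M a e) (j : ℕ) (A : Set (ℝ × ℝ)) :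
    |∫ x in A, f j x| ≤ e j :=
  (abs_integral_le_integral_abs.trans (setIntegral_le_integral (h.integrable j).abs
    (Eventually.of_forall fun _ => abs_nonneg _))).trans (h.norm_le j)

lemma hasSum_setIntegral (h : IsGroupSeq sel c t f M a e) (A : Set (ℝ × ℝ)) :
    HasSum (fun j => ∫ x in A, f j x) (∫ x in A, ∑' j, f j x) := by
  refine hasSum_integral_of_summable_integral_norm (fun j => (h.integrable j).integrableOn)
    (h.summable_e.of_nonneg_of_le (fun j => integral_nonneg fun _ => norm_nonneg _) fun j => ?_)
  exact (setIntegral_le_integral (h.integrable j).norm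
    (Eventually.of_forall fun _ => norm_nonneg _)).trans (h.norm_le j)

lemma ae_differentiates (h : IsGroupSeq sel c t f M a e) {s : ℝ}
    (hs : ∀ᶠ j in atTop, sel j → 3 * t j * |Real.cos (s - c j)| ≤ |Real.sin (s - c j)| ∧
      3 * t j * |Real.sin (s - c j)| ≤ |Real.cos (s - c j)|) :
    ∀ᵐ x ∂(volume : Measure (ℝ × ℝ)), ∀ η > 0, ∃ δ > 0, ∀ x₀ x₁ y₀ y₁, x ∈ Rc s x₀ x₁ y₀ y₁ →
      x₁ - x₀ < δ → y₁ - y₀ < δ →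
      |(∫ p in Rc s x₀ x₁ y₀ y₁, ∑' j, f j p) - (∑' j, f j x) * ((x₁ - x₀) * (y₁ - y₀))| ≤
        η * ((x₁ - x₀) * (y₁ - y₀)) := by
  -- Putting the transversality condition inside the set makes the sets of the finitely many
  -- non-transversal indices empty, so the measure bound holds for every index.
  have hbc := ae_eventually_notMem_of_le h.e_le (T := fun j => {x |
    (sel j → 3 * t j * |Real.cos (s - c j)| ≤ |Real.sin (s - c j)| ∧
      3 * t j * |Real.sin (s - c j)| ≤ |Real.cos (s - c j)|) ∧
    ∃ x₀ x₁ y₀ y₁, x ∈ Rc s x₀ x₁ y₀ y₁ ∧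
      e j * ((x₁ - x₀) * (y₁ - y₀)) < |∫ p in Rc s x₀ x₁ y₀ y₁, f j p|}) fun j => by
    by_cases hj : sel j → 3 * t j * |Real.cos (s - c j)| ≤ |Real.sin (s - c j)| ∧
      3 * t j * |Real.sin (s - c j)| ≤ |Real.cos (s - c j)|
    · exact (measure_mono fun x hx => hx.2).trans (h.bad j s hj)
    · exact (measure_mono_null (fun x hx => hj hx.1) measure_empty).trans_le bot_le
  filter_upwards [hbc] with x hx η hη
  obtain ⟨J, hJ⟩ := eventually_atTop.1 (hx.and hs)
  have hR : ∀ j ≥ J, ∀ x₀ x₁ y₀ y₁, x ∈ Rc s x₀ x₁ y₀ y₁ →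
      |∫ p in Rc s x₀ x₁ y₀ y₁, f j p| ≤ (1 / 2) ^ j * ((x₁ - x₀) * (y₁ - y₀)) := by
    intro j hj x₀ x₁ y₀ y₁ hxR
    obtain ⟨h1, h2⟩ := hJ j hj
    have h3 : |∫ p in Rc s x₀ x₁ y₀ y₁, f j p| ≤ e j * ((x₁ - x₀) * (y₁ - y₀)) := by
      by_contra hcon
      exact h1 ⟨h2, x₀, x₁, y₀, y₁, hxR, not_le.1 hcon⟩
    obtain ⟨h4, h5⟩ := Rc_lt hxR
    exact h3.trans (mul_le_mul_of_nonneg_right (h.e_le j)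
      (mul_nonneg (sub_pos.2 h4).le (sub_pos.2 h5).le))
  -- The averages bound the values: `f j` is continuous, so `f j x` is the limit of its averages
  -- over rectangles shrinking to `x`.
  have hfx : ∀ j ≥ J, |f j x| ≤ (1 / 2) ^ j := by
    intro j hj
    refine le_of_forall_pos_le_add fun κ hκ => ?_
    obtain ⟨δ, hδ, hδR⟩ := abs_setIntegral_Rc_sub_le (h.cont j) s x hκ
    have hxR : x ∈ Rc s (al s x - δ / 3) (al s x + δ / 3) (ac s x - δ / 3) (ac s x + δ / 3) :=
      ⟨⟨by linarith, by linarith⟩, by linarith, by linarith⟩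
    have h1 := hδR _ _ _ _ hxR (by linarith) (by linarith)
    have h2 := hR j hj _ _ _ _ hxR
    set v := (al s x + δ / 3 - (al s x - δ / 3)) * (ac s x + δ / 3 - (ac s x - δ / 3)) with hv
    have hv0 : 0 < v := by
      rw [hv]; exact mul_pos (by linarith) (by linarith)
    have h3 : |f j x * v| ≤ (1 / 2) ^ j * v + κ * v := by
      rw [abs_le] at h1 h2 ⊢
      constructor <;> linarith [h1.1, h1.2, h2.1, h2.2]
    rw [abs_mul, abs_of_pos hv0, ← add_mul] at h3
    exact le_of_mul_le_mul_right h3 hv0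
  have hsum : HasSum (fun j => f j x) (∑' j, f j x) := by
    refine Summable.hasSum ?_
    rw [← summable_nat_add_iff J]
    exact ((summable_nat_add_iff J).2 summable_geometric_two).of_norm_bounded
      fun i => hfx _ (Nat.le_add_left _ _)
  obtain ⟨L, hL⟩ := exists_pow_lt_of_lt_one (show 0 < η / 8 by positivity)
    (show (1 / 2 : ℝ) < 1 by norm_num)
  set J' := max J L with hJ'
  have hJL : (1 / 2 : ℝ) ^ J' ≤ η / 8 :=
    (pow_le_pow_of_le_one (by norm_num) (by norm_num) (le_max_right J L)).trans hL.le
  have hη' : 0 < η / (2 * (J' + 1)) := by positivity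
  choose D hD hDR using fun j => abs_setIntegral_Rc_sub_le (h.cont j) s x hη'
  obtain ⟨δ, hδ, hδD⟩ : ∃ δ > 0, ∀ j ∈ Finset.range (J' + 1), δ ≤ D j := by
    obtain ⟨i, -, hi⟩ := Finset.exists_min_image (Finset.range (J' + 1)) D ⟨0, by simp⟩
    exact ⟨D i, hD i, hi⟩
  refine ⟨δ, hδ, fun x₀ x₁ y₀ y₁ hxR h1 h2 => ?_⟩
  obtain ⟨h3, h4⟩ := Rc_lt hxR
  set v := (x₁ - x₀) * (y₁ - y₀) with hv
  have hv0 : 0 < v := mul_pos (by linarith) (by linarith)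
  -- The error splits at `J'`: the tail is uniformly small by the maximal bounds, and the finite
  -- head by continuity once the rectangle is small.
  have hg := (h.hasSum_setIntegral (Rc s x₀ x₁ y₀ y₁)).sub (hsum.mul_right v)
  have htail := abs_sub_sum_range_le hg (J := J') (C := 2 * v) fun j hj => by
    have hj' : j ≥ J := (le_max_left J L).trans hj
    have h5 := hR j hj' _ _ _ _ hxR
    have h6 : |f j x * v| ≤ (1 / 2) ^ j * v := by
      rw [abs_mul, abs_of_pos hv0]
      exact mul_le_mul_of_nonneg_right (hfx j hj') hv0.le
    rw [abs_le] at h5 h6 ⊢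
    constructor <;> linarith [h5.1, h5.2, h6.1, h6.2]
  have hhead : |∑ j ∈ Finset.range J', ((∫ p in Rc s x₀ x₁ y₀ y₁, f j p) - f j x * v)|
      ≤ η / 2 * v := by
    calc |∑ j ∈ Finset.range J', ((∫ p in Rc s x₀ x₁ y₀ y₁, f j p) - f j x * v)|
        ≤ ∑ j ∈ Finset.range J', |(∫ p in Rc s x₀ x₁ y₀ y₁, f j p) - f j x * v| :=
          Finset.abs_sum_le_sum_abs _ _
      _ ≤ ∑ j ∈ Finset.range J', η / (2 * (J' + 1)) * v := by
          refine Finset.sum_le_sum fun j hj => ?_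
          have hjD := hδD j (Finset.mem_range.2 (by have := Finset.mem_range.1 hj; omega))
          exact hDR j _ _ _ _ hxR (h1.trans_le hjD) (h2.trans_le hjD)
      _ = J' / (J' + 1) * (η / 2 * v) := by
          rw [Finset.sum_const, Finset.card_range, nsmul_eq_mul]; field_simp
      _ ≤ η / 2 * v := by
          refine mul_le_of_le_one_left (by positivity) ?_
          rw [div_le_one (by positivity)]; linarith
  have h7 : 2 * (2 * v) * (1 / 2) ^ J' ≤ η / 2 * v := by nlinarith
  rw [abs_le] at htail hhead ⊢
  constructor <;> linarith [htail.1, htail.2, hhead.1, hhead.2]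

lemma ae_large_averages (h : IsGroupSeq sel c t f M a e) {s : ℝ}
    (hs : ∃ᶠ j in atTop, sel j ∧ |Real.sin (s - c j)| ≤ t j * Real.cos (s - c j)) :
    ∀ᵐ x ∂(volume : Measure (ℝ × ℝ)), ∀ (N : ℕ), ∀ δ > 0, ∃ x₀ x₁ y₀ y₁, x ∈ Rc s x₀ x₁ y₀ y₁ ∧
      x₁ - x₀ < δ ∧ y₁ - y₀ < δ ∧
      N * ((x₁ - x₀) * (y₁ - y₀)) ≤ ∫ p in Rc s x₀ x₁ y₀ y₁, ∑' j, f j p := by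
  have hbc := ae_eventually_notMem_of_le h.e_le (T := fun j => {x |
    (sel j ∧ |Real.sin (s - c j)| ≤ t j * Real.cos (s - c j)) ∧
    x ∈ box (j : ℕ) ∧ ¬ ∃ x₀ x₁ y₀ y₁, x ∈ Rc s x₀ x₁ y₀ y₁ ∧ x₁ - x₀ ≤ e j ∧
      y₁ - y₀ ≤ e j ∧ a j ≤ (x₁ - x₀) * (y₁ - y₀) ∧
      (j + 1 + ∑ i ∈ Finset.range j, M i) * ((x₁ - x₀) * (y₁ - y₀)) ≤
        ∫ p in Rc s x₀ x₁ y₀ y₁, f j p}) fun j => by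
    by_cases hj : sel j ∧ |Real.sin (s - c j)| ≤ t j * Real.cos (s - c j)
    · exact (measure_mono fun x hx => hx.2).trans (h.good j s hj.1 hj.2)
    · exact (measure_mono_null (fun x hx => hj hx.1) measure_empty).trans_le bot_le
  filter_upwards [hbc] with x hx N δ hδ
  obtain ⟨L, hL⟩ := exists_pow_lt_of_lt_one hδ (show (1 / 2 : ℝ) < 1 by norm_num)
  obtain ⟨m, hm⟩ := exists_nat_gt (|x.1| + |x.2|)
  obtain ⟨j, hgood, hnot, hjm⟩ := (hs.and_eventually
    (hx.and (eventually_ge_atTop (max (max N L) m)))).exists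
  have hjN : (N : ℝ) ≤ j := by
    exact_mod_cast ((le_max_left N L).trans (le_max_left _ m)).trans hjm
  have hjm' : (m : ℝ) ≤ j := by exact_mod_cast (le_max_right _ m).trans hjm
  have hej : e j < δ := (h.e_le j).trans_lt ((pow_le_pow_of_le_one (by norm_num) (by norm_num)
    (((le_max_right N L).trans (le_max_left _ m)).trans hjm)).trans_lt hL)
  have hbox : x ∈ box (j : ℕ) := by
    have h1 := abs_lt.1 (show |x.1| < (j : ℝ) by linarith [abs_nonneg x.2])
    have h2 := abs_lt.1 (show |x.2| < (j : ℝ) by linarith [abs_nonneg x.1])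
    exact ⟨⟨h1.1.le, h1.2⟩, h2.1.le, h2.2⟩
  have hex := not_not.1 fun hcon => hnot ⟨hgood, hbox, hcon⟩
  obtain ⟨x₀, x₁, y₀, y₁, hxR, h1, h2, h3, h4⟩ := hex
  refine ⟨x₀, x₁, y₀, y₁, hxR, h1.trans_lt hej, h2.trans_lt hej, ?_⟩
  obtain ⟨h5, h6⟩ := Rc_lt hxR
  have hvol := volume_real_Rc (s := s) h5.le h6.le
  set v := (x₁ - x₀) * (y₁ - y₀) with hv
  have hv0 : 0 < v := mul_pos (by linarith) (by linarith)
  -- Later groups have total mass small compared with `a j`, which is at most the area of the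
  -- witnessing rectangle; so they lower the average by at most `1`.
  have htail := abs_sub_sum_range_le (h.hasSum_setIntegral (Rc s x₀ x₁ y₀ y₁)) (J := j + 1)
    (C := v) fun i hi => (h.abs_setIntegral_le i _).trans ((h.e_le_mul j i hi).trans
      (mul_le_mul_of_nonneg_right h3 (by positivity)))
  have hhead : |∑ i ∈ Finset.range j, ∫ p in Rc s x₀ x₁ y₀ y₁, f i p|
      ≤ (∑ i ∈ Finset.range j, M i) * v := by
    refine (Finset.abs_sum_le_sum_abs _ _).trans ?_
    rw [Finset.sum_mul]
    refine Finset.sum_le_sum fun i _ => ?_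
    have := norm_setIntegral_le_of_norm_le_const (volume_Rc_lt_top s x₀ x₁ y₀ y₁)
      (f := f i) (C := M i) fun p _ => h.bound i p
    rwa [hvol] at this
  -- Group `j` gives average at least `j + 1 + ∑ M i`; earlier groups cost `∑ M i` and later ones
  -- `1`, leaving at least `j ≥ N`.
  rw [Finset.sum_range_succ] at htail
  have h7 : 2 * v * (1 / 2) ^ (j + 1) ≤ v := by
    rw [pow_succ]
    have : (1 / 2 : ℝ) ^ j ≤ 1 := pow_le_one₀ (by norm_num) (by norm_num)
    nlinarith
  have h8 : (N : ℝ) * v ≤ j * v := mul_le_mul_of_nonneg_right hjN hv0.le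
  rw [abs_le] at htail hhead
  linarith [htail.1, hhead.1]

end IsGroupSeq

/-- For a `G_δ` set of slopes there is an integrable function whose integral is differentiated
exactly in the complementary directions. -/
theorem exists_integrable_of_isGδ {S : Set ℝ} (hS : S ⊆ Set.Ico 0 (Real.pi / 2))
    (hG : IsGδ ((fun s : Set.Ico (0 : ℝ) (Real.pi / 2) => (s : ℝ)) ⁻¹' S)) :
    ∃ F : ℝ × ℝ → ℝ, Integrable F ∧
      (∀ s ∈ Set.Ico 0 (Real.pi / 2) \ S, ∀ᵐ x ∂(volume : Measure (ℝ × ℝ)), ∀ η > 0, ∃ δ > 0,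
        ∀ x₀ x₁ y₀ y₁, x ∈ Rc s x₀ x₁ y₀ y₁ → x₁ - x₀ < δ → y₁ - y₀ < δ →
          |(∫ p in Rc s x₀ x₁ y₀ y₁, F p) - F x * ((x₁ - x₀) * (y₁ - y₀))| ≤
            η * ((x₁ - x₀) * (y₁ - y₀))) ∧
      ∀ s ∈ S, ∀ᵐ x ∂(volume : Measure (ℝ × ℝ)), ∀ (N : ℕ), ∀ δ > 0, ∃ x₀ x₁ y₀ y₁,
        x ∈ Rc s x₀ x₁ y₀ y₁ ∧ x₁ - x₀ < δ ∧ y₁ - y₀ < δ ∧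
          N * ((x₁ - x₀) * (y₁ - y₀)) ≤ ∫ p in Rc s x₀ x₁ y₀ y₁, F p := by
  obtain ⟨sel, c, t, h1, h2, h3, h4⟩ := exists_intervals hS hG
  obtain ⟨f, M, a, e, h⟩ := exists_isGroupSeq sel c t h1 h2
  exact ⟨_, h.integrable_tsum, fun s hs => h.ae_differentiates (h4 s hs),
    fun s hs => h.ae_large_averages (h3 s hs)⟩

/-! ### Necessity of the `G_δ` condition. -/

lemma ae_al_ne (s a : ℝ) : ∀ᵐ p ∂(volume : Measure (ℝ × ℝ)), al s p ≠ a := by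
  rw [ae_iff]
  have : {p : ℝ × ℝ | ¬ al s p ≠ a} = rot s ⁻¹' ({a} ×ˢ Set.univ) := by
    ext p; simp [rot_apply]
  rw [this, volume_rot_preimage, volume_prod_set, Real.volume_singleton, zero_mul]

lemma ae_ac_ne (s a : ℝ) : ∀ᵐ p ∂(volume : Measure (ℝ × ℝ)), ac s p ≠ a := by
  filter_upwards [ae_al_ne (s + Real.pi / 2) a] with p hp
  rwa [al_add_pi_div_two] at hp

lemma continuous_al_left (p : ℝ × ℝ) : Continuous fun s => al s p := by
  unfold al; fun_prop

lemma continuous_ac_left (p : ℝ × ℝ) : Continuous fun s => ac s p := by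
  unfold ac; fun_prop

lemma eventually_mem_Ioo_iff {g : ℝ → ℝ} (hg : Continuous g) {s a b : ℝ} (ha : g s ≠ a)
    (hb : g s ≠ b) : ∀ᶠ r in 𝓝 s, (g r ∈ Set.Ioo a b ↔ g s ∈ Set.Ioo a b) := by
  by_cases h : g s ∈ Set.Ioo a b
  · filter_upwards [hg.continuousAt.eventually (isOpen_Ioo.mem_nhds h)] with r hr
    exact iff_of_true hr h
  · have h' : g s ∈ (Set.Icc a b)ᶜ := fun h2 => h ⟨lt_of_le_of_ne h2.1 ha.symm, lt_of_le_of_ne h2.2 hb⟩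
    filter_upwards [hg.continuousAt.eventually (isClosed_Icc.isOpen_compl.mem_nhds h')] with r hr
    exact iff_of_false (fun h2 => hr (Set.Ioo_subset_Icc_self h2)) h

/-- Away from the four lines bounding the rectangle, a null set, the indicator at a given point is
locally constant in the slope. Dominated convergence with bound `|F|` concludes. -/
lemma continuous_setIntegral_Rc {F : ℝ × ℝ → ℝ} (hF : Integrable F) (a b c d : ℝ) :
    Continuous fun s => ∫ p in Rc s a b c d, F p := by
  rw [continuous_iff_continuousAt]
  intro s
  have e : ∀ r, ∫ p in Rc r a b c d, F p = ∫ p, (Rc r a b c d).indicator F p := fun r =>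
    (integral_indicator (measurableSet_Rc r a b c d)).symm
  simp only [ContinuousAt, e]
  refine tendsto_integral_filter_of_dominated_convergence (fun p => |F p|)
    (Eventually.of_forall fun r =>
      hF.aestronglyMeasurable.indicator (measurableSet_Rc r a b c d))
    (Eventually.of_forall fun r => Eventually.of_forall fun p => norm_indicator_le_norm_self _ _)
    hF.abs ?_
  filter_upwards [ae_al_ne s a, ae_al_ne s b, ae_ac_ne s c, ae_ac_ne s d] with p h1 h2 h3 h4
  refine tendsto_const_nhds.congr' ?_
  filter_upwards [eventually_mem_Ioo_iff (continuous_al_left p) h1 h2,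
    eventually_mem_Ioo_iff (continuous_ac_left p) h3 h4] with r h5 h6
  have h7 : p ∈ Rc r a b c d ↔ p ∈ Rc s a b c d := and_congr h5 h6
  by_cases h : p ∈ Rc s a b c d
  · rw [Set.indicator_of_mem h, Set.indicator_of_mem (h7.2 h)]
  · rw [Set.indicator_of_notMem h, Set.indicator_of_notMem (mt h7.1 h)]

/-- The points lying in a rectangle of slope `s` and sides less than `1 / (n + 1)` over which the
average of `F` exceeds `n`. -/
def largeAverageSet (F : ℝ × ℝ → ℝ) (n : ℕ) (s : ℝ) : Set (ℝ × ℝ) :=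
  {x | ∃ a b c d, x ∈ Rc s a b c d ∧ b - a < 1 / (n + 1) ∧ d - c < 1 / (n + 1) ∧
    n * ((b - a) * (d - c)) < ∫ p in Rc s a b c d, F p}

lemma isOpen_largeAverageSet (F : ℝ × ℝ → ℝ) (n : ℕ) (s : ℝ) : IsOpen (largeAverageSet F n s) := by
  rw [isOpen_iff_mem_nhds]
  rintro x ⟨a, b, c, d, hx, h⟩
  filter_upwards [(isOpen_Rc s a b c d).mem_nhds hx] with y hy
  exact ⟨a, b, c, d, hy, h⟩

lemma antitone_largeAverageSet (F : ℝ × ℝ → ℝ) (s : ℝ) :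
    Antitone fun n => largeAverageSet F n s := by
  rintro m n hmn x ⟨a, b, c, d, hx, h1, h2, h3⟩
  have h4 : (1 : ℝ) / (n + 1) ≤ 1 / (m + 1) := by gcongr
  obtain ⟨h5, h6⟩ := Rc_lt hx
  refine ⟨a, b, c, d, hx, h1.trans_le h4, h2.trans_le h4, lt_of_le_of_lt ?_ h3⟩
  have : 0 < (b - a) * (d - c) := mul_pos (by linarith) (by linarith)
  gcongr

lemma eventually_mem_largeAverageSet {F : ℝ × ℝ → ℝ} (hF : Integrable F) {n : ℕ} {s : ℝ}
    {x : ℝ × ℝ} (hx : x ∈ largeAverageSet F n s) : ∀ᶠ r in 𝓝 s, x ∈ largeAverageSet F n r := by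
  obtain ⟨a, b, c, d, hx, h1, h2, h3⟩ := hx
  filter_upwards [(continuous_al_left x).continuousAt.eventually (isOpen_Ioo.mem_nhds hx.1),
    (continuous_ac_left x).continuousAt.eventually (isOpen_Ioo.mem_nhds hx.2),
    (continuous_setIntegral_Rc hF a b c d).continuousAt.eventually (lt_mem_nhds h3)]
    with r h4 h5 h6
  exact ⟨a, b, c, d, ⟨h4, h5⟩, h1, h2, h6⟩

lemma isOpen_setOf_lt_volume_largeAverageSet {F : ℝ × ℝ → ℝ} (hF : Integrable F) (n : ℕ)
    (B : Set (ℝ × ℝ)) (v : ENNReal) : IsOpen {s | v < volume (B ∩ largeAverageSet F n s)} := by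
  rw [Metric.isOpen_iff]
  intro s hs
  -- Points that stay in the set for all slopes within `1 / (m + 1)` of `s`. They exhaust the set,
  -- so one `m` already has measure above `v`, uniformly over that ball of slopes. No measurability
  -- is needed for continuity from below.
  set U : ℕ → Set (ℝ × ℝ) := fun m =>
    B ∩ {x | ∀ r ∈ Metric.ball s (1 / (m + 1)), x ∈ largeAverageSet F n r} with hU
  have hmono : Monotone U := by
    intro m k hmk x hx
    refine ⟨hx.1, fun r hr => hx.2 r (Metric.ball_subset_ball ?_ hr)⟩
    gcongr
  have hsub : B ∩ largeAverageSet F n s ⊆ ⋃ m, U m := by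
    rintro x ⟨hxB, hx⟩
    obtain ⟨ρ, hρ, h⟩ := Metric.eventually_nhds_iff.1 (eventually_mem_largeAverageSet hF hx)
    obtain ⟨m, hm⟩ := exists_nat_one_div_lt hρ
    exact Set.mem_iUnion.2 ⟨m, hxB, fun r hr => h ((Metric.mem_ball.1 hr).trans hm)⟩
  have hlt : v < ⨆ m, volume (U m) := by
    rw [← hmono.measure_iUnion]
    exact lt_of_lt_of_le hs (measure_mono hsub)
  obtain ⟨m, hm⟩ := lt_iSup_iff.1 hlt
  refine ⟨1 / (m + 1), Nat.one_div_pos_of_nat, fun r hr => hm.trans_le (measure_mono ?_)⟩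
  exact fun x hx => ⟨hx.1, hx.2 r hr⟩

theorem isGδ_of_integrable {S : Set ℝ} {F : ℝ × ℝ → ℝ} (hF : Integrable F)
    (hd : ∀ s ∈ Set.Ico 0 (Real.pi / 2) \ S, ∀ᵐ x ∂(volume : Measure (ℝ × ℝ)), ∀ η > 0, ∃ δ > 0,
      ∀ x₀ x₁ y₀ y₁, x ∈ Rc s x₀ x₁ y₀ y₁ → x₁ - x₀ < δ → y₁ - y₀ < δ →
        |(∫ p in Rc s x₀ x₁ y₀ y₁, F p) - F x * ((x₁ - x₀) * (y₁ - y₀))| ≤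
          η * ((x₁ - x₀) * (y₁ - y₀)))
    (hu : ∀ s ∈ S, ∀ᵐ x ∂(volume : Measure (ℝ × ℝ)), ∀ (N : ℕ), ∀ δ > 0, ∃ x₀ x₁ y₀ y₁,
      x ∈ Rc s x₀ x₁ y₀ y₁ ∧ x₁ - x₀ < δ ∧ y₁ - y₀ < δ ∧
        N * ((x₁ - x₀) * (y₁ - y₀)) ≤ ∫ p in Rc s x₀ x₁ y₀ y₁, F p) :
    IsGδ ((fun s : Set.Ico (0 : ℝ) (Real.pi / 2) => (s : ℝ)) ⁻¹' S) := by
  set B : Set (ℝ × ℝ) := Set.Ioo 0 1 ×ˢ Set.Ioo 0 1 with hB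
  have hBvol : volume B = 1 := by
    rw [hB, volume_prod_set, Real.volume_Ioo]; simp
  have hBo : IsOpen B := isOpen_Ioo.prod isOpen_Ioo
  have hhalf : (2⁻¹ : ENNReal) < 1 := ENNReal.inv_lt_one.2 ENNReal.one_lt_two
  have key : ∀ s ∈ Set.Ico 0 (Real.pi / 2),
      s ∈ S ↔ ∀ n, s ∈ {s | 2⁻¹ < volume (B ∩ largeAverageSet F n s)} := by
    intro s hs
    constructor
    · intro hsS n
      have hsub : (B ∩ largeAverageSet F n s : Set _) =ᵐ[volume] B := by
        refine inter_ae_eq_left_of_ae_eq_univ ?_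
        refine eventuallyEq_univ.2 ?_
        filter_upwards [hu s hsS] with x hx
        -- Asking for average `n + 1` yields the strict inequality with `n`.
        obtain ⟨a, b, c, d, h1, h2, h3, h4⟩ := hx (n + 1) (1 / (n + 1)) Nat.one_div_pos_of_nat
        refine ⟨a, b, c, d, h1, h2, h3, lt_of_lt_of_le ?_ h4⟩
        obtain ⟨h5, h6⟩ := Rc_lt h1
        have : 0 < (b - a) * (d - c) := mul_pos (by linarith) (by linarith)
        push_cast
        linarith
      rw [Set.mem_ofPred_eq, measure_congr hsub, hBvol]
      exact hhalf
    · intro h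
      by_contra hsS
      -- At a point of differentiability small rectangles have averages at most `F x + 1`, which
      -- excludes averages above every `n`. The measures therefore tend to zero and cannot all
      -- exceed one half.
      have hnull : volume (⋂ n, B ∩ largeAverageSet F n s) = 0 := by
        refine measure_mono_null ?_ (ae_iff.1 (hd s ⟨hs, hsS⟩))
        intro x hx hcon
        rw [Set.mem_iInter] at hx
        obtain ⟨δ, hδ, hR⟩ := hcon 1 one_pos
        obtain ⟨k, hk⟩ := exists_nat_one_div_lt hδ
        obtain ⟨m, hm⟩ := exists_nat_gt (F x + 1)
        obtain ⟨-, a, b, c, d, h1, h2, h3, h4⟩ := hx (max k m)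
        obtain ⟨h5, h6⟩ := Rc_lt h1
        have hv : 0 < (b - a) * (d - c) := mul_pos (by linarith) (by linarith)
        have hkm : (1 : ℝ) / ((max k m : ℕ) + 1) ≤ 1 / (k + 1) := by
          gcongr; exact le_max_left _ _
        have hm' : (m : ℝ) ≤ (max k m : ℕ) := by exact_mod_cast le_max_right _ _
        have h7 := (abs_le.1 (hR a b c d h1 (by linarith) (by linarith))).2
        nlinarith
      have htend := tendsto_measure_iInter_atTop (μ := volume)
        (fun n => (hBo.inter (isOpen_largeAverageSet F n s)).measurableSet.nullMeasurableSet)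
        (fun m n hmn => Set.inter_subset_inter_right B (antitone_largeAverageSet F s hmn))
        ⟨0, ((measure_mono Set.inter_subset_left).trans_lt
          (hBvol.trans_lt ENNReal.one_lt_top)).ne⟩
      rw [hnull] at htend
      have := ge_of_tendsto' htend fun n => (h n).le
      simp at this
  have e : (fun s : Set.Ico (0 : ℝ) (Real.pi / 2) => (s : ℝ)) ⁻¹' S =
      ⋂ n, (fun s : Set.Ico (0 : ℝ) (Real.pi / 2) => (s : ℝ)) ⁻¹'
        {s | 2⁻¹ < volume (B ∩ largeAverageSet F n s)} := by
    ext s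
    rw [Set.mem_iInter]
    exact key s s.2
  rw [e]
  exact .iInter_of_isOpen fun n =>
    (isOpen_setOf_lt_volume_largeAverageSet hF n B _).preimage continuous_subtype_val

/-! ### Transfer between `Plane` and `ℝ × ℝ`. -/

/-- The plane in Cartesian coordinates. -/
noncomputable def planeEquiv : Plane ≃ᵐ ℝ × ℝ :=
  (MeasurableEquiv.toLp 2 (Fin 2 → ℝ)).symm.trans MeasurableEquiv.finTwoArrow

lemma planeEquiv_apply (x : Plane) : planeEquiv x = (x 0, x 1) := rfl

lemma measurePreserving_planeEquiv : MeasurePreserving planeEquiv volume volume :=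
  (volume_preserving_finTwoArrow ℝ).comp
    (EuclideanSpace.volume_preserving_symm_measurableEquiv_toLp (Fin 2))

lemma ae_planeEquiv_iff {P : ℝ × ℝ → Prop} :
    (∀ᵐ x ∂(volume : Measure Plane), P (planeEquiv x)) ↔
      ∀ᵐ p ∂(volume : Measure (ℝ × ℝ)), P p := by
  rw [← measurePreserving_planeEquiv.map_eq, planeEquiv.measurableEmbedding.ae_map_iff]

lemma mem_rectBasis_iff {s : ℝ} {R : Set Plane} :
    R ∈ rectBasis s ↔ ∃ a b c d, a < b ∧ c < d ∧ R = planeEquiv ⁻¹' Rc s a b c d := Iff.rfl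

lemma setAverage_planeEquiv_preimage (F : ℝ × ℝ → ℝ) {s a b c d : ℝ} (hab : a < b) (hcd : c < d) :
    ⨍ y in planeEquiv ⁻¹' Rc s a b c d, (F ∘ planeEquiv) y =
      (∫ p in Rc s a b c d, F p) / ((b - a) * (d - c)) := by
  rw [setAverage_eq, measureReal_def, measurePreserving_planeEquiv.measure_preimage_equiv,
    ← measureReal_def, volume_real_Rc hab.le hcd.le, smul_eq_mul, div_eq_inv_mul]
  congr 1
  exact measurePreserving_planeEquiv.setIntegral_preimage_emb planeEquiv.measurableEmbedding F _

lemma dist_sq_eq_al_ac (s : ℝ) (x y : Plane) :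
    dist x y ^ 2 = (al s (planeEquiv x) - al s (planeEquiv y)) ^ 2 +
      (ac s (planeEquiv x) - ac s (planeEquiv y)) ^ 2 := by
  rw [EuclideanSpace.dist_eq, Real.sq_sqrt (by positivity)]
  simp only [Fin.sum_univ_two, Real.dist_eq, sq_abs, planeEquiv_apply, al, ac]
  have := Real.cos_sq_add_sin_sq s
  linear_combination (-(x 0 - y 0) ^ 2 - (x 1 - y 1) ^ 2) * this

lemma dist_le_of_mem_Rc {s a b c d : ℝ} {x y : Plane} (hx : planeEquiv x ∈ Rc s a b c d)
    (hy : planeEquiv y ∈ Rc s a b c d) : dist x y ≤ (b - a) + (d - c) := by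
  obtain ⟨hab, hcd⟩ := Rc_lt hx
  refine abs_le_of_sq_le_sq' ?_ (by linarith) |>.2
  rw [dist_sq_eq_al_ac s]
  have h1 : (al s (planeEquiv x) - al s (planeEquiv y)) ^ 2 ≤ (b - a) ^ 2 :=
    sq_le_sq' (by linarith [hx.1.1, hy.1.2]) (by linarith [hx.1.2, hy.1.1])
  have h2 : (ac s (planeEquiv x) - ac s (planeEquiv y)) ^ 2 ≤ (d - c) ^ 2 :=
    sq_le_sq' (by linarith [hx.2.1, hy.2.2]) (by linarith [hx.2.2, hy.2.1])
  nlinarith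

lemma isBounded_preimage_Rc (s a b c d : ℝ) :
    Bornology.IsBounded (planeEquiv ⁻¹' Rc s a b c d) :=
  Metric.isBounded_iff.2 ⟨_, fun _ hx _ hy => dist_le_of_mem_Rc hx hy⟩

lemma exists_planeEquiv_al_ac (s u v : ℝ) :
    ∃ x : Plane, al s (planeEquiv x) = u ∧ ac s (planeEquiv x) = v := by
  refine ⟨planeEquiv.symm ((rot s).symm (u, v)), ?_⟩
  rw [planeEquiv.apply_symm_apply]
  have : rot s ((rot s).symm (u, v)) = (u, v) := (rot s).apply_symm_apply _
  rw [rot_apply] at this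
  exact Prod.ext_iff.1 this

lemma sides_le_diam {s a b c d : ℝ} (hab : a < b) (hcd : c < d) :
    b - a ≤ 2 * Metric.diam (planeEquiv ⁻¹' Rc s a b c d) ∧
      d - c ≤ 2 * Metric.diam (planeEquiv ⁻¹' Rc s a b c d) := by
  -- The rectangle is open, so its corners are not available; the points at one and three quarters
  -- of each side cost only the factor `2`.
  obtain ⟨x, hx1, hx2⟩ := exists_planeEquiv_al_ac s (a + (b - a) / 4) (c + (d - c) / 4)
  obtain ⟨y, hy1, hy2⟩ := exists_planeEquiv_al_ac s (a + 3 * (b - a) / 4) (c + 3 * (d - c) / 4)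
  have hxR : planeEquiv x ∈ Rc s a b c d := by
    refine ⟨?_, ?_⟩
    · rw [hx1]; constructor <;> linarith
    · rw [hx2]; constructor <;> linarith
  have hyR : planeEquiv y ∈ Rc s a b c d := by
    refine ⟨?_, ?_⟩
    · rw [hy1]; constructor <;> linarith
    · rw [hy2]; constructor <;> linarith
  have hd := Metric.dist_le_diam_of_mem (isBounded_preimage_Rc s a b c d) hxR hyR
  have hsq := dist_sq_eq_al_ac s x y
  rw [hx1, hx2, hy1, hy2] at hsq
  have h0 := dist_nonneg (x := x) (y := y)
  have h1 : (b - a) / 2 ≤ dist x y := by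
    refine (abs_le_of_sq_le_sq' ?_ h0).2
    rw [hsq]; nlinarith [sq_nonneg (d - c)]
  have h2 : (d - c) / 2 ≤ dist x y := by
    refine (abs_le_of_sq_le_sq' ?_ h0).2
    rw [hsq]; nlinarith [sq_nonneg (b - a)]
  constructor <;> linarith

/-- Diameter and side lengths control each other up to constant factors, so the filter can be read
off from the sides. -/
lemma eventually_rectFilter_iff {s : ℝ} {x : Plane} {Q : Set Plane → Prop} :
    (∀ᶠ R in rectFilter s x, Q R) ↔ ∃ δ > 0, ∀ a b c d, planeEquiv x ∈ Rc s a b c d →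
      b - a < δ → d - c < δ → Q (planeEquiv ⁻¹' Rc s a b c d) := by
  rw [rectFilter, ((Metric.nhds_basis_ball.comap _).inf_principal _).eventually_iff]
  constructor
  · rintro ⟨δ, hδ, h⟩
    refine ⟨δ / 3, by positivity, fun a b c d hx hb hd => h ⟨?_, ?_, hx⟩⟩
    · rw [Set.mem_preimage, Metric.mem_ball, Real.dist_eq, sub_zero, abs_of_nonneg Metric.diam_nonneg]
      obtain ⟨hab, hcd⟩ := Rc_lt hx
      have := Metric.diam_le_of_forall_dist_le (s := planeEquiv ⁻¹' Rc s a b c d)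
        (C := (b - a) + (d - c)) (by linarith) fun y hy z hz => dist_le_of_mem_Rc hy hz
      linarith
    · obtain ⟨hab, hcd⟩ := Rc_lt hx
      exact mem_rectBasis_iff.2 ⟨a, b, c, d, hab, hcd, rfl⟩
  · rintro ⟨δ, hδ, h⟩
    refine ⟨δ / 2, by positivity, ?_⟩
    rintro R ⟨hR, hRb, hx⟩
    obtain ⟨a, b, c, d, hab, hcd, rfl⟩ := mem_rectBasis_iff.1 hRb
    rw [Set.mem_preimage, Metric.mem_ball, Real.dist_eq, sub_zero,
      abs_of_nonneg Metric.diam_nonneg] at hR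
    obtain ⟨h1, h2⟩ := sides_le_diam (s := s) hab hcd
    exact h a b c d hx (by linarith) (by linarith)

lemma differentiatesIntegral_iff {s : ℝ} {F : ℝ × ℝ → ℝ} :
    DifferentiatesIntegral s (F ∘ planeEquiv) ↔
      ∀ᵐ x ∂(volume : Measure (ℝ × ℝ)), ∀ η > 0, ∃ δ > 0, ∀ x₀ x₁ y₀ y₁,
        x ∈ Rc s x₀ x₁ y₀ y₁ → x₁ - x₀ < δ → y₁ - y₀ < δ →
          |(∫ p in Rc s x₀ x₁ y₀ y₁, F p) - F x * ((x₁ - x₀) * (y₁ - y₀))| ≤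
            η * ((x₁ - x₀) * (y₁ - y₀)) := by
  rw [← ae_planeEquiv_iff, DifferentiatesIntegral]
  refine eventually_congr (Eventually.of_forall fun x => ?_)
  rw [Metric.nhds_basis_closedBall.tendsto_right_iff]
  refine forall_congr' fun η => forall_congr' fun hη => ?_
  rw [eventually_rectFilter_iff]
  refine exists_congr fun δ => and_congr_right fun hδ => forall_congr' fun a => forall_congr' fun b =>
    forall_congr' fun c => forall_congr' fun d => forall_congr' fun hx => forall_congr' fun _ =>
    forall_congr' fun _ => ?_
  obtain ⟨hab, hcd⟩ := Rc_lt hx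
  have hv : 0 < (b - a) * (d - c) := mul_pos (by linarith) (by linarith)
  rw [setAverage_planeEquiv_preimage F hab hcd, Metric.mem_closedBall, Real.dist_eq,
    Function.comp_apply, ← mul_le_mul_iff_left₀ hv]
  nth_rewrite 2 [← abs_of_pos hv]
  rw [← abs_mul, sub_mul, div_mul_cancel₀ _ hv.ne']

/-- An infinite upper limit means that every natural number is reached frequently along the filter;
multiplying by the area clears the average. -/
lemma upperDerivative_eq_top_iff {s : ℝ} {F : ℝ × ℝ → ℝ} {x : Plane} :
    upperDerivative s (F ∘ planeEquiv) x = ⊤ ↔ ∀ (N : ℕ), ∀ δ > 0, ∃ x₀ x₁ y₀ y₁,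
      planeEquiv x ∈ Rc s x₀ x₁ y₀ y₁ ∧ x₁ - x₀ < δ ∧ y₁ - y₀ < δ ∧
        N * ((x₁ - x₀) * (y₁ - y₀)) ≤ ∫ p in Rc s x₀ x₁ y₀ y₁, F p := by
  have h1 : upperDerivative s (F ∘ planeEquiv) x = ⊤ ↔ ∀ N : ℕ, ∃ᶠ R in rectFilter s x,
      (N : ℝ) ≤ ⨍ y in R, (F ∘ planeEquiv) y := by
    constructor
    · intro h N hcon
      have : upperDerivative s (F ∘ planeEquiv) x ≤ ((N : ℝ) : EReal) := by
        refine limsup_le_of_le (h := ?_)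
        filter_upwards [hcon] with R hR
        exact EReal.coe_le_coe_iff.2 (not_le.1 hR).le
      rw [h, top_le_iff] at this
      exact EReal.coe_ne_top _ this
    · intro h
      rw [EReal.eq_top_iff_forall_lt]
      intro y
      obtain ⟨N, hN⟩ := exists_nat_gt y
      refine (EReal.coe_lt_coe_iff.2 hN).trans_le ?_
      exact le_limsup_of_frequently_le ((h N).mono fun R hR => EReal.coe_le_coe_iff.2 hR)
  rw [h1]
  refine forall_congr' fun N => ?_
  rw [Filter.Frequently, eventually_rectFilter_iff]
  push Not
  refine forall_congr' fun δ => forall_congr' fun hδ => exists_congr fun a => exists_congr fun b =>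
    exists_congr fun c => exists_congr fun d => and_congr_right fun hx => and_congr_right fun _ =>
    and_congr_right fun _ => ?_
  obtain ⟨hab, hcd⟩ := Rc_lt hx
  have hv : 0 < (b - a) * (d - c) := mul_pos (by linarith) (by linarith)
  rw [setAverage_planeEquiv_preimage F hab hcd, le_div_iff₀ hv]

theorem theorem1 (S : Set ℝ) (hS : S ⊆ Set.Ico 0 (Real.pi / 2)) :
    IsRSet S ↔
      IsGδ ((fun s : Set.Ico (0 : ℝ) (Real.pi / 2) => (s : ℝ)) ⁻¹' S) := by
  constructor
  · rintro ⟨f, hf, hd, hu⟩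
    obtain ⟨F, rfl⟩ : ∃ F : ℝ × ℝ → ℝ, f = F ∘ planeEquiv :=
      ⟨f ∘ planeEquiv.symm, by ext x; simp⟩
    rw [measurePreserving_planeEquiv.integrable_comp_emb planeEquiv.measurableEmbedding] at hf
    refine isGδ_of_integrable hf (fun s hs => differentiatesIntegral_iff.1 (hd s hs))
      fun s hs => ae_planeEquiv_iff.1 ?_
    filter_upwards [hu s hs] with x hx
    exact upperDerivative_eq_top_iff.1 hx
  · intro hG
    obtain ⟨F, hF, hd, hu⟩ := exists_integrable_of_isGδ hS hG
    refine ⟨F ∘ planeEquiv, ?_, fun s hs => differentiatesIntegral_iff.2 (hd s hs), fun s hs => ?_⟩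
    · rwa [measurePreserving_planeEquiv.integrable_comp_emb planeEquiv.measurableEmbedding]
    · filter_upwards [ae_planeEquiv_iff.2 (hu s hs)] with x hx
      exact upperDerivative_eq_top_iff.2 hx
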